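/- Let $\mathcal X$ be a unitary fusion category with its canonical unitary spherical structure: every object $c$ has a dual $\bar c$ with $\mathrm{coev}_c:1\to c\otimes\bar c$ and $\mathrm{ev}_c:\bar c\otimes c\to 1$ satisfying the zigzag identities and $\mathrm{ev}_c(\mathrm{id}\otimes f)\mathrm{ev}_c^\dagger=\mathrm{coev}_c^\dagger(f\otimes \mathrm{id})\mathrm{coev}_c=:\mathrm{tr}(f)$ for all $f:c\to c$; put $d_c=\mathrm{tr}(\mathrm{id}_c)$. Let $\mathrm{Irr}(\mathcal X)$ be a set of representatives of the simple objects. Let $\Lambda\subset\mathbb Z^2$ be a finite set of vertices of the square lattice that is a contractible patch, i.e. the planar complex formed by $\Lambda$, all lattice edges with both ends in $\Lambda$, and all plaquettes with four corners in $\Lambda$ is contractible. Let $\#p$ be its number of plaquettes. Edges are directed rightwards and upwards. To each $v\in\Lambda$ attach $$\mathcal H_v=\bigoplus_{w,x,y,z\in\mathrm{Irr}(\mathcal X)}\mathcal X(w\otimes x\to y\otimes z),\qquad \langle f|g\rangle=\frac{\mathrm{tr}(f^\dagger g)}{\sqrt{d_wd_xd_yd_z}},$$ where $w,x,y,z$ label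 the half-edges at $v$ to the left, bottom, top and right, and different labels are orthogonal. For an edge $\ell$ with both ends in $\Lambda$ let $A_\ell$ be the projector of $\bigotimes_{v\in\Lambda}\mathcal H_v$ onto the states whose labels on the two halves of $\ell$ agree, and let $P_A$ be the projection onto the ground-state space (least eigenspace) of $-\sum_\ell A_\ell$. The external edges are those with exactly one end in $\Lambda$. A boundary condition is a map $x$ from the external edges to $\mathrm{Irr}(\mathcal X)$; write $\vec x$ for the tensor product, over the external edges in counterclockwise order starting at any chosen one of them, of the labels $x_i$ for edges entering $\Lambda$ and of their duals $\overline{x_i}$ for edges leaving $\Lambda$. Let $F:Z(\mathcal X)\to\mathcal X$ be the forgetful functor from the Drinfeld center, $I$ a right adjoint of $F$, and $\varepsilon:FI(1_{\mathcal X})\to 1_{\mathcal X}$ the counit. For $j\in\mathrm{Irr}(\mathcal X)$ let $$\pi_j:FI(1_{\mathcal X})\xrightarrow{\mathrm{id}\otimes\mathrm{coev}_j}FI(1_{\mathcal X})\otimes j\otimes\bar j\xrightarrow{\text{half-braiding}}j\otimes FI(1_{\mathcal X})\otimes\bar j\xrightarrow{\mathrm{id}\otimes\varepsilon\otimes\mathrm{id}}j\otimes\bar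 j,$$ the components of the identification $FI(1_{\mathcal X})\cong\bigoplus_j j\otimes\bar j$. Equip $\mathcal X(\vec x\to FI(1_{\mathcal X})^{\otimes \#p})$ with the skein module inner product $$\langle f|g\rangle=\sum_{j_1,\dots,j_{\#p}\in\mathrm{Irr}(\mathcal X)}\frac{\mathrm{tr}\big((\pi_{\vec\jmath}f)^\dagger(\pi_{\vec\jmath}\,g)\big)}{d_{j_1}\cdots d_{j_{\#p}}\sqrt{\prod_i d_{x_i}}},\qquad \pi_{\vec\jmath}=\pi_{j_1}\otimes\cdots\otimes\pi_{j_{\#p}}.$$ Then there is a unitary (a linear bijection preserving the inner products) $$P_A\bigotimes_{v\in\Lambda}\mathcal H_v\;\cong\;\bigoplus_{x}\mathcal X\big(\vec x\to FI(1_{\mathcal X})^{\otimes\#p}\big),$$ the orthogonal direct sum running over all boundary conditions $x$, under which the states with boundary condition $x$ correspond exactly to the summand of $x$. -/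

import Mathlib

open CategoryTheory MonoidalCategory Limits
open scoped TensorProduct ComplexConjugate

universe v u w

noncomputable section

namespace StringNet

/-! ### Unitary fusion categories -/

section Category

attribute [local instance] Abelian.hasFiniteBiproducts

/-- A unitary fusion category: a semisimple `ℂ`-linear abelian rigid monoidal category with
finite-dimensional hom spaces, finitely many isomorphism classes of simple objects and a simple
unit, together with a `C⋆` dagger structure compatible with the monoidal structure. In
`f ≫ dag f` (which is `f† ∘ f` in the usual order) composition is written from left to right. -/
class UnitaryFusionCategory (C : Type u) [Category.{v} C] [Abelian C] [Linear ℂ C]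
    [MonoidalCategory C] [MonoidalPreadditive C] [MonoidalLinear ℂ C] where
  /-- the dagger `f ↦ f†` -/
  dag : ∀ {X Y : C}, (X ⟶ Y) → (Y ⟶ X)
  dag_dag : ∀ {X Y : C} (f : X ⟶ Y), dag (dag f) = f
  dag_comp : ∀ {X Y Z : C} (f : X ⟶ Y) (g : Y ⟶ Z), dag (f ≫ g) = dag g ≫ dag f
  dag_add : ∀ {X Y : C} (f g : X ⟶ Y), dag (f + g) = dag f + dag g
  dag_smul : ∀ {X Y : C} (a : ℂ) (f : X ⟶ Y), dag (a • f) = conj a • dag f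
  dag_tensorHom : ∀ {X Y X' Y' : C} (f : X ⟶ Y) (g : X' ⟶ Y'),
    dag (f ⊗ₘ g) = dag f ⊗ₘ dag g
  dag_associator : ∀ X Y Z : C, dag (α_ X Y Z).hom = (α_ X Y Z).inv
  dag_leftUnitor : ∀ X : C, dag (λ_ X).hom = (λ_ X).inv
  dag_rightUnitor : ∀ X : C, dag (ρ_ X).hom = (ρ_ X).inv
  faithful : ∀ {X Y : C} (f : X ⟶ Y), f ≫ dag f = 0 → f = 0
  positive : ∀ {X Y : C} (f : X ⟶ Y), ∃ g : X ⟶ X, f ≫ dag f = g ≫ dag g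
  finiteDimensional : ∀ X Y : C, FiniteDimensional ℂ (X ⟶ Y)
  semisimple : ∀ X : C, ∃ (n : ℕ) (s : Fin n → C),
    (∀ i, Simple (s i)) ∧ Nonempty (X ≅ ⨁ s)
  finite_simples : ∃ (n : ℕ) (s : Fin n → C), ∀ X : C, Simple X → ∃ i, Nonempty (X ≅ s i)
  simple_unit : Simple (𝟙_ C)
  rigid : Nonempty (RigidCategory C)


variable {C : Type u} [Category.{v} C] [Abelian C] [Linear ℂ C]
  [MonoidalCategory C] [MonoidalPreadditive C] [MonoidalLinear ℂ C]

/-- `S : ι → C` is a complete irredundant list of the simple objects, that is, `ι` indexes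
`Irr(C)`. -/
structure IsIrr {ι : Type w} (S : ι → C) : Prop where
  simple : ∀ i, Simple (S i)
  eq_of_iso : ∀ i j, Nonempty (S i ≅ S j) → i = j
  exists_iso : ∀ X : C, Simple X → ∃ i, Nonempty (X ≅ S i)

/-- `X₀ ⊗ (X₁ ⊗ (⋯ ⊗ 𝟙))`. -/
def tensorFam : (n : ℕ) → (Fin n → C) → C
  | 0, _ => 𝟙_ C
  | n + 1, X => X 0 ⊗ tensorFam n fun k => X k.succ

/-- `f₀ ⊗ (f₁ ⊗ (⋯ ⊗ 𝟙))`. -/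
def tensorFamMap : (n : ℕ) → {X Y : Fin n → C} → (∀ k, X k ⟶ Y k) →
    (tensorFam n X ⟶ tensorFam n Y)
  | 0, _, _, _ => 𝟙 (𝟙_ C)
  | n + 1, _, _, f => f 0 ⊗ₘ tensorFamMap n fun k => f k.succ

/-- `A ^ ⊗ n`. -/
def tensorPow (A : C) (n : ℕ) : C := tensorFam n fun _ => A

/-- The scalar `c` with `f = c • 𝟙`, for an endomorphism `f` of the tensor unit: as `End(𝟙)` is
one-dimensional, it is the trace of the composition operator `g ↦ g ≫ f`. -/
def scal : (𝟙_ C ⟶ 𝟙_ C) →ₗ[ℂ] ℂ :=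
  LinearMap.trace ℂ (𝟙_ C ⟶ 𝟙_ C) ∘ₗ (Linear.comp (𝟙_ C) (𝟙_ C) (𝟙_ C)).flip

variable [UnitaryFusionCategory C]

/-- A standard dual of `c`: an object `c̄` with `coev : 𝟙 ⟶ c ⊗ c̄` and `ev : c̄ ⊗ c ⟶ 𝟙`
satisfying the zigzag identities, for which the left and right traces
`coev† ∘ (f ⊗ 𝟙) ∘ coev` and `ev ∘ (𝟙 ⊗ f) ∘ ev†` of each endomorphism `f` of `c` agree. -/
structure StandardDual (c : C) where
  dual : C
  pairing : ExactPairing c dual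
  balanced : ∀ f : c ⟶ c,
    pairing.coevaluation' ≫ f ▷ dual ≫ UnitaryFusionCategory.dag pairing.coevaluation' =
      UnitaryFusionCategory.dag pairing.evaluation' ≫ dual ◁ f ≫ pairing.evaluation'

variable (C) in
/-- The canonical unitary spherical structure, presented by a standard dual of each object
(standard duals are unique up to unique unitary isomorphism). -/
abbrev SphericalStructure := ∀ c : C, StandardDual c

variable (D : SphericalStructure C)

/-- The dual object `c̄`. -/
def bar (c : C) : C := (D c).dual

/-- The cup `𝟙 ⟶ c ⊗ c̄`. -/
def coev (c : C) : 𝟙_ C ⟶ c ⊗ bar D c := (D c).pairing.coevaluation'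

/-- The categorical (spherical) trace of an endomorphism. -/
def tr {c : C} (f : c ⟶ c) : ℂ :=
  scal (coev D c ≫ f ▷ bar D c ≫ UnitaryFusionCategory.dag (coev D c))

/-- The quantum dimension `d_c`. -/
def dim (c : C) : ℝ := (tr D (𝟙 c)).re

/-- `tr(f† ∘ g)`. -/
def trInner {a b : C} (f g : a ⟶ b) : ℂ := tr D (g ≫ UnitaryFusionCategory.dag f)

lemma tr_add {c : C} (f g : c ⟶ c) : tr D (f + g) = tr D f + tr D g := by
  simp [tr]

lemma tr_smul {c : C} (a : ℂ) (f : c ⟶ c) : tr D (a • f) = a * tr D f := by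
  simp [tr]

end Category

/-! ### Patches of the square lattice -/

section Lattice

/-- The four directions at a vertex of the square lattice. -/
inductive Dir
  | east | north | west | south
  deriving DecidableEq

namespace Dir

instance : Fintype Dir := ⟨{east, north, west, south}, fun d => by cases d <;> simp⟩

/-- The unit vector in a direction. -/
def vec : Dir → ℤ × ℤ
  | east => (1, 0)
  | north => (0, 1)
  | west => (-1, 0)
  | south => (0, -1)

/-- The next direction in counterclockwise order. -/
def next : Dir → Dir
  | east => north
  | north => west
  | west => south
  | south => east

/-- The opposite direction. -/
def opp : Dir → Dir
  | east => west
  | north => south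
  | west => east
  | south => north

/-- Edges are directed to the right and upwards. -/
def IsOutgoing (d : Dir) : Prop := d = east ∨ d = north

instance : DecidablePred IsOutgoing := fun d => inferInstanceAs (Decidable (d = east ∨ d = north))

end Dir

/-- A patch, given by its set of vertices, seen as an induced subgraph of the square lattice. -/
def patchGraph (V : Finset (ℤ × ℤ)) : SimpleGraph V where
  Adj p q := ∃ d : Dir, q.1 = p.1 + d.vec
  symm := ⟨by
    rintro ⟨p, _⟩ ⟨q, _⟩ ⟨d, h⟩
    refine ⟨d.opp, ?_⟩
    simp only at h ⊢
    subst h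
    cases d <;> simp [Dir.opp, Dir.vec, add_assoc]⟩
  loopless := ⟨by
    rintro ⟨p, _⟩ ⟨d, h⟩
    have h2 : d.vec = 0 := by simpa using h
    cases d <;> simp [Dir.vec, Prod.ext_iff] at h2⟩

/-- Homotopy of edge paths, generated by cancelling backtracks and by pushing a path across a
square `p q s q'` all of whose corners are in the graph. In the square lattice two different
vertices with two different common neighbours are opposite corners of a plaquette, so that the
squares are exactly the plaquettes. -/
inductive WalkHomotopic {α : Type*} (G : SimpleGraph α) :
    ∀ {p s : α}, G.Walk p s → G.Walk p s → Prop
  | refl {p s : α} (a : G.Walk p s) : WalkHomotopic G a a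
  | symm {p s : α} {a b : G.Walk p s} : WalkHomotopic G a b → WalkHomotopic G b a
  | trans {p s : α} {a b c : G.Walk p s} :
      WalkHomotopic G a b → WalkHomotopic G b c → WalkHomotopic G a c
  | cons {p q s : α} (h : G.Adj p q) {a b : G.Walk q s} :
      WalkHomotopic G a b → WalkHomotopic G (.cons h a) (.cons h b)
  | backtrack {p q s : α} (h : G.Adj p q) (a : G.Walk p s) :
      WalkHomotopic G (.cons h (.cons h.symm a)) a
  | square {p q q' s t : α} (h₁ : G.Adj p q) (h₂ : G.Adj q s) (h₁' : G.Adj p q')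
      (h₂' : G.Adj q' s) (a : G.Walk s t) :
      WalkHomotopic G (.cons h₁ (.cons h₂ a)) (.cons h₁' (.cons h₂' a))

/-- The patch, a planar complex with its vertices, edges and (filled) plaquettes, is contractible:
it is non-empty, connected and simply connected. -/
structure IsContractiblePatch (V : Finset (ℤ × ℤ)) : Prop where
  connected : (patchGraph V).Connected
  simplyConnected : ∀ (p q : V) (a b : (patchGraph V).Walk p q),
    WalkHomotopic (patchGraph V) a b

/-- The number `#p` of plaquettes with all four corners in the patch (indexed by their lower left
corners). -/
def numPlaquettes (V : Finset (ℤ × ℤ)) : ℕ :=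
  (V.filter fun p => p + (1, 0) ∈ V ∧ p + (0, 1) ∈ V ∧ p + (1, 1) ∈ V).card

/-- The internal edges of the patch, given by tail and direction. -/
abbrev Edge (V : Finset (ℤ × ℤ)) :=
  {h : V × Dir // h.2.IsOutgoing ∧ h.1.1 + h.2.vec ∈ V}

/-- The head of an internal edge. -/
def Edge.head {V : Finset (ℤ × ℤ)} (l : Edge V) : V := ⟨l.1.1.1 + l.1.2.vec, l.2.2⟩

/-- The external edges of the patch, given by their vertex in the patch and the direction in which
they leave it. -/
abbrev Leg (V : Finset (ℤ × ℤ)) := {h : V × Dir // h.1.1 + h.2.vec ∉ V}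

/-- One step around the outside of the patch, on half-edges: turn counterclockwise at the vertex
to the next half-edge, and go to its other end if it is internal. -/
def turn (V : Finset (ℤ × ℤ)) (h : V × Dir) : V × Dir :=
  if hm : h.1.1 + h.2.next.vec ∈ V then (⟨h.1.1 + h.2.next.vec, hm⟩, h.2.next.opp)
  else (h.1, h.2.next)

/-- The external edges of the patch in counterclockwise order, beginning with `b`. -/
def legList {V : Finset (ℤ × ℤ)} (b : Leg V) : List (Leg V) :=
  (List.range (Function.minimalPeriod (turn V) b.1)).filterMap fun k =>
    if hk : ((turn V)^[k] b.1).1.1 + ((turn V)^[k] b.1).2.vec ∉ V then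
      some ⟨(turn V)^[k] b.1, hk⟩ else none

end Lattice

/-! ### Tensor products of spaces with sesquilinear forms -/

section TensorForm

variable {κ : Type*} [Fintype κ] {H : κ → Type*} [∀ k, AddCommGroup (H k)] [∀ k, Module ℂ (H k)]

/-- `y ↦ ∏ B (xₖ, yₖ)`, as a linear functional on the tensor product. -/
def pureForm (B : ∀ k, H k →ₗ⋆[ℂ] H k →ₗ[ℂ] ℂ) (x : ∀ k, H k) : (⨂[ℂ] k, H k) →ₗ[ℂ] ℂ :=
  PiTensorProduct.lift ((MultilinearMap.mkPiAlgebra ℂ κ ℂ).compLinearMap fun k => B k (x k))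

lemma pureForm_tprod (B : ∀ k, H k →ₗ⋆[ℂ] H k →ₗ[ℂ] ℂ) (x y : ∀ k, H k) :
    pureForm B x (PiTensorProduct.tprod ℂ y) = ∏ k, B k (x k) (y k) := by
  simp [pureForm]

lemma prod_update [DecidableEq κ] (B : ∀ k, H k →ₗ⋆[ℂ] H k →ₗ[ℂ] ℂ) (x y : ∀ k, H k) (i : κ)
    (c : H i) : ∏ k, B k (Function.update x i c k) (y k) =
      B i c (y i) * ∏ k ∈ Finset.univ.erase i, B k (x k) (y k) := by
  rw [← Finset.mul_prod_erase _ _ (Finset.mem_univ i), Function.update_self]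
  congr 1
  exact Finset.prod_congr rfl fun k hk => by
    rw [Function.update_of_ne (Finset.ne_of_mem_erase hk)]

lemma pureForm_update_add [DecidableEq κ] (B : ∀ k, H k →ₗ⋆[ℂ] H k →ₗ[ℂ] ℂ) (x : ∀ k, H k)
    (i : κ) (a b : H i) : pureForm B (Function.update x i (a + b)) =
      pureForm B (Function.update x i a) + pureForm B (Function.update x i b) := by
  ext y
  simp only [LinearMap.compMultilinearMap_apply, LinearMap.add_apply, pureForm_tprod, prod_update,
    map_add, add_mul]

lemma pureForm_update_smul [DecidableEq κ] (B : ∀ k, H k →ₗ⋆[ℂ] H k →ₗ[ℂ] ℂ) (x : ∀ k, H k)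
    (i : κ) (r : ℂ) (a : H i) : pureForm B (Function.update x i (r • a)) =
      conj r • pureForm B (Function.update x i a) := by
  ext y
  simp only [LinearMap.compMultilinearMap_apply, LinearMap.smul_apply, pureForm_tprod, prod_update,
    map_smulₛₗ, smul_eq_mul, mul_assoc]

/-- The complex conjugate of `pureForm`, as a multilinear map of its first argument. -/
def conjForm (B : ∀ k, H k →ₗ⋆[ℂ] H k →ₗ[ℂ] ℂ) :
    MultilinearMap ℂ H ((⨂[ℂ] k, H k) →ₗ⋆[ℂ] ℂ) where
  toFun x :=
    { toFun := fun y => conj (pureForm B x y)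
      map_add' := by simp
      map_smul' := by simp }
  map_update_add' x i a b := by
    apply LinearMap.ext
    intro y
    simp [pureForm_update_add]
  map_update_smul' x i r a := by
    apply LinearMap.ext
    intro y
    simp [pureForm_update_smul]

/-- The form on a tensor product with `⟨⊗ xₖ, ⊗ yₖ⟩ = ∏ Bₖ(xₖ, yₖ)`. -/
def tensorForm (B : ∀ k, H k →ₗ⋆[ℂ] H k →ₗ[ℂ] ℂ) (x y : ⨂[ℂ] k, H k) : ℂ :=
  conj (PiTensorProduct.lift (conjForm B) x y)

lemma tensorForm_tprod (B : ∀ k, H k →ₗ⋆[ℂ] H k →ₗ[ℂ] ℂ) (x y : ∀ k, H k) :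
    tensorForm B (PiTensorProduct.tprod ℂ x) (PiTensorProduct.tprod ℂ y) =
      ∏ k, B k (x k) (y k) := by
  simp [tensorForm, conjForm, pureForm_tprod]

end TensorForm

/-! ### The string net model on a patch -/

section Model

variable {C : Type u} [Category.{v} C] [Abelian C] [Linear ℂ C]
  [MonoidalCategory C] [MonoidalPreadditive C] [MonoidalLinear ℂ C]
  [UnitaryFusionCategory C] (D : SphericalStructure C)
  {ι : Type w} [Fintype ι] [DecidableEq ι] (S : ι → C)

/-- The local space `H_v`, the direct sum of the spaces `C(w ⊗ x ⟶ y ⊗ z)` over all simple labels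
`w, x, y, z` of the edges to the west, south, north and east. -/
abbrev Local := ∀ a : Dir → ι, S (a .west) ⊗ S (a .south) ⟶ S (a .north) ⊗ S (a .east)

/-- The inner product of `H_v`: the sum over all labels of
`tr(f† ∘ g) / √(d_w d_x d_y d_z)`. -/
def localForm : Local S →ₗ⋆[ℂ] Local S →ₗ[ℂ] ℂ :=
  LinearMap.mk₂'ₛₗ (starRingEnd ℂ) (RingHom.id ℂ)
    (fun f g => ∑ a : Dir → ι, ((√(∏ d, dim D (S (a d))))⁻¹ : ℝ) * trInner D (f a) (g a))
    (by
      intro f f' g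
      simp [trInner, UnitaryFusionCategory.dag_add, tr_add, mul_add, Finset.sum_add_distrib])
    (by
      intro r f g
      simp [trInner, UnitaryFusionCategory.dag_smul, tr_smul, Finset.mul_sum, mul_left_comm])
    (by
      intro f g g'
      simp [trInner, tr_add, mul_add, Finset.sum_add_distrib])
    (by
      intro r f g
      simp [trInner, tr_smul, Finset.mul_sum, mul_left_comm])

/-- The total space `⨂ H_v` of a patch. -/
abbrev Total (V : Finset (ℤ × ℤ)) := ⨂[ℂ] _p : V, Local S

/-- The inner product of the total space. -/
def totalInner (V : Finset (ℤ × ℤ)) (φ ψ : Total S V) : ℂ :=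
  tensorForm (fun _ : V => localForm D S) φ ψ

/-- The projector of `H_v` onto the states with label `i` in direction `d`. -/
def labelProj (d : Dir) (i : ι) : Local S →ₗ[ℂ] Local S where
  toFun f a := if a d = i then f a else 0
  map_add' f g := by
    funext a
    by_cases h : a d = i <;> simp [h]
  map_smul' r f := by
    funext a
    by_cases h : a d = i <;> simp [h]

/-- An operator on the local space at `p`, acting on the total space. -/
def atVertex {V : Finset (ℤ × ℤ)} (p : V) (T : Local S →ₗ[ℂ] Local S) :
    Module.End ℂ (Total S V) :=
  PiTensorProduct.map fun q => if q = p then T else LinearMap.id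

/-- The edge term `A_ℓ`: the projector onto the states for which the labels of the two halves of
the edge `ℓ` match. -/
def edgeTerm {V : Finset (ℤ × ℤ)} (l : Edge V) : Module.End ℂ (Total S V) :=
  ∑ i : ι, atVertex S l.1.1 (labelProj S l.1.2 i) * atVertex S l.head (labelProj S l.1.2.opp i)

/-- The ground states of an operator with real spectrum: the eigenspace of its least eigenvalue. -/
def groundStates {E : Type*} [AddCommGroup E] [Module ℂ E] (T : Module.End ℂ E) :
    Submodule ℂ E :=
  T.eigenspace ((sInf {r : ℝ | T.HasEigenvalue (r : ℂ)} : ℝ) : ℂ)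

/-- The ground-state space of `-∑ A_ℓ`, which is the image of `P_A`. -/
def edgeGroundStates (V : Finset (ℤ × ℤ)) : Submodule ℂ (Total S V) :=
  groundStates (-∑ l : Edge V, edgeTerm S l)

/-- The states satisfying the boundary condition `x`: every external edge `l` has the
label `x l`. -/
def HasBoundary {V : Finset (ℤ × ℤ)} (x : Leg V → ι) (ψ : Total S V) : Prop :=
  ∀ l : Leg V, atVertex S l.1.1 (labelProj S l.1.2 (x l)) ψ = ψ

/-- The object of a boundary label: the simple object itself for an external edge that enters the
patch, and its dual for one that leaves it. -/
def legObj {V : Finset (ℤ × ℤ)} (x : Leg V → ι) (l : Leg V) : C :=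
  if l.1.2.IsOutgoing then bar D (S (x l)) else S (x l)

/-- The tensor product of the boundary labels in counterclockwise order, beginning at `b`. -/
def boundaryObj {V : Finset (ℤ × ℤ)} (b : Leg V) (x : Leg V → ι) : C :=
  tensorFam (legList b).length fun k => legObj D S x ((legList b).get k)

/-- For an object `Z` of the Drinfeld center with a map `ε : F Z ⟶ 𝟙`, the map
`F Z ⟶ c ⊗ c̄` that creates the pair `c ⊗ c̄`, moves `Z` behind `c` by the half-braiding, and
applies `ε`. If `Z = I(𝟙)` and `ε` is the counit, then these maps, for simple `c`, are the
components of the identification of `F I(𝟙)` with the direct sum of the `c ⊗ c̄`. -/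
def component (Z : Center C) (ε : Z.1 ⟶ 𝟙_ C) (c : C) : Z.1 ⟶ c ⊗ bar D c :=
  (ρ_ Z.1).inv ≫ Z.1 ◁ coev D c ≫ (α_ Z.1 c (bar D c)).inv ≫ (Z.2.β c).hom ▷ bar D c ≫
    (c ◁ ε) ▷ bar D c ≫ (ρ_ c).hom ▷ bar D c

/-- The skein module inner product on `C(x⃗ ⟶ F(Z) ^ ⊗ n)`, where `F(Z)` is seen as the direct sum
of the objects `j ⊗ j̄` by its `component`s: the sum over `j₁, …, jₙ` of the inner products
`tr(f† ∘ g) / (d_{j₁} ⋯ d_{jₙ} √(∏ d_x))` of the components in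
`C(x⃗ ⟶ j₁ ⊗ j̄₁ ⊗ ⋯ ⊗ jₙ ⊗ j̄ₙ)`. -/
def skeinInner {V : Finset (ℤ × ℤ)} (b : Leg V) (x : Leg V → ι) (Z : Center C)
    (ε : Z.1 ⟶ 𝟙_ C) (n : ℕ) (f g : boundaryObj D S b x ⟶ tensorPow Z.1 n) : ℂ :=
  ∑ j : Fin n → ι,
    ((√(∏ l, dim D (S (x l))) * ∏ k, dim D (S (j k)))⁻¹ : ℝ) *
      trInner D (f ≫ tensorFamMap n fun k => component D Z ε (S (j k)))
        (g ≫ tensorFamMap n fun k => component D Z ε (S (j k)))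

end Model

end StringNet

end

noncomputable section

namespace StringNet

set_option linter.unusedSectionVars false

/-! ### Dagger calculus and multiplicities. -/

section Category

attribute [local instance] Abelian.hasFiniteBiproducts

variable {C : Type u} [Category.{v} C] [Abelian C] [Linear ℂ C]
  [MonoidalCategory C] [MonoidalPreadditive C] [MonoidalLinear ℂ C]

variable [UnitaryFusionCategory C]

open UnitaryFusionCategory

/-! Both sides are finite-dimensional inner product spaces that split orthogonally according to the
boundary condition, so a unitary respecting the splitting exists as soon as the dimensions agree for
each boundary condition. The proof is this count; the unitary merely matches orthonormal bases
(`exists_unitary`).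

Lattice side: orthonormal bases of the `H_v` adapted to the labels give product states on which
every edge term is diagonal. The ground space is spanned by those whose labels match on all internal
edges (`LocalBasis.mem_edgeGroundStates`). With a fixed boundary condition their number is a state
sum: the sum, over labellings of the internal edges, of the product of the dimensions of the vertex
spaces (`card_matched_eq_stateSum`).

Categorical side: let `A = FI(1)` and let `T(L, n)` be the dimension of the space of maps from a
word `L` of simple objects and duals to the `n`-th tensor power of `A`. Three rules hold
(`IsWordSum`). Powers of `A` commute with every object, so `T` depends only on the cyclic word.
Semisimplicity gives `∑ⱼ T(L j, n) T(j̄ M, m) = T(L M, n + m)`. Finally `A` is the direct sum of the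
`j ⊗ j̄`, so `∑ⱼ T(j j̄ L, n) = T(L, n + 1)`. The direct sum decomposition is
`exists_component_splitting`: a half-braiding is built on `⨁ⱼ j ⊗ j̄`, and the result is compared
with `I(1)` through the adjunction.

Geometry: a vertex with maximal coordinate sum is joined to the rest only to the west and south.
Attaching it by one edge uses the gluing rule once; closing a plaquette uses gluing and then the
pair rule, which accounts for one new factor `A`; joining two components uses gluing twice. The
remaining case, two edges into a connected rest without a plaquette, lowers the Euler
characteristic. Hence a connected patch has Euler characteristic at most 1, and in case of equality
its state sum is `T` of its outline (`IsConn.hasOutline`). Simple connectedness makes every flat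
cochain a gradient, which gives the opposite inequality for contractible patches
(`IsContractiblePatch.one_le_eulerChar`). -/

lemma dag_id (X : C) : dag (𝟙 X) = 𝟙 X := by
  have h := dag_comp (dag (𝟙 X)) (𝟙 X)
  rw [Category.comp_id, dag_dag, Category.comp_id] at h
  exact h.symm

lemma dag_whiskerLeft (X : C) {Y Z : C} (f : Y ⟶ Z) : dag (X ◁ f) = X ◁ dag f := by
  rw [← id_tensorHom, dag_tensorHom, dag_id, id_tensorHom]

lemma dag_whiskerRight {Y Z : C} (f : Y ⟶ Z) (X : C) : dag (f ▷ X) = dag f ▷ X := by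
  rw [← tensorHom_id, dag_tensorHom, dag_id, tensorHom_id]

lemma dag_associator_inv (X Y Z : C) : dag (α_ X Y Z).inv = (α_ X Y Z).hom := by
  rw [← dag_associator, dag_dag]

lemma dag_leftUnitor_inv (X : C) : dag (λ_ X).inv = (λ_ X).hom := by
  rw [← dag_leftUnitor, dag_dag]

lemma dag_rightUnitor_inv (X : C) : dag (ρ_ X).inv = (ρ_ X).hom := by
  rw [← dag_rightUnitor, dag_dag]

instance (X Y : C) : FiniteDimensional ℂ (X ⟶ Y) := finiteDimensional X Y

instance : Simple (𝟙_ C) := simple_unit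

/-- The dagger of an exact pairing of `X` with `Y` is an exact pairing of `Y` with `X`. -/
@[reducible]
def flipPairing {X Y : C} (P : ExactPairing X Y) : ExactPairing Y X where
  coevaluation' := dag P.evaluation'
  evaluation' := dag P.coevaluation'
  coevaluation_evaluation' := by
    -- The dagger reverses composition, so it exchanges the two zigzag identities.
    have h := congrArg dag P.evaluation_coevaluation'
    simp only [dag_comp, dag_whiskerLeft, dag_whiskerRight, dag_associator, dag_leftUnitor,
      dag_rightUnitor_inv, Category.assoc] at h
    exact h
  evaluation_coevaluation' := by
    have h := congrArg dag P.coevaluation_evaluation'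
    simp only [dag_comp, dag_whiskerLeft, dag_whiskerRight, dag_associator_inv, dag_rightUnitor,
      dag_leftUnitor_inv, Category.assoc] at h
    exact h

/-! ### Dimensions of hom spaces -/

/-- The dimension of `C(X ⟶ Y)`. -/
def homRank (X Y : C) : ℕ := Module.finrank ℂ (X ⟶ Y)

lemma homRank_congr {X X' Y Y' : C} (e : X ≅ X') (f : Y ≅ Y') : homRank X Y = homRank X' Y' :=
  (Linear.homCongr ℂ e f).finrank_eq

/-- Frobenius reciprocity: bending a strand is linear and invertible. Only its effect on dimensions
is needed for the count. -/
lemma homRank_tensorLeft {Y Y' : C} (P : ExactPairing Y Y') (X Z : C) :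
    homRank (Y' ⊗ X) Z = homRank X (Y ⊗ Z) :=
  LinearEquiv.finrank_eq
    { tensorLeftHomEquiv X Y Y' Z with
      map_add' := by intro f g; simp [tensorLeftHomEquiv]
      map_smul' := by intro r f; simp [tensorLeftHomEquiv] }

lemma homRank_tensorRight {Y Y' : C} (P : ExactPairing Y Y') (X Z : C) :
    homRank (X ⊗ Y) Z = homRank X (Z ⊗ Y') :=
  LinearEquiv.finrank_eq
    { tensorRightHomEquiv X Y Y' Z with
      map_add' := by intro f g; simp [tensorRightHomEquiv]
      map_smul' := by intro r f; simp [tensorRightHomEquiv] }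

/-- If `Y` is retracted onto the `Yₖ` with the sum of the retractions the identity, then the
dimensions of hom spaces into `Y` add up. -/
lemma homRank_eq_sum {κ : Type*} [Fintype κ] {Y : C} {Z : κ → C} (p : ∀ k, Y ⟶ Z k)
    (i : ∀ k, Z k ⟶ Y) (hself : ∀ k, i k ≫ p k = 𝟙 _) (hne : ∀ k l, k ≠ l → i k ≫ p l = 0)
    (hsum : ∑ k, p k ≫ i k = 𝟙 Y) (X : C) : homRank X Y = ∑ k, homRank X (Z k) := by
  classical
  have e : (X ⟶ Y) ≃ₗ[ℂ] ∀ k, X ⟶ Z k :=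
    { toFun := fun f k => f ≫ p k
      invFun := fun g => ∑ k, g k ≫ i k
      map_add' := by intro f g; funext k; simp
      map_smul' := by intro r f; funext k; simp
      left_inv := by
        intro f
        simp only [Category.assoc]
        rw [← Preadditive.comp_sum, hsum, Category.comp_id]
      right_inv := by
        intro g
        funext k
        simp only [Preadditive.sum_comp, Category.assoc]
        rw [Finset.sum_eq_single k]
        · rw [hself, Category.comp_id]
        · intro l _ hl
          rw [hne l k hl, comp_zero]
        · simp }
  rw [homRank, e.finrank_eq, Module.finrank_pi_fintype]
  rfl

section Irr

variable {ι : Type w} [Fintype ι] {S : ι → C} (hS : IsIrr S)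

include hS

lemma IsIrr.hom_eq_zero {i j : ι} (h : i ≠ j) (f : S i ⟶ S j) : f = 0 := by
  have := hS.simple i
  have := hS.simple j
  by_contra hf
  have := isIso_of_hom_simple hf
  exact h (hS.eq_of_iso i j ⟨asIso f⟩)

lemma IsIrr.hom_eq_smul {i : ι} (f : S i ⟶ S i) : ∃ c : ℂ, f = c • 𝟙 _ := by
  have := hS.simple i
  obtain ⟨c, hc⟩ := endomorphism_simple_eq_smul_id ℂ f
  exact ⟨c, hc.symm⟩

lemma IsIrr.homRank_self (i : ι) : homRank (S i) (S i) = 1 := by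
  have := hS.simple i
  exact finrank_endomorphism_simple_eq_one ℂ (S i)

lemma IsIrr.homRank_ne {i j : ι} (h : i ≠ j) : homRank (S i) (S j) = 0 := by
  have : Subsingleton (S i ⟶ S j) :=
    ⟨fun f g => by rw [hS.hom_eq_zero h f, hS.hom_eq_zero h g]⟩
  exact Module.finrank_zero_of_subsingleton

/-- Every object is a finite direct sum of the given simple objects. -/
lemma IsIrr.exists_decomposition (X : C) : ∃ (n : ℕ) (s : Fin n → ι) (p : ∀ k, X ⟶ S (s k))
    (i : ∀ k, S (s k) ⟶ X), (∀ k, i k ≫ p k = 𝟙 _) ∧ (∀ k l, k ≠ l → i k ≫ p l = 0) ∧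
      ∑ k, p k ≫ i k = 𝟙 X := by
  obtain ⟨n, t, ht, ⟨e⟩⟩ := UnitaryFusionCategory.semisimple X
  have h := fun k => hS.exists_iso (t k) (ht k)
  choose s hs using h
  have f := fun k => (hs k).some
  refine ⟨n, s, fun k => e.hom ≫ biproduct.π t k ≫ (f k).hom,
    fun k => (f k).inv ≫ biproduct.ι t k ≫ e.inv, ?_, ?_, ?_⟩
  · intro k
    simp
  · intro k l hkl
    simp [biproduct.ι_π_ne_assoc t hkl]
  · simp only [Category.assoc, Iso.hom_inv_id_assoc]
    rw [← Preadditive.comp_sum]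
    simp_rw [← Category.assoc (biproduct.π t _)]
    rw [← Preadditive.sum_comp, biproduct.total]
    simp

/-- Decompose `Y` into simple summands. By Schur's lemma the second factor is the multiplicity of `S
j` in `Y`, so the sum groups the summands of `Y` by isomorphism type. -/
lemma IsIrr.homRank_eq_sum_mul (X Y : C) :
    homRank X Y = ∑ j, homRank X (S j) * homRank (S j) Y := by
  classical
  obtain ⟨n, s, p, i, h1, h2, h3⟩ := hS.exists_decomposition Y
  rw [homRank_eq_sum p i h1 h2 h3]
  have : ∀ j, homRank (S j) Y = ∑ k, if s k = j then 1 else 0 := by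
    intro j
    rw [homRank_eq_sum p i h1 h2 h3]
    refine Finset.sum_congr rfl fun k _ => ?_
    split_ifs with h
    · subst h
      exact hS.homRank_self _
    · exact hS.homRank_ne (Ne.symm h)
  simp_rw [this, Finset.mul_sum]
  rw [Finset.sum_comm]
  simp

end Irr

end Category

section Category

attribute [local instance] Abelian.hasFiniteBiproducts

variable {C : Type u} [Category.{v} C] [Abelian C] [Linear ℂ C]
  [MonoidalCategory C] [MonoidalPreadditive C] [MonoidalLinear ℂ C]

variable [UnitaryFusionCategory C]

open UnitaryFusionCategory

/-! ### Fusion-categorical state sums of words -/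

section Words

variable (D : SphericalStructure C) {ι : Type w} [Fintype ι] [DecidableEq ι] (S : ι → C)

/-- The object of a signed label: `Sⱼ`, or its dual if the sign is `true`. -/
def letterObj (l : ι × Bool) : C := if l.2 then bar D (S l.1) else S l.1

/-- The tensor product of the objects of a list of signed labels. -/
def wordObj : List (ι × Bool) → C
  | [] => 𝟙_ C
  | l :: L => letterObj D S l ⊗ wordObj L

/-- `dim C(w ⟶ A ^ ⊗ n)` for a word `w` of signed labels. -/
def skeinDim (A : C) (L : List (ι × Bool)) (n : ℕ) : ℕ :=
  homRank (wordObj D S L) (tensorPow A n)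

lemma wordObj_append (L M : List (ι × Bool)) :
    Nonempty (wordObj D S (L ++ M) ≅ wordObj D S L ⊗ wordObj D S M) := by
  induction L with
  | nil => exact ⟨(λ_ _).symm⟩
  | cons l L ih =>
    obtain ⟨e⟩ := ih
    exact ⟨whiskerLeftIso _ e ≪≫ (α_ _ _ _).symm⟩

lemma tensorPow_add (A : C) (n m : ℕ) :
    Nonempty (tensorPow A (n + m) ≅ tensorPow A n ⊗ tensorPow A m) := by
  induction n with
  | zero => rw [Nat.zero_add]; exact ⟨(λ_ _).symm⟩
  | succ n ih =>
    obtain ⟨e⟩ := ih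
    rw [Nat.succ_add]
    exact ⟨whiskerLeftIso A e ≪≫ (α_ _ _ _).symm⟩

/-- The tensor factors pass `X` one at a time by the half-braiding. This is the source of the cyclic
symmetry of `skeinDim`. -/
lemma tensorPow_central (Z : Center C) (n : ℕ) (X : C) :
    Nonempty (tensorPow Z.1 n ⊗ X ≅ X ⊗ tensorPow Z.1 n) := by
  induction n with
  | zero => exact ⟨λ_ X ≪≫ (ρ_ X).symm⟩
  | succ n ih =>
    obtain ⟨e⟩ := ih
    exact ⟨α_ _ _ _ ≪≫ whiskerLeftIso Z.1 e ≪≫ (α_ _ _ _).symm ≪≫ whiskerRightIso (Z.2.β X) _ ≪≫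
      α_ _ _ _⟩

lemma homRank_mul_left (X Y Z : C) : homRank (X ⊗ Y) Z = homRank Y (bar D X ⊗ Z) :=
  homRank_tensorLeft (flipPairing (D X).pairing) Y Z

lemma homRank_bar_mul_left (X Y Z : C) : homRank (bar D X ⊗ Y) Z = homRank Y (X ⊗ Z) :=
  homRank_tensorLeft (D X).pairing Y Z

lemma homRank_mul_right (X Y Z : C) : homRank (X ⊗ Y) Z = homRank X (Z ⊗ bar D Y) :=
  homRank_tensorRight (D Y).pairing X Z

lemma homRank_mul_bar_right (X Y Z : C) : homRank (X ⊗ bar D Y) Z = homRank X (Z ⊗ Y) :=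
  homRank_tensorRight (flipPairing (D Y).pairing) X Z

include D in
-- Bend `X` to the target, carry its dual from the left of `Z` to the right, and bend it back on the
-- other side. A bare isomorphism is enough, since only dimensions are compared.
lemma homRank_tensor_swap (X Y : C) {Z : C} (hZ : ∀ W, Nonempty (Z ⊗ W ≅ W ⊗ Z)) :
    homRank (X ⊗ Y) Z = homRank (Y ⊗ X) Z := by
  obtain ⟨e⟩ := hZ (bar D X)
  rw [homRank_mul_left D, homRank_mul_right D, homRank_congr (Iso.refl Y) e]

lemma skeinDim_swap (Z : Center C) (L M : List (ι × Bool)) (n : ℕ) :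
    skeinDim D S Z.1 (L ++ M) n = skeinDim D S Z.1 (M ++ L) n := by
  obtain ⟨e⟩ := wordObj_append D S L M
  obtain ⟨f⟩ := wordObj_append D S M L
  rw [skeinDim, skeinDim, homRank_congr e (Iso.refl _), homRank_congr f (Iso.refl _),
    homRank_tensor_swap D _ _ (tensorPow_central Z n)]

variable {S} (hS : IsIrr S)

include hS

/-- Bending strands turns the two factors into the dimensions of maps out of and into `S j`. Their
sum over `j` counts maps factored through simple objects, and bending back gives the right-hand
side. It is the dimension count for cutting a diagram along one strand. -/
lemma sum_homRank_glue (X Y Z W : C) :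
    ∑ j, homRank (X ⊗ S j) Z * homRank (bar D (S j) ⊗ Y) W = homRank (X ⊗ Y) (Z ⊗ W) := by
  have h1 : ∀ j, homRank (X ⊗ S j) Z = homRank (S j) (bar D X ⊗ Z) :=
    fun j => homRank_mul_left D _ _ _
  have h2 : ∀ j, homRank (bar D (S j) ⊗ Y) W = homRank (Y ⊗ bar D W) (S j) := fun j => by
    rw [homRank_bar_mul_left, homRank_mul_bar_right]
  simp_rw [h1, h2, mul_comm (homRank (S _) _)]
  rw [← hS.homRank_eq_sum_mul, homRank_mul_bar_right, homRank_mul_left D X,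
    homRank_congr (Iso.refl Y) (α_ _ _ _)]

/-- The same cut with the strand oriented the other way. Strands are bent to the opposite sides, so
that double duals never appear. -/
lemma sum_homRank_glue' (X Y Z W : C) :
    ∑ j, homRank (X ⊗ bar D (S j)) Z * homRank (S j ⊗ Y) W = homRank (X ⊗ Y) (Z ⊗ W) := by
  have h1 : ∀ j, homRank (X ⊗ bar D (S j)) Z = homRank (bar D Z ⊗ X) (S j) := fun j => by
    rw [homRank_mul_bar_right, homRank_bar_mul_left]
  have h2 : ∀ j, homRank (S j ⊗ Y) W = homRank (S j) (W ⊗ bar D Y) :=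
    fun j => homRank_mul_right D _ _ _
  simp_rw [h1, h2]
  rw [← hS.homRank_eq_sum_mul, homRank_bar_mul_left, homRank_mul_right D X,
    homRank_congr (Iso.refl X) (α_ _ _ _)]

lemma sum_skeinDim_glue (A : C) (L M : List (ι × Bool)) (s : Bool) (n m : ℕ) :
    ∑ j, skeinDim D S A (L ++ [(j, s)]) n * skeinDim D S A ((j, !s) :: M) m =
      skeinDim D S A (L ++ M) (n + m) := by
  obtain ⟨e⟩ := wordObj_append D S L M
  obtain ⟨f⟩ := tensorPow_add A n m
  have h : ∀ j, skeinDim D S A (L ++ [(j, s)]) n =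
      homRank (wordObj D S L ⊗ letterObj D S (j, s)) (tensorPow A n) := fun j => by
    obtain ⟨g⟩ := wordObj_append D S L [(j, s)]
    exact homRank_congr (g ≪≫ whiskerLeftIso _ (ρ_ _)) (Iso.refl _)
  simp_rw [h]
  rw [skeinDim, homRank_congr e f]
  cases s
  · exact sum_homRank_glue D hS _ _ _ _
  · exact sum_homRank_glue' D hS _ _ _ _

omit hS

/-- Both letters of the pair bend to the target, where they reappear in the same order as `S j ⊗ bar
D (S j)`; summed over `j` these make up one more factor `A`. This is how a plaquette contributes its
factor. -/
lemma sum_skeinDim_pair {A : C} (p : ∀ j, A ⟶ S j ⊗ bar D (S j)) (i : ∀ j, S j ⊗ bar D (S j) ⟶ A)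
    (hself : ∀ k, i k ≫ p k = 𝟙 _) (hne : ∀ k l, k ≠ l → i k ≫ p l = 0)
    (hsum : ∑ k, p k ≫ i k = 𝟙 A) (L : List (ι × Bool)) (n : ℕ) :
    ∑ j, skeinDim D S A ((j, false) :: (j, true) :: L) n = skeinDim D S A L (n + 1) := by
  have h : ∀ j, skeinDim D S A ((j, false) :: (j, true) :: L) n =
      homRank (wordObj D S L) ((S j ⊗ bar D (S j)) ⊗ tensorPow A n) := fun j => by
    rw [homRank_congr (Iso.refl _) (α_ _ _ _), ← homRank_bar_mul_left, ← homRank_mul_left]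
    rfl
  simp_rw [h]
  refine (homRank_eq_sum (fun j => p j ▷ tensorPow A n) (fun j => i j ▷ tensorPow A n) ?_ ?_ ?_
    (wordObj D S L)).symm
  · intro k
    rw [← comp_whiskerRight, hself, id_whiskerRight]
  · intro k l hkl
    rw [← comp_whiskerRight, hne k l hkl, MonoidalPreadditive.zero_whiskerRight]
  · simp_rw [← comp_whiskerRight]
    rw [← sum_whiskerRight, hsum, id_whiskerRight]

/-- The word of a single vertex. -/
lemma skeinDim_vertex (A : C) (w s n e : ι) :
    skeinDim D S A [(e, true), (n, true), (w, false), (s, false)] 0 =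
      homRank (S w ⊗ S s) (S n ⊗ S e) := by
  have h1 : skeinDim D S A [(e, true), (n, true), (w, false), (s, false)] 0 =
      homRank (bar D (S e) ⊗ (bar D (S n) ⊗ (S w ⊗ S s))) (𝟙_ C) :=
    homRank_congr (whiskerLeftIso _ (whiskerLeftIso _ (whiskerLeftIso _ (ρ_ _)))) (Iso.refl _)
  rw [h1, homRank_bar_mul_left, homRank_bar_mul_left,
    homRank_congr (Iso.refl _) (whiskerLeftIso _ (ρ_ _))]

end Words

end Category

section Category

attribute [local instance] Abelian.hasFiniteBiproducts

variable {C : Type u} [Category.{v} C] [Abelian C] [Linear ℂ C]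
  [MonoidalCategory C] [MonoidalPreadditive C] [MonoidalLinear ℂ C]

variable [UnitaryFusionCategory C]

open UnitaryFusionCategory

/-! ### The cofree object of the Drinfeld center on the tensor unit -/

section Cofree

variable (D : SphericalStructure C)

/-- The mate `X ⟶ Z ⊗ c̄` of `X ⊗ c ⟶ Z`. -/
def mate {X c Z : C} : (X ⊗ c ⟶ Z) ≃ (X ⟶ Z ⊗ bar D c) :=
  letI : ExactPairing c (bar D c) := (D c).pairing
  tensorRightHomEquiv X c (bar D c) Z

lemma mate_apply {X c Z : C} (f : X ⊗ c ⟶ Z) :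
    mate D f = (ρ_ _).inv ≫ X ◁ coev D c ≫ (α_ _ _ _).inv ≫ f ▷ bar D c := rfl

lemma mate_whiskerRight_comp {X X' c Z : C} (f : X ⟶ X') (g : X' ⊗ c ⟶ Z) :
    mate D (f ▷ c ≫ g) = f ≫ mate D g := by
  simp only [mate_apply, comp_whiskerRight, ← whisker_exchange_assoc,
    rightUnitor_inv_naturality_assoc, associator_inv_naturality_left_assoc]

lemma mate_associator {X Y c Z : C} (f : Y ⊗ c ⟶ Z) :
    mate D ((α_ X Y c).hom ≫ X ◁ f) = X ◁ mate D f ≫ (α_ _ _ _).inv := by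
  simp only [mate_apply]
  monoidal

variable {ι : Type w} [Fintype ι] [DecidableEq ι] {S : ι → C} (hS : IsIrr S)

variable (S) in
/-- The object `⨁ⱼ Sⱼ ⊗ S̄ⱼ`. -/
def cofree : C := ⨁ fun j => S j ⊗ bar D (S j)

variable (S) in
/-- The projection of `⨁ⱼ Sⱼ ⊗ S̄ⱼ` onto a summand. -/
def cofreeProj (j : ι) : cofree D S ⟶ S j ⊗ bar D (S j) :=
  biproduct.π (fun j => S j ⊗ bar D (S j)) j

variable (S) in
/-- The inclusion of a summand of `⨁ⱼ Sⱼ ⊗ S̄ⱼ`. -/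
def cofreeIncl (j : ι) : S j ⊗ bar D (S j) ⟶ cofree D S :=
  biproduct.ι (fun j => S j ⊗ bar D (S j)) j

lemma cofreeIncl_proj_self (j : ι) : cofreeIncl D S j ≫ cofreeProj D S j = 𝟙 _ :=
  biproduct.ι_π_self _ j

lemma cofreeIncl_proj_ne {j k : ι} (h : j ≠ k) : cofreeIncl D S j ≫ cofreeProj D S k = 0 :=
  biproduct.ι_π_ne _ h

lemma cofree_total : ∑ j, cofreeProj D S j ≫ cofreeIncl D S j = 𝟙 (cofree D S) := by
  refine biproduct.hom_ext _ _ fun k => ?_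
  change _ ≫ cofreeProj D S k = 𝟙 _ ≫ cofreeProj D S k
  rw [Preadditive.sum_comp, Finset.sum_eq_single k]
  · rw [Category.assoc, cofreeIncl_proj_self, Category.comp_id, Category.id_comp]
  · intro j _ hj
    rw [Category.assoc, cofreeIncl_proj_ne D hj, comp_zero]
  · simp

variable (S) in
/-- The action `A ⊗ Sⱼ ⟶ Sⱼ` of `A = ⨁ⱼ Sⱼ ⊗ S̄ⱼ` on a simple object. -/
def actSimple (j : ι) : cofree D S ⊗ S j ⟶ S j := (mate D).symm (cofreeProj D S j)

lemma mate_actSimple (j : ι) : mate D (actSimple D S j) = cofreeProj D S j :=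
  Equiv.apply_symm_apply _ _

/-- A family of maps `Y ⊗ d ⟶ c ⊗ d`, natural in `d`. -/
def IsNat {Y c : C} (θ : ∀ d, Y ⊗ d ⟶ c ⊗ d) : Prop :=
  ∀ (d d' : C) (f : d ⟶ d'), Y ◁ f ≫ θ d' = θ d ≫ c ◁ f

include hS

/-- By Schur's lemma the maps between listed simple objects are zero or scalar, so naturality costs
nothing there. -/
lemma actSimple_naturality {j k : ι} (f : S j ⟶ S k) :
    cofree D S ◁ f ≫ actSimple D S k = actSimple D S j ≫ f := by
  by_cases h : j = k
  · subst h
    obtain ⟨c, rfl⟩ := hS.hom_eq_smul f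
    simp
  · rw [hS.hom_eq_zero h f]
    simp

/-- Naturality along the projections and inclusions of a decomposition of `d` expresses the value at
`d` through the values at simple objects. -/
lemma IsNat.eq_of_simple {Y c : C} {θ η : ∀ d, Y ⊗ d ⟶ c ⊗ d} (hθ : IsNat θ) (hη : IsNat η)
    (h : ∀ j, θ (S j) = η (S j)) : θ = η := by
  funext d
  obtain ⟨n, s, p, i, -, -, h3⟩ := hS.exists_decomposition d
  have key : ∀ {ζ : ∀ d, Y ⊗ d ⟶ c ⊗ d}, IsNat ζ → ζ d = ∑ k, Y ◁ p k ≫ ζ (S (s k)) ≫ c ◁ i k := by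
    intro ζ hζ
    have : ∀ k, Y ◁ p k ≫ ζ (S (s k)) ≫ c ◁ i k = ζ d ≫ c ◁ (p k ≫ i k) := fun k => by
      rw [← Category.assoc, hζ, Category.assoc, MonoidalCategory.whiskerLeft_comp]
    simp_rw [this]
    rw [← Preadditive.comp_sum, ← whiskerLeft_sum, h3, MonoidalCategory.whiskerLeft_id,
      Category.comp_id]
  rw [key hθ, key hη]
  simp_rw [h]

/-- The action `A ⊗ c ⟶ c` of `A = ⨁ⱼ Sⱼ ⊗ S̄ⱼ` on an object. -/
def act (c : C) : cofree D S ⊗ c ⟶ c :=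
  let h := hS.exists_decomposition c
  let p := h.choose_spec.choose_spec.choose
  let i := h.choose_spec.choose_spec.choose_spec.choose
  ∑ k, cofree D S ◁ p k ≫ actSimple D S _ ≫ i k

lemma act_spec (c : C) : ∃ (n : ℕ) (s : Fin n → ι) (p : ∀ k, c ⟶ S (s k))
    (i : ∀ k, S (s k) ⟶ c), ∑ k, p k ≫ i k = 𝟙 c ∧
      act D hS c = ∑ k, cofree D S ◁ p k ≫ actSimple D S _ ≫ i k :=
  let h := hS.exists_decomposition c
  ⟨_, _, _, _, h.choose_spec.choose_spec.choose_spec.choose_spec.2.2, rfl⟩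

/-- The decompositions of `c` and `d` behind `act` are arbitrary and unrelated. Inserting both turns
`f` into a matrix of maps between simple objects, and each entry commutes with the action by
`actSimple_naturality`. In particular the action does not depend on the choices. -/
lemma act_naturality {c d : C} (f : c ⟶ d) :
    cofree D S ◁ f ≫ act D hS d = act D hS c ≫ f := by
  obtain ⟨n, s, p, i, h, hc⟩ := act_spec D hS c
  obtain ⟨n', s', p', i', h', hd⟩ := act_spec D hS d
  have h1 : ∀ k l, cofree D S ◁ p k ≫ actSimple D S _ ≫ i k ≫ f ≫ p' l ≫ i' l =
      cofree D S ◁ (p k ≫ i k) ≫ cofree D S ◁ f ≫ cofree D S ◁ p' l ≫ actSimple D S _ ≫ i' l := by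
    intro k l
    have := actSimple_naturality D hS (i k ≫ f ≫ p' l)
    simp only [MonoidalCategory.whiskerLeft_comp, Category.assoc] at this ⊢
    rw [reassoc_of% this]
  have h2 : act D hS c ≫ f = ∑ k, ∑ l,
      cofree D S ◁ p k ≫ actSimple D S _ ≫ i k ≫ f ≫ p' l ≫ i' l := by
    simp_rw [← Preadditive.comp_sum, h', Category.comp_id, hc, Preadditive.sum_comp,
      Category.assoc]
  rw [h2]
  simp_rw [h1]
  rw [Finset.sum_comm]
  simp_rw [← Preadditive.sum_comp, ← whiskerLeft_sum, h, hd, Preadditive.comp_sum]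
  simp

/-- The decomposition chosen for `S j` need not be the trivial one; naturality moves its two halves
together, where they sum to the identity. -/
lemma act_simple (j : ι) : act D hS (S j) = actSimple D S j := by
  obtain ⟨n, s, p, i, h, hc⟩ := act_spec D hS (S j)
  rw [hc]
  simp_rw [← actSimple_naturality D hS, ← Category.assoc, ← MonoidalCategory.whiskerLeft_comp]
  rw [← Preadditive.sum_comp, ← whiskerLeft_sum, h]
  simp

/-- With `cofree_ext` and `exists_cofree_lift` this is the universal property of `A`: maps `Y ⟶ c ⊗
A` correspond to natural families `Y ⊗ d ⟶ c ⊗ d`. The half-braiding is constructed, and its axioms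
are checked, through this correspondence. -/
lemma isNat_test {Y c : C} (f : Y ⟶ c ⊗ cofree D S) :
    IsNat fun d => f ▷ d ≫ (α_ _ _ _).hom ≫ c ◁ act D hS d := by
  intro d d' g
  dsimp only
  rw [Category.assoc, Category.assoc, ← MonoidalCategory.whiskerLeft_comp, ← act_naturality,
    MonoidalCategory.whiskerLeft_comp, whisker_exchange_assoc, associator_naturality_right_assoc]

/-- A map into `c ⊗ A` is determined by the maps `Y ⊗ d ⟶ c ⊗ d` that it induces. -/
lemma cofree_ext {Y c : C} {f g : Y ⟶ c ⊗ cofree D S}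
    (h : ∀ d, f ▷ d ≫ (α_ _ _ _).hom ≫ c ◁ act D hS d =
      g ▷ d ≫ (α_ _ _ _).hom ≫ c ◁ act D hS d) : f = g := by
  have key : ∀ j, f ≫ c ◁ cofreeProj D S j = g ≫ c ◁ cofreeProj D S j := by
    intro j
    have := congrArg (mate D) (h (S j))
    rw [mate_whiskerRight_comp, mate_whiskerRight_comp, mate_associator, act_simple,
      mate_actSimple, ← Category.assoc, ← Category.assoc, cancel_mono] at this
    exact this
  have tot : ∀ f : Y ⟶ c ⊗ cofree D S,
      f = ∑ j, (f ≫ c ◁ cofreeProj D S j) ≫ c ◁ cofreeIncl D S j := by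
    intro f
    simp_rw [Category.assoc, ← MonoidalCategory.whiskerLeft_comp]
    rw [← Preadditive.comp_sum, ← whiskerLeft_sum, cofree_total,
      MonoidalCategory.whiskerLeft_id, Category.comp_id]
  rw [tot f, tot g]
  simp_rw [key]

/-- A natural family of maps `Y ⊗ d ⟶ c ⊗ d` is induced by a map into `c ⊗ A`. -/
lemma exists_cofree_lift {Y c : C} (θ : ∀ d, Y ⊗ d ⟶ c ⊗ d) (hθ : IsNat θ) :
    ∃ f : Y ⟶ c ⊗ cofree D S, ∀ d, f ▷ d ≫ (α_ _ _ _).hom ≫ c ◁ act D hS d = θ d := by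
  -- The component of the lift at `j` is the mate of `θ (S j)`. Since the action on `S j` has the
  -- projection as its mate, acting on `S j` returns `θ (S j)`, and simple objects suffice for
  -- equality.
  refine ⟨∑ j, mate D (θ (S j)) ≫ (α_ _ _ _).hom ≫ c ◁ cofreeIncl D S j, ?_⟩
  refine fun d => congrFun ((isNat_test D hS _).eq_of_simple hS hθ fun j => ?_) d
  apply (mate D).injective
  rw [mate_whiskerRight_comp, mate_associator, act_simple, mate_actSimple, Preadditive.sum_comp,
    Finset.sum_eq_single j]
  · simp only [Category.assoc, ← MonoidalCategory.whiskerLeft_comp_assoc, cofreeIncl_proj_self]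
    simp
  · intro k _ hk
    simp only [Category.assoc, ← MonoidalCategory.whiskerLeft_comp_assoc,
      cofreeIncl_proj_ne D hk]
    simp
  · simp

/-- The action on `c ⊗ d`, viewed as a family in `d`; its lift to a map `A ⊗ c ⟶ c ⊗ A` will be the
half-braiding. -/
lemma isNat_act_tensor (c : C) :
    IsNat fun d => (α_ (cofree D S) c d).hom ≫ act D hS (c ⊗ d) := by
  intro d d' f
  dsimp only
  rw [associator_naturality_right_assoc, act_naturality, Category.assoc]

/-- The half-braiding of `A = ⨁ⱼ Sⱼ ⊗ S̄ⱼ`. -/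
def cofreeBraid (c : C) : cofree D S ⊗ c ⟶ c ⊗ cofree D S :=
  (exists_cofree_lift D hS _ (isNat_act_tensor D hS c)).choose

lemma cofreeBraid_act (c d : C) :
    cofreeBraid D hS c ▷ d ≫ (α_ _ _ _).hom ≫ c ◁ act D hS d =
      (α_ (cofree D S) c d).hom ≫ act D hS (c ⊗ d) :=
  (exists_cofree_lift D hS _ (isNat_act_tensor D hS c)).choose_spec d

lemma cofreeBraid_naturality {c c' : C} (f : c ⟶ c') :
    cofree D S ◁ f ≫ cofreeBraid D hS c' = cofreeBraid D hS c ≫ f ▷ cofree D S := by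
  apply cofree_ext D hS
  intro d
  rw [comp_whiskerRight, Category.assoc, cofreeBraid_act, comp_whiskerRight, Category.assoc,
    associator_naturality_left_assoc, ← whisker_exchange, reassoc_of% cofreeBraid_act,
    associator_naturality_middle_assoc, act_naturality]

/-- Tested by acting on `d`, both sides become the action of `A` on `c ⊗ c' ⊗ d`: the right-hand
side reaches it by applying the defining property of the half-braiding twice. -/
lemma cofreeBraid_tensor (c c' : C) : cofreeBraid D hS (c ⊗ c') =
    (α_ _ _ _).inv ≫ (cofreeBraid D hS c ▷ c') ≫ (α_ _ _ _).hom ≫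
      (c ◁ cofreeBraid D hS c') ≫ (α_ _ _ _).inv := by
  apply cofree_ext D hS
  intro d
  rw [cofreeBraid_act]
  symm
  calc _ = 𝟙 _ ⊗≫ cofreeBraid D hS c ▷ c' ▷ d ⊗≫ c ◁ (cofreeBraid D hS c' ▷ d ≫ (α_ _ _ _).hom ≫
          c' ◁ act D hS d) ⊗≫ 𝟙 _ := by monoidal
    _ = 𝟙 _ ⊗≫ (cofreeBraid D hS c ▷ (c' ⊗ d) ≫ (α_ _ _ _).hom ≫ c ◁ act D hS (c' ⊗ d)) ⊗≫ 𝟙 _ := by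
      rw [cofreeBraid_act]; monoidal
    _ = 𝟙 _ ⊗≫ act D hS (c ⊗ c' ⊗ d) ≫ (α_ c c' d).inv := by
      rw [cofreeBraid_act]; monoidal
    _ = _ := by
      rw [← act_naturality]; monoidal

lemma cofreeBraid_unit :
    cofreeBraid D hS (𝟙_ C) = (ρ_ _).hom ≫ (λ_ _).inv := by
  apply cofree_ext D hS
  intro d
  have h := act_naturality D hS (λ_ d).hom
  rw [cofreeBraid_act, ← cancel_mono (λ_ d).hom]
  simp only [Category.assoc]
  rw [← h]
  monoidal

/-- The cup `𝟙 ⟶ c̄ ⊗ c`. -/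
def cup' (c : C) : 𝟙_ C ⟶ bar D c ⊗ c := dag (D c).pairing.evaluation'

/-- The inverse of `cofreeBraid`. -/
def cofreeBraidInv (c : C) : c ⊗ cofree D S ⟶ cofree D S ⊗ c :=
  𝟙 _ ⊗≫ (c ⊗ cofree D S) ◁ cup' D c ⊗≫
    c ◁ cofreeBraid D hS (bar D c) ▷ c ⊗≫
      dag (coev D c) ▷ (cofree D S ⊗ c) ⊗≫ 𝟙 _

omit [Fintype ι] [DecidableEq ι] hS in
lemma zigzag_flip (c : C) :
    c ◁ cup' D c ⊗≫ dag (coev D c) ▷ c = ⊗𝟙.hom := by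
  let _ : ExactPairing (bar D c) c := flipPairing (D c).pairing
  exact ExactPairing.coevaluation_evaluation'' (bar D c) c

/-- The candidate inverse is the half-braiding with `c̄`, rotated by a cup and a cap. Naturality
along the cap `c ⊗ c̄ ⟶ 𝟙`, with the tensor and unit rules, frees `A` from the strand, and a zigzag
remains. -/
lemma cofreeBraid_inv (c : C) : cofreeBraid D hS c ≫ cofreeBraidInv D hS c = 𝟙 _ := by
  have h := cofreeBraid_naturality D hS (dag (coev D c))
  rw [cofreeBraid_tensor, cofreeBraid_unit] at h
  calc _ = 𝟙 _ ⊗≫ (cofreeBraid D hS c ▷ 𝟙_ C ≫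
            (c ⊗ cofree D S) ◁ cup' D c) ⊗≫
          c ◁ cofreeBraid D hS (bar D c) ▷ c ⊗≫
            dag (coev D c) ▷ (cofree D S ⊗ c) ⊗≫ 𝟙 _ := by
        rw [cofreeBraidInv]; monoidal
    _ = 𝟙 _ ⊗≫ (cofree D S ⊗ c) ◁ cup' D c ⊗≫
          (((α_ _ _ _).inv ≫ (cofreeBraid D hS c ▷ bar D c) ≫ (α_ _ _ _).hom ≫
            (c ◁ cofreeBraid D hS (bar D c)) ≫ (α_ _ _ _).inv) ≫ dag (coev D c) ▷ cofree D S) ▷ c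
            ⊗≫ 𝟙 _ := by
        rw [← whisker_exchange]; monoidal
    _ = 𝟙 _ ⊗≫ cofree D S ◁ (c ◁ cup' D c ⊗≫ dag (coev D c) ▷ c) ⊗≫ 𝟙 _ := by
        rw [← h]; monoidal
    _ = _ := by rw [zigzag_flip]; monoidal

/-- For this order of composition the universal property is available. After acting on `d`,
naturality of the action along the cup `d ⟶ c̄ ⊗ c ⊗ d` replaces the cap used for the other order.
-/
lemma cofreeBraidInv_comp (c : C) : cofreeBraidInv D hS c ≫ cofreeBraid D hS c = 𝟙 _ := by
  apply cofree_ext D hS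
  intro d
  have h1 := cofreeBraid_act D hS (bar D c) (c ⊗ d)
  have h2 := act_naturality D hS ((λ_ d).inv ≫ cup' D c ▷ d ≫ (α_ _ _ _).hom)
  calc _ = cofreeBraidInv D hS c ▷ d ≫ (cofreeBraid D hS c ▷ d ≫ (α_ _ _ _).hom ≫
            c ◁ act D hS d) := by monoidal
    _ = 𝟙 _ ⊗≫ (c ⊗ cofree D S) ◁ (cup' D c ▷ d) ⊗≫
          c ◁ cofreeBraid D hS (bar D c) ▷ (c ⊗ d) ⊗≫
          (dag (coev D c) ▷ (cofree D S ⊗ c ⊗ d) ≫ 𝟙_ C ◁ act D hS (c ⊗ d)) ⊗≫ 𝟙 _ := by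
      rw [cofreeBraid_act, cofreeBraidInv]; monoidal
    _ = 𝟙 _ ⊗≫ (c ⊗ cofree D S) ◁ (cup' D c ▷ d) ⊗≫
          c ◁ (cofreeBraid D hS (bar D c) ▷ (c ⊗ d) ≫ (α_ _ _ _).hom ≫
            bar D c ◁ act D hS (c ⊗ d)) ⊗≫
          dag (coev D c) ▷ (c ⊗ d) ⊗≫ 𝟙 _ := by
      rw [← whisker_exchange]; monoidal
    _ = 𝟙 _ ⊗≫ c ◁ (cofree D S ◁ ((λ_ d).inv ≫ cup' D c ▷ d ≫
            (α_ _ _ _).hom) ≫ act D hS (bar D c ⊗ c ⊗ d)) ⊗≫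
          dag (coev D c) ▷ (c ⊗ d) ⊗≫ 𝟙 _ := by
      rw [h1]; monoidal
    _ = 𝟙 _ ⊗≫ c ◁ act D hS d ⊗≫
          (c ◁ cup' D c ⊗≫ dag (coev D c) ▷ c) ▷ d ⊗≫ 𝟙 _ := by
      rw [h2]; monoidal
    _ = _ := by rw [zigzag_flip]; monoidal

/-- `A = ⨁ⱼ Sⱼ ⊗ S̄ⱼ` as an object of the Drinfeld center. -/
def cofreeCenter : Center C :=
  ⟨cofree D S,
    { β := fun c => ⟨cofreeBraid D hS c, cofreeBraidInv D hS c, cofreeBraid_inv D hS c,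
        cofreeBraidInv_comp D hS c⟩
      monoidal := cofreeBraid_tensor D hS
      naturality := cofreeBraid_naturality D hS }⟩

end Cofree

end Category

section Category

attribute [local instance] Abelian.hasFiniteBiproducts

variable {C : Type u} [Category.{v} C] [Abelian C] [Linear ℂ C]
  [MonoidalCategory C] [MonoidalPreadditive C] [MonoidalLinear ℂ C]

variable [UnitaryFusionCategory C]

open UnitaryFusionCategory

/-! ### Comparison of `I(𝟙)` with the cofree object. -/

section Splitting

variable (D : SphericalStructure C) {ι : Type w} [Fintype ι] [DecidableEq ι] {S : ι → C}
  (hS : IsIrr S)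

/-- The action `Z ⊗ c ⟶ c` of an object of the center with a map `ε : Z ⟶ 𝟙`. -/
def centerAct (Z : Center C) (ε : Z.1 ⟶ 𝟙_ C) (c : C) : Z.1 ⊗ c ⟶ c :=
  (Z.2.β c).hom ≫ c ◁ ε ≫ (ρ_ c).hom

lemma mate_centerAct (Z : Center C) (ε : Z.1 ⟶ 𝟙_ C) (c : C) :
    mate D (centerAct Z ε c) = component D Z ε c := by
  simp [mate_apply, component, centerAct]

lemma centerAct_naturality (Z : Center C) (ε : Z.1 ⟶ 𝟙_ C) {c d : C} (f : c ⟶ d) :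
    Z.1 ◁ f ≫ centerAct Z ε d = centerAct Z ε c ≫ f := by
  simp only [centerAct, Category.assoc, HalfBraiding.naturality_assoc]
  rw [← whisker_exchange_assoc, rightUnitor_naturality]

/-- A morphism of the center commutes with half-braidings, so it slides through the construction and
is absorbed into `ε`. -/
lemma component_comp {Z W : Center C} (f : Z ⟶ W) (ε : W.1 ⟶ 𝟙_ C) (c : C) :
    f.f ≫ component D W ε c = component D Z (f.f ≫ ε) c := by
  rw [← mate_centerAct, ← mate_centerAct, ← mate_whiskerRight_comp]
  congr 1
  simp only [centerAct]
  rw [Center.Hom.comm_assoc, ← MonoidalCategory.whiskerLeft_comp_assoc]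

/-- The point is that the half-braiding `b` with the unit is trivial. The tensor rule at `𝟙 ⊗ 𝟙` and
naturality along the unitor make `b` idempotent up to unitors; being invertible, it is then the
canonical map. -/
lemma centerAct_unit (Z : Center C) (ε : Z.1 ⟶ 𝟙_ C) :
    (ρ_ Z.1).inv ≫ centerAct Z ε (𝟙_ C) = ε := by
  have h1 : (Z.2.β (𝟙_ C)).hom = (ρ_ Z.1).hom ≫ (λ_ Z.1).inv := by
    have hm := Z.2.monoidal (𝟙_ C) (𝟙_ C)
    have hn := Z.2.naturality (λ_ (𝟙_ C)).hom
    rw [hm] at hn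
    set b := (Z.2.β (𝟙_ C)).hom with hb
    have h2 : Z.1 ◁ (λ_ (𝟙_ C)).hom ≫ b =
        Z.1 ◁ (λ_ (𝟙_ C)).hom ≫ b ≫ (λ_ Z.1).hom ≫ (ρ_ Z.1).inv ≫ b := by
      rw [hn]
      calc _ = 𝟙 _ ⊗≫ b ▷ 𝟙_ C ⊗≫ (𝟙_ C) ◁ b ⊗≫ 𝟙 _ := by monoidal
        _ = Z.1 ◁ (λ_ (𝟙_ C)).hom ≫ ((ρ_ _).inv ≫ b ▷ 𝟙_ C ≫ (ρ_ _).hom) ≫ (λ_ Z.1).hom ≫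
            (ρ_ Z.1).inv ≫ ((λ_ _).inv ≫ 𝟙_ C ◁ b ≫ (λ_ _).hom) := by monoidal
        _ = _ := by simp
    rw [cancel_epi] at h2
    have h3 : 𝟙 _ = (λ_ Z.1).hom ≫ (ρ_ Z.1).inv ≫ b := by
      rw [← cancel_epi (Z.2.β (𝟙_ C)).hom, ← hb, ← h2, Category.comp_id]
    rw [Iso.eq_comp_inv, ← cancel_mono (ρ_ Z.1).inv]
    rw [← cancel_mono b]
    simp only [Category.assoc]
    rw [← h3]
    simp
  simp only [centerAct, h1]
  have h2 : (λ_ (𝟙_ C)).inv ≫ (ρ_ (𝟙_ C)).hom = 𝟙 _ := by monoidal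
  simp [h2]

include hS

lemma act_eq_of_simple {Y : C} {θ η : ∀ d, Y ⊗ d ⟶ d}
    (hθ : ∀ (d d' : C) (f : d ⟶ d'), Y ◁ f ≫ θ d' = θ d ≫ f)
    (hη : ∀ (d d' : C) (f : d ⟶ d'), Y ◁ f ≫ η d' = η d ≫ f)
    (h : ∀ j, θ (S j) = η (S j)) (d : C) : θ d = η d := by
  have hn : ∀ {ζ : ∀ d, Y ⊗ d ⟶ d}, (∀ (d d' : C) (f : d ⟶ d'), Y ◁ f ≫ ζ d' = ζ d ≫ f) →
      IsNat fun d => ζ d ≫ (λ_ d).inv := by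
    intro ζ hζ d d' f
    simp only [Category.assoc]
    rw [reassoc_of% hζ]
    simp
  have := congrFun ((hn hθ).eq_of_simple hS (hn hη) fun j => by rw [h]) d
  exact (cancel_mono _).1 this

omit hS in
variable (S) in
/-- The map to `⨁ⱼ Sⱼ ⊗ S̄ⱼ` with the given components. -/
def toCofree (Z : Center C) (ε : Z.1 ⟶ 𝟙_ C) : Z.1 ⟶ cofree D S :=
  ∑ j, component D Z ε (S j) ≫ cofreeIncl D S j

omit hS in
lemma toCofree_proj (Z : Center C) (ε : Z.1 ⟶ 𝟙_ C) (j : ι) :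
    toCofree D S Z ε ≫ cofreeProj D S j = component D Z ε (S j) := by
  rw [toCofree, Preadditive.sum_comp, Finset.sum_eq_single j]
  · rw [Category.assoc, cofreeIncl_proj_self, Category.comp_id]
  · intro k _ hk
    rw [Category.assoc, cofreeIncl_proj_ne D hk, comp_zero]
  · simp

lemma toCofree_act (Z : Center C) (ε : Z.1 ⟶ 𝟙_ C) (c : C) :
    toCofree D S Z ε ▷ c ≫ act D hS c = centerAct Z ε c := by
  refine act_eq_of_simple hS (θ := fun c => toCofree D S Z ε ▷ c ≫ act D hS c)
    (η := fun c => centerAct Z ε c) ?_ (fun d d' f => centerAct_naturality Z ε f) ?_ c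
  · intro d d' f
    rw [whisker_exchange_assoc, act_naturality, Category.assoc]
  · intro j
    apply (mate D).injective
    rw [mate_whiskerRight_comp, act_simple, mate_actSimple, toCofree_proj, mate_centerAct]

/-- Acting on the unit is a counit for the cofree object: braiding past `c` and then acting on `𝟙`
is acting on `c ⊗ 𝟙`. Hence the components of the cofree object are its projections. -/
lemma centerAct_cofree (c : C) :
    centerAct (cofreeCenter D hS) ((ρ_ (cofree D S)).inv ≫ act D hS (𝟙_ C)) c = act D hS c := by
  have h1 := cofreeBraid_act D hS c (𝟙_ C)
  have h2 := act_naturality D hS (ρ_ c).hom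
  change cofreeBraid D hS c ≫ c ◁ _ ≫ _ = _
  have h3 : cofree D S ◁ (ρ_ c).inv ≫ cofree D S ◁ (ρ_ c).hom ≫ act D hS c = act D hS c := by
    rw [← MonoidalCategory.whiskerLeft_comp_assoc]
    simp
  rw [← h3, h2]
  calc _ = (ρ_ _).inv ≫ (cofreeBraid D hS c ▷ 𝟙_ C ≫ (α_ _ _ _).hom ≫ c ◁ act D hS (𝟙_ C)) ≫
          (ρ_ c).hom := by monoidal
    _ = _ := by rw [h1]; monoidal

lemma component_cofree (j : ι) :
    component D (cofreeCenter D hS) ((ρ_ (cofree D S)).inv ≫ act D hS (𝟙_ C)) (S j) =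
      cofreeProj D S j := by
  rw [← mate_centerAct, centerAct_cofree, act_simple]
  exact mate_actSimple D j

/-- Both composites land in `c ⊗ A`, so they may be tested by acting on `d`; each then becomes the
action of `Z` on `c ⊗ d`. This is what makes `toCofree` a morphism of the center. -/
lemma toCofree_braid (Z : Center C) (ε : Z.1 ⟶ 𝟙_ C) (c : C) :
    toCofree D S Z ε ▷ c ≫ cofreeBraid D hS c = (Z.2.β c).hom ≫ c ◁ toCofree D S Z ε := by
  apply cofree_ext D hS
  intro d
  have hm : (Z.2.β c).hom ▷ d ≫ (α_ _ _ _).hom ≫ c ◁ centerAct Z ε d =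
      (α_ _ _ _).hom ≫ centerAct Z ε (c ⊗ d) := by
    simp only [centerAct, HalfBraiding.monoidal]
    monoidal
  rw [comp_whiskerRight, Category.assoc, cofreeBraid_act, associator_naturality_left_assoc,
    toCofree_act, comp_whiskerRight, Category.assoc, associator_naturality_middle_assoc,
    ← MonoidalCategory.whiskerLeft_comp, toCofree_act, hm]

/-- `toCofree` as a morphism of the Drinfeld center. -/
def toCofreeCenter (Z : Center C) (ε : Z.1 ⟶ 𝟙_ C) : Z ⟶ cofreeCenter D hS where
  f := toCofree D S Z ε
  comm c := toCofree_braid D hS Z ε c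

/-- The components exhibit `F(I(𝟙))` as the direct sum of the `Sⱼ ⊗ S̄ⱼ`. -/
theorem exists_component_splitting (I : C ⥤ Center C) (adj : Center.forget C ⊣ I) :
    ∃ s : ∀ j, S j ⊗ bar D (S j) ⟶ (I.obj (𝟙_ C)).1,
      (∀ j, s j ≫ component D (I.obj (𝟙_ C)) (adj.counit.app (𝟙_ C)) (S j) = 𝟙 _) ∧
      (∀ j k, j ≠ k → s j ≫ component D (I.obj (𝟙_ C)) (adj.counit.app (𝟙_ C)) (S k) = 0) ∧
      ∑ j, component D (I.obj (𝟙_ C)) (adj.counit.app (𝟙_ C)) (S j) ≫ s j = 𝟙 _ := by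
  set Z := I.obj (𝟙_ C)
  set ε : Z.1 ⟶ 𝟙_ C := adj.counit.app (𝟙_ C)
  set εA : cofree D S ⟶ 𝟙_ C := (ρ_ (cofree D S)).inv ≫ act D hS (𝟙_ C)
  -- The cofreeness of `I(𝟙)` supplies a comparison map in the reverse direction.
  let φ : cofreeCenter D hS ⟶ Z := adj.homEquiv (cofreeCenter D hS) (𝟙_ C) εA
  have hφ : φ.f ≫ ε = εA := by
    have := (adj.homEquiv (cofreeCenter D hS) (𝟙_ C)).symm_apply_apply εA
    rwa [Adjunction.homEquiv_counit] at this
  have hπ : (toCofreeCenter D hS Z ε).f ≫ εA = ε := by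
    have h := toCofree_act D hS Z ε (𝟙_ C)
    change toCofree D S Z ε ≫ (ρ_ _).inv ≫ _ = _
    rw [rightUnitor_inv_naturality_assoc, h, centerAct_unit]
  -- Morphisms into `I(𝟙)` in the center are determined by their composites with the counit.
  have hid : toCofreeCenter D hS Z ε ≫ φ = 𝟙 Z := by
    apply (adj.homEquiv Z (𝟙_ C)).symm.injective
    rw [Adjunction.homEquiv_counit, Adjunction.homEquiv_counit]
    change ((toCofreeCenter D hS Z ε).f ≫ φ.f) ≫ ε = 𝟙 _ ≫ ε
    rw [Category.assoc, hφ, hπ, Category.id_comp]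
  let f : cofree D S ⟶ Z.1 := φ.f
  -- This gives the orthogonality relations; the composite `hid` gives the sum relation. The
  -- opposite composite of `φ` and `toCofreeCenter` need not be computed.
  have hc : ∀ j, f ≫ component D Z ε (S j) = cofreeProj D S j := fun j => by
    refine (component_comp D φ ε (S j)).trans ?_
    rw [hφ]
    exact component_cofree D hS j
  refine ⟨fun j => cofreeIncl D S j ≫ f, fun j => ?_, fun j k hjk => ?_, ?_⟩
  · rw [Category.assoc, hc, cofreeIncl_proj_self]
  · rw [Category.assoc, hc, cofreeIncl_proj_ne D hjk]
  · have h : toCofree D S Z ε ≫ f = 𝟙 Z.1 := congrArg Center.Hom.f hid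
    rw [← h, toCofree, Preadditive.sum_comp]
    exact Finset.sum_congr rfl fun j _ => (Category.assoc _ _ _).symm

end Splitting

end Category

section Category

attribute [local instance] Abelian.hasFiniteBiproducts

variable {C : Type u} [Category.{v} C] [Abelian C] [Linear ℂ C]
  [MonoidalCategory C] [MonoidalPreadditive C] [MonoidalLinear ℂ C]

/-! ### Inner products -/

/-- A function of two variables that is an inner product, linear in the second variable. -/
structure IsInnerForm {M : Type*} [AddCommGroup M] [Module ℂ M] (B : M → M → ℂ) : Prop where
  add_right : ∀ x y z, B x (y + z) = B x y + B x z
  smul_right : ∀ x (r : ℂ) y, B x (r • y) = r * B x y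
  conj_symm : ∀ x y, conj (B y x) = B x y
  re_nonneg : ∀ x, 0 ≤ (B x x).re
  definite : ∀ x, B x x = 0 → x = 0

namespace IsInnerForm

variable {M : Type*} [AddCommGroup M] [Module ℂ M] {B : M → M → ℂ}

lemma add_left (h : IsInnerForm B) (x y z : M) : B (x + y) z = B x z + B y z := by
  rw [← h.conj_symm, h.add_right, map_add, h.conj_symm, h.conj_symm]

lemma smul_left (h : IsInnerForm B) (r : ℂ) (x y : M) : B (r • x) y = conj r * B x y := by
  rw [← h.conj_symm, h.smul_right, map_mul, h.conj_symm]

lemma zero_right (h : IsInnerForm B) (x : M) : B x 0 = 0 := by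
  have := h.smul_right x 0 0
  simpa using this

lemma zero_left (h : IsInnerForm B) (x : M) : B 0 x = 0 := by
  rw [← h.conj_symm, h.zero_right, map_zero]

lemma sum_right (h : IsInnerForm B) {κ : Type*} (s : Finset κ) (x : M) (f : κ → M) :
    B x (∑ k ∈ s, f k) = ∑ k ∈ s, B x (f k) :=
  map_sum (AddMonoidHom.mk' (B x) (h.add_right x)) f s

lemma sum_left (h : IsInnerForm B) {κ : Type*} (s : Finset κ) (f : κ → M) (x : M) :
    B (∑ k ∈ s, f k) x = ∑ k ∈ s, B (f k) x :=
  map_sum (AddMonoidHom.mk' (fun y => B y x) fun y z => h.add_left y z x) f s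

lemma self_eq_re (h : IsInnerForm B) (x : M) : B x x = (B x x).re :=
  (Complex.conj_eq_iff_re.1 (h.conj_symm x x)).symm

/-- An orthonormal basis expands an inner product. -/
lemma eq_sum_repr (h : IsInnerForm B) {κ : Type*} [Fintype κ] [DecidableEq κ]
    (b : Module.Basis κ ℂ M) (hb : ∀ i j, B (b i) (b j) = if i = j then 1 else 0) (x y : M) :
    B x y = ∑ k, conj (b.repr x k) * b.repr y k := by
  conv_lhs => rw [← b.sum_repr x, ← b.sum_repr y]
  simp_rw [h.sum_left, h.sum_right, h.smul_left, h.smul_right, hb]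
  simp

lemma exists_orthonormal [FiniteDimensional ℂ M] (h : IsInnerForm B) :
    ∃ b : Module.Basis (Fin (Module.finrank ℂ M)) ℂ M,
      ∀ i j, B (b i) (b j) = if i = j then 1 else 0 := by
  let core : InnerProductSpace.Core ℂ M :=
    { inner := B
      conj_inner_symm := h.conj_symm
      re_inner_nonneg := h.re_nonneg
      add_left := h.add_left
      smul_left := fun x y r => h.smul_left r x y
      definite := h.definite }
  let _ := core.toNormedAddCommGroup
  let _ : InnerProductSpace ℂ M := InnerProductSpace.ofCore core.toCore
  let e := stdOrthonormalBasis ℂ M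
  refine ⟨e.toBasis, fun i j => ?_⟩
  rw [OrthonormalBasis.coe_toBasis]
  exact orthonormal_iff_ite.1 e.orthonormal i j

/-- A positive combination of inner products, along jointly injective maps, is one. -/
lemma sum_comp {κ : Type*} [Fintype κ] {N : κ → Type*} [∀ k, AddCommGroup (N k)]
    [∀ k, Module ℂ (N k)] {A : ∀ k, N k → N k → ℂ} (hA : ∀ k, IsInnerForm (A k))
    (T : ∀ k, M →ₗ[ℂ] N k) (r : κ → ℝ) (hr : ∀ k, 0 < r k) (hT : ∀ x, (∀ k, T k x = 0) → x = 0) :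
    IsInnerForm fun x y => ∑ k, (r k : ℂ) * A k (T k x) (T k y) where
  add_right x y z := by simp [(hA _).add_right, mul_add, Finset.sum_add_distrib]
  smul_right x c y := by simp [(hA _).smul_right, Finset.mul_sum, mul_left_comm]
  conj_symm x y := by simp [(hA _).conj_symm]
  re_nonneg x := by
    rw [Complex.re_sum]
    refine Finset.sum_nonneg fun k _ => ?_
    rw [Complex.re_ofReal_mul]
    exact mul_nonneg (hr k).le ((hA k).re_nonneg _)
  definite x hx := by
    refine hT x fun k => (hA k).definite _ ?_
    have h1 := congrArg Complex.re hx
    rw [Complex.re_sum, Complex.zero_re, Finset.sum_eq_zero_iff_of_nonneg] at h1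
    · have h2 := h1 k (Finset.mem_univ _)
      rw [Complex.re_ofReal_mul, mul_eq_zero] at h2
      rw [(hA k).self_eq_re, h2.resolve_left (hr k).ne', Complex.ofReal_zero]
    · intro k _
      rw [Complex.re_ofReal_mul]
      exact mul_nonneg (hr k).le ((hA k).re_nonneg _)

end IsInnerForm

variable [UnitaryFusionCategory C]

open UnitaryFusionCategory

lemma scal_smul_id (c : ℂ) : scal (c • 𝟙 (𝟙_ C)) = c := by
  have h : (Linear.comp (𝟙_ C) (𝟙_ C) (𝟙_ C)).flip (𝟙 (𝟙_ C)) =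
      (LinearMap.id : (𝟙_ C ⟶ 𝟙_ C) →ₗ[ℂ] (𝟙_ C ⟶ 𝟙_ C)) := by
    apply LinearMap.ext
    intro f
    simp
  have h1 : Module.finrank ℂ (𝟙_ C ⟶ 𝟙_ C) = 1 := finrank_endomorphism_simple_eq_one ℂ (𝟙_ C)
  rw [map_smul, scal, LinearMap.comp_apply, h, LinearMap.trace_id, h1]
  simp

lemma eq_scal_smul_id (f : 𝟙_ C ⟶ 𝟙_ C) : f = scal f • 𝟙 (𝟙_ C) := by
  obtain ⟨c, rfl⟩ := endomorphism_simple_eq_smul_id ℂ f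
  rw [scal_smul_id]

lemma scal_dag (f : 𝟙_ C ⟶ 𝟙_ C) : scal (dag f) = conj (scal f) := by
  conv_lhs => rw [eq_scal_smul_id f, dag_smul, dag_id, scal_smul_id]

/-- The positivity axiom replaces `f ≫ dag f` by `g ≫ dag g` with `g` an endomorphism of the unit.
As `g` is a scalar, the form takes a value `|c|²`; definiteness is faithfulness of the dagger. -/
lemma isInnerForm_scal (X : C) : IsInnerForm fun f g : 𝟙_ C ⟶ X => scal (g ≫ dag f) := by
  have key : ∀ f : 𝟙_ C ⟶ X, ∃ c : ℂ, f ≫ dag f = (c * conj c) • 𝟙 (𝟙_ C) := by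
    intro f
    obtain ⟨g, hg⟩ := positive f
    refine ⟨scal g, ?_⟩
    rw [hg]
    conv_lhs => rw [eq_scal_smul_id g, dag_smul, dag_id]
    rw [Linear.comp_smul, Linear.smul_comp, Category.comp_id, smul_smul, mul_comm]
  refine ⟨?_, ?_, ?_, ?_, ?_⟩
  · intro f g h
    simp
  · intro f r g
    simp
  · intro f g
    rw [← scal_dag, dag_comp, dag_dag]
  · intro f
    obtain ⟨c, hc⟩ := key f
    rw [hc, scal_smul_id, Complex.mul_conj, Complex.ofReal_re]
    exact Complex.normSq_nonneg c
  · intro f hf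
    apply faithful
    rw [eq_scal_smul_id (f ≫ dag f)]
    rw [hf, zero_smul]

variable (D : SphericalStructure C)

/-- A spherical trace inner product is the inner product of bent maps. -/
lemma isInnerForm_trInner (a b : C) :
    IsInnerForm fun f g : a ⟶ b => trInner D f g := by
  let T : (a ⟶ b) →ₗ[ℂ] (𝟙_ C ⟶ b ⊗ bar D a) :=
    { toFun := fun f => coev D a ≫ f ▷ bar D a
      map_add' := by intro f g; simp
      map_smul' := by intro r f; simp }
  -- Bending loses nothing: up to a unitor, the bent map is the mate of `f`, and taking mates is a
  -- bijection.
  have hT : ∀ f, (∀ _ : Unit, T f = 0) → f = 0 := by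
    intro f hf
    have h0 : coev D a ≫ f ▷ bar D a = 0 := hf ()
    have h1 : mate D ((λ_ a).hom ≫ f) = 0 := by
      calc _ = 𝟙 _ ⊗≫ (coev D a ≫ f ▷ bar D a) := by
            rw [mate_apply]; monoidal
        _ = 0 := by rw [h0]; simp [monoidalComp]
    have h2 : mate D (0 : 𝟙_ C ⊗ a ⟶ b) = 0 := by simp [mate_apply]
    rw [← h2] at h1
    have := (mate D).injective h1
    rw [← cancel_epi (λ_ a).hom, this, comp_zero]
  have := IsInnerForm.sum_comp (κ := Unit) (fun _ => isInnerForm_scal (b ⊗ bar D a))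
    (fun _ => T) (fun _ => 1) (fun _ => one_pos) hT
  convert this using 3 with f g
  simp [T, trInner, tr, dag_comp, dag_whiskerRight]

/-- The quantum dimension is the squared norm of the identity for the trace inner product. -/
lemma dim_pos {c : C} (hc : 𝟙 c ≠ 0) : 0 < dim D c := by
  have h := isInnerForm_trInner D c c
  have h1 : trInner D (𝟙 c) (𝟙 c) = tr D (𝟙 c) := by
    rw [trInner, dag_id, Category.comp_id]
  rw [dim, ← h1]
  refine lt_of_le_of_ne (h.re_nonneg (𝟙 c)) fun h0 => hc (h.definite _ ?_)
  rw [h.self_eq_re, ← h0, Complex.ofReal_zero]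

lemma IsIrr.dim_pos {ι : Type w} {S : ι → C} (hS : IsIrr S) (j : ι) : 0 < dim D (S j) := by
  have := hS.simple j
  exact StringNet.dim_pos D (id_nonzero (S j))

omit [UnitaryFusionCategory C] in
-- A resolution of the identity of `X` tensors up to one of its powers. It is used to see that the
-- components in the skein inner product are jointly injective.
lemma sum_tensorFamMap {ι : Type w} [Fintype ι] {X : C} {Y : ι → C} (p : ∀ j, X ⟶ Y j)
    (i : ∀ j, Y j ⟶ X) (h : ∑ j, p j ≫ i j = 𝟙 X) (n : ℕ) :
    ∑ j : Fin n → ι, tensorFamMap n (fun k => p (j k)) ≫ tensorFamMap n (fun k => i (j k)) =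
      𝟙 (tensorFam n fun _ => X) := by
  induction n with
  | zero =>
    rw [Fintype.sum_unique]
    exact Category.comp_id _
  | succ n ih =>
    rw [← (Fin.consEquiv fun _ => ι).sum_comp, Fintype.sum_prod_type]
    have : ∀ (a : ι) (j : Fin n → ι),
        tensorFamMap (n + 1) (fun k => p ((Fin.consEquiv fun _ => ι) (a, j) k)) ≫
          tensorFamMap (n + 1) (fun k => i ((Fin.consEquiv fun _ => ι) (a, j) k)) =
        (p a ≫ i a) ⊗ₘ (tensorFamMap n (fun k => p (j k)) ≫ tensorFamMap n (fun k => i (j k))) :=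
      fun a j => tensorHom_comp_tensorHom _ _ _ _
    refine (Finset.sum_congr rfl fun a _ => (Finset.sum_congr rfl fun j _ => this a j).trans
      (tensor_sum _ _ _).symm).trans ?_
    refine (sum_tensor _ _ _).symm.trans ?_
    rw [ih, h]
    exact id_tensorHom_id _ _

end Category

/-! ### Half-edges of the square lattice -/

section HalfEdges

/-- The half-edges of the square lattice. -/
abbrev HalfEdge := (ℤ × ℤ) × Dir

namespace HalfEdge

/-- The vertex at the other end of the edge. -/
def far (h : HalfEdge) : ℤ × ℤ := h.1 + h.2.vec

/-- The other half of the edge. -/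
def flip (h : HalfEdge) : HalfEdge := (h.far, h.2.opp)

/-- The edge of a half-edge, presented by its outgoing half. -/
def edge (h : HalfEdge) : HalfEdge := if h.2.IsOutgoing then h else h.flip

end HalfEdge

lemma Dir.vec_opp (d : Dir) : d.opp.vec = -d.vec := by
  cases d <;> rfl

lemma Dir.opp_opp (d : Dir) : d.opp.opp = d := by
  cases d <;> rfl

lemma Dir.isOutgoing_opp (d : Dir) : d.opp.IsOutgoing ↔ ¬ d.IsOutgoing := by
  cases d <;> simp [Dir.opp, Dir.IsOutgoing]

namespace HalfEdge

lemma flip_flip (h : HalfEdge) : h.flip.flip = h := by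
  simp [flip, far, Dir.vec_opp, Dir.opp_opp]

lemma far_flip (h : HalfEdge) : h.flip.far = h.1 := by
  simp [flip, far, Dir.vec_opp]

lemma edge_eq_iff (h k : HalfEdge) : h.edge = k.edge ↔ h = k ∨ h = k.flip := by
  have inj : ∀ a b : HalfEdge, a.flip = b.flip → a = b := fun a b hab => by
    rw [← flip_flip a, hab, flip_flip]
  have ho : ∀ a : HalfEdge, a.flip.2.IsOutgoing ↔ ¬ a.2.IsOutgoing :=
    fun a => Dir.isOutgoing_opp a.2
  unfold edge
  split_ifs with h1 h2 h2
  · constructor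
    · exact Or.inl
    · rintro (h | rfl)
      · exact h
      · exact absurd h2 ((ho k).1 h1)
  · constructor
    · exact Or.inr
    · rintro (rfl | h)
      · exact absurd h1 h2
      · exact h
  · constructor
    · rintro rfl
      exact Or.inr (flip_flip h).symm
    · rintro (rfl | rfl)
      · exact absurd h2 h1
      · exact flip_flip k
  · constructor
    · exact fun h => Or.inl (inj _ _ h)
    · rintro (rfl | rfl)
      · rfl
      · exact absurd ((ho k).2 h2) h1

end HalfEdge

/-- The internal edges of a patch, presented by their outgoing halves. -/
def intEdges (V : Finset (ℤ × ℤ)) : Finset HalfEdge :=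
  (V ×ˢ Finset.univ).filter fun h => h.2.IsOutgoing ∧ HalfEdge.far h ∈ V

lemma mem_intEdges {V : Finset (ℤ × ℤ)} {h : HalfEdge} :
    h ∈ intEdges V ↔ h.1 ∈ V ∧ h.2.IsOutgoing ∧ h.far ∈ V := by
  simp [intEdges]

lemma edge_mem_intEdges {V : Finset (ℤ × ℤ)} {h : HalfEdge} :
    h.edge ∈ intEdges V ↔ h.1 ∈ V ∧ h.far ∈ V := by
  rw [mem_intEdges, HalfEdge.edge]
  split_ifs with ho
  · tauto
  · rw [HalfEdge.far_flip]
    have : h.flip.2.IsOutgoing := (Dir.isOutgoing_opp h.2).2 ho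
    simp only [HalfEdge.flip] at this ⊢
    tauto

end HalfEdges

/-! ### Summation over some of the variables -/

section Marginal

variable {α ι : Type*} [DecidableEq α] [Fintype ι]

/-- The sum of a function over the values of the variables in a finite set. -/
def marginal (E : Finset α) (F : (α → ι) → ℕ) (x : α → ι) : ℕ :=
  ∑ a : E → ι, F (Function.updateFinset x E a)

lemma marginal_empty (F : (α → ι) → ℕ) (x : α → ι) : marginal ∅ F x = F x := by
  simp [marginal]

lemma marginal_singleton (e : α) (F : (α → ι) → ℕ) (x : α → ι) :
    marginal {e} F x = ∑ j, F (Function.update x e j) := by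
  rw [marginal, ← (Equiv.funUnique ({e} : Finset α) ι).symm.sum_comp]
  refine Finset.sum_congr rfl fun j _ => ?_
  rw [Function.updateFinset_singleton]
  rfl

lemma marginal_union {E E' : Finset α} (h : Disjoint E E') (F : (α → ι) → ℕ) (x : α → ι) :
    marginal (E ∪ E') F x = marginal E (marginal E' F) x := by
  rw [marginal, ← (Equiv.piFinsetUnion (fun _ => ι) h).sum_comp, Fintype.sum_prod_type]
  refine Finset.sum_congr rfl fun a _ => Finset.sum_congr rfl fun b _ => ?_
  rw [Function.updateFinset_updateFinset h]

lemma marginal_congr {E : Finset α} {F G : (α → ι) → ℕ} (h : ∀ y, F y = G y) (x : α → ι) :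
    marginal E F x = marginal E G x := by
  rw [funext h]

lemma marginal_mul_left {E : Finset α} {F G : (α → ι) → ℕ}
    (hF : ∀ y z, (∀ e ∉ E, y e = z e) → F y = F z) (x : α → ι) :
    marginal E (fun y => F y * G y) x = F x * marginal E G x := by
  rw [marginal, marginal, Finset.mul_sum]
  refine Finset.sum_congr rfl fun a _ => ?_
  congr 1
  refine hF _ _ fun e he => ?_
  simp [Function.updateFinset, he]

lemma marginal_mul_right {E : Finset α} {F G : (α → ι) → ℕ}
    (hG : ∀ y z, (∀ e ∉ E, y e = z e) → G y = G z) (x : α → ι) :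
    marginal E (fun y => F y * G y) x = marginal E F x * G x := by
  simp_rw [mul_comm _ (G _)]
  exact marginal_mul_left hG x

/-- A marginal sum only depends on the values that the function depends on. -/
lemma marginal_dependsOn {E A : Finset α} {F : (α → ι) → ℕ}
    (hF : ∀ y z, (∀ e ∉ A, y e = z e) → F y = F z) (y z : α → ι)
    (h : ∀ e ∉ A, y e = z e) : marginal E F y = marginal E F z := by
  refine Finset.sum_congr rfl fun a _ => hF _ _ fun e he => ?_
  by_cases h' : e ∈ E <;> simp [Function.updateFinset, h', h e he]

end Marginal

/-! ### State sums on patches -/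

section StateSum

variable {ι : Type w} [Fintype ι]

/-- The signed label of a half-edge, if the edges are labelled by `x`. -/
def letter (x : HalfEdge → ι) (h : HalfEdge) : ι × Bool := (x h.edge, decide h.2.IsOutgoing)

/-- A function on cyclic words of signed labels and numbers of plaquettes that is compatible with
gluing. -/
structure IsWordSum (T : List (ι × Bool) → ℕ → ℕ) : Prop where
  swap : ∀ L M n, T (L ++ M) n = T (M ++ L) n
  glue : ∀ L M s n m, ∑ j, T (L ++ [(j, s)]) n * T ((j, !s) :: M) m = T (L ++ M) (n + m)
  pair : ∀ L n, ∑ j, T ((j, false) :: (j, true) :: L) n = T L (n + 1)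

variable (T : List (ι × Bool) → ℕ → ℕ)

/-- The weight of a vertex. -/
def vertexWeight (v : ℤ × ℤ) (x : HalfEdge → ι) : ℕ :=
  T [letter x (v, .east), letter x (v, .north), letter x (v, .west), letter x (v, .south)] 0

/-- The sum of the products of the vertex weights over all labels of the internal edges. -/
def stateSum (V : Finset (ℤ × ℤ)) (x : HalfEdge → ι) : ℕ :=
  marginal (intEdges V) (fun y => ∏ v ∈ V, vertexWeight T v y) x

variable {T}

lemma letter_congr {x y : HalfEdge → ι} {h : HalfEdge} (hxy : x h.edge = y h.edge) :
    letter x h = letter y h := by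
  rw [letter, letter, hxy]

lemma vertexWeight_congr {v : ℤ × ℤ} {x y : HalfEdge → ι}
    (h : ∀ d, x (HalfEdge.edge (v, d)) = y (HalfEdge.edge (v, d))) :
    vertexWeight T v x = vertexWeight T v y := by
  simp only [vertexWeight, letter_congr (h _)]

/-- The vertex weights away from a patch do not depend on its internal edges. -/
lemma vertexWeight_dependsOn {V : Finset (ℤ × ℤ)} {v : ℤ × ℤ} (hv : v ∉ V) (x y : HalfEdge → ι)
    (h : ∀ e ∉ intEdges V, x e = y e) : vertexWeight T v x = vertexWeight T v y :=
  vertexWeight_congr fun _ => h _ fun hd => hv (edge_mem_intEdges.1 hd).1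

lemma prod_vertexWeight_dependsOn {V V' : Finset (ℤ × ℤ)} (hV : Disjoint V V')
    (x y : HalfEdge → ι) (h : ∀ e ∉ intEdges V, x e = y e) :
    ∏ v ∈ V', vertexWeight T v x = ∏ v ∈ V', vertexWeight T v y :=
  Finset.prod_congr rfl fun _ hv =>
    vertexWeight_dependsOn (fun hv' => Finset.disjoint_left.1 hV hv' hv) x y h

lemma stateSum_singleton (v : ℤ × ℤ) (x : HalfEdge → ι) :
    stateSum T {v} x = vertexWeight T v x := by
  have : intEdges {v} = ∅ := by
    ext ⟨p, d⟩
    simp only [mem_intEdges, Finset.mem_singleton, HalfEdge.far, Finset.notMem_empty, iff_false]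
    rintro ⟨rfl, -, h⟩
    cases d <;> simp [Dir.vec, Prod.ext_iff] at h
  rw [stateSum, this, marginal_empty, Finset.prod_singleton]

/-- Attaching a vertex to a patch. -/
lemma stateSum_insert {V : Finset (ℤ × ℤ)} {v : ℤ × ℤ} (hv : v ∉ V) {E : Finset HalfEdge}
    (hE : intEdges (insert v V) = E ∪ intEdges V) (hd : Disjoint E (intEdges V))
    (x : HalfEdge → ι) :
    stateSum T (insert v V) x = marginal E (fun y => vertexWeight T v y * stateSum T V y) x := by
  rw [stateSum, hE, marginal_union hd]
  refine marginal_congr (fun y => ?_) x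
  simp_rw [Finset.prod_insert hv]
  exact marginal_mul_left (vertexWeight_dependsOn hv) y

/-- The state sum of a disjoint union. -/
lemma stateSum_union {V V' : Finset (ℤ × ℤ)} (hV : Disjoint V V')
    (hE : intEdges (V ∪ V') = intEdges V ∪ intEdges V') (x : HalfEdge → ι) :
    stateSum T (V ∪ V') x = stateSum T V x * stateSum T V' x := by
  have hd : Disjoint (intEdges V) (intEdges V') := by
    rw [Finset.disjoint_left] at hV ⊢
    intro h h1 h2
    exact hV (mem_intEdges.1 h1).1 (mem_intEdges.1 h2).1
  rw [stateSum, hE, marginal_union hd]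
  simp_rw [Finset.prod_union hV]
  rw [marginal_congr (fun y => marginal_mul_left (prod_vertexWeight_dependsOn hV.symm) y)]
  exact marginal_mul_right
    (fun y z h => marginal_dependsOn (prod_vertexWeight_dependsOn hV) y z h) x

end StateSum

/-! ### Walks around the outside of a patch -/

section Outline

/-- A walk around a patch: it inspects half-edges in counterclockwise order, emits them if they are
external, and goes to their other end if they are internal. -/
inductive OutlineWalk (V : Finset (ℤ × ℤ)) : HalfEdge → List HalfEdge → HalfEdge → Prop
  | nil (c : HalfEdge) : OutlineWalk V c [] c
  | leg {c c' : HalfEdge} {L : List HalfEdge} : c.far ∉ V →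
      OutlineWalk V (c.1, c.2.next) L c' → OutlineWalk V c (c :: L) c'
  | edge {c c' : HalfEdge} {L : List HalfEdge} : c.far ∈ V →
      OutlineWalk V (c.far, c.2.opp.next) L c' → OutlineWalk V c L c'

namespace OutlineWalk

variable {V V' : Finset (ℤ × ℤ)}

lemma append {c c' c'' : HalfEdge} {L L' : List HalfEdge} (h : OutlineWalk V c L c')
    (h' : OutlineWalk V c' L' c'') : OutlineWalk V c (L ++ L') c'' := by
  induction h with
  | nil => exact h'
  | leg hc _ ih => exact .leg hc (ih h')
  | edge hc _ ih => exact .edge hc (ih h')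

lemma inv {c c' : HalfEdge} {L : List HalfEdge} (h : OutlineWalk V c L c') :
    (c = c' ∧ L = []) ∨
      (c.far ∉ V ∧ ∃ L', L = c :: L' ∧ OutlineWalk V (c.1, c.2.next) L' c') ∨
      (c.far ∈ V ∧ OutlineWalk V (c.far, c.2.opp.next) L c') := by
  cases h with
  | nil => exact Or.inl ⟨rfl, rfl⟩
  | leg hc h => exact Or.inr (Or.inl ⟨hc, _, rfl, h⟩)
  | edge hc h => exact Or.inr (Or.inr ⟨hc, h⟩)

/-- Internal edges stay internal when the patch grows, so only the emitted half-edges need checking.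
-/
lemma mono (hV : V ⊆ V') {c c' : HalfEdge} {L : List HalfEdge} (h : OutlineWalk V c L c')
    (hL : ∀ l ∈ L, l.far ∉ V') : OutlineWalk V' c L c' := by
  induction h with
  | nil => exact .nil _
  | leg hc _ ih => exact .leg (hL _ (by simp)) (ih fun l hl => hL l (by simp [hl]))
  | edge hc _ ih => exact .edge (hV hc) (ih hL)

/-- A half-edge is emitted exactly when the walk stands on it, so the walk can be cut there and
resumed at the next direction. -/
lemma split {c c' l : HalfEdge} {A B M : List HalfEdge} (h : OutlineWalk V c M c')
    (hM : M = A ++ l :: B) : OutlineWalk V c A l ∧ OutlineWalk V (l.1, l.2.next) B c' := by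
  induction h generalizing A with
  | nil => simp at hM
  | @leg c c' L hc h ih =>
    cases A with
    | nil =>
      obtain ⟨rfl, rfl⟩ := List.cons_eq_cons.1 hM
      exact ⟨.nil _, h⟩
    | cons a A =>
      obtain ⟨rfl, rfl⟩ := List.cons_eq_cons.1 hM
      obtain ⟨h1, h2⟩ := ih rfl
      exact ⟨.leg hc h1, h2⟩
  | edge hc _ ih =>
    obtain ⟨h1, h2⟩ := ih hM
    exact ⟨.edge hc h1, h2⟩

end OutlineWalk

/-- `l :: R` is the list of the external edges of `V` in counterclockwise order. -/
structure IsOutline (V : Finset (ℤ × ℤ)) (l : HalfEdge) (R : List HalfEdge) : Prop where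
  walk : OutlineWalk V (l.1, l.2.next) R l
  nodup : (l :: R).Nodup
  mem_iff : ∀ h : HalfEdge, h ∈ l :: R ↔ h.1 ∈ V ∧ h.far ∉ V

/-- An outline is a cycle: cutting at `l'` and exchanging the two arcs starts it there. The lists
`A`, `B` record the rotation so that it can be matched with the `swap` rule. -/
lemma IsOutline.rotate {V : Finset (ℤ × ℤ)} {l l' : HalfEdge} {R : List HalfEdge}
    (h : IsOutline V l R) (hl : l'.1 ∈ V) (hl' : l'.far ∉ V) :
    ∃ R' A B, IsOutline V l' R' ∧ l :: R = A ++ B ∧ l' :: R' = B ++ A := by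
  have hm := (h.mem_iff l').2 ⟨hl, hl'⟩
  rcases List.mem_cons.1 hm with rfl | hm
  · exact ⟨R, [], _, h, rfl, by simp⟩
  · obtain ⟨A, B, rfl⟩ := List.append_of_mem hm
    obtain ⟨h1, h2⟩ := h.walk.split rfl
    have hp : (l' :: (B ++ l :: A)).Perm (l :: (A ++ l' :: B)) := by
      have : (l' :: B ++ l :: A).Perm (l :: A ++ l' :: B) := List.perm_append_comm
      simpa using this
    refine ⟨B ++ l :: A, l :: A, l' :: B, ⟨?_, ?_, ?_⟩, by simp, by simp⟩
    · exact h2.append (.leg ((h.mem_iff l).1 (by simp)).2 h1)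
    · exact hp.nodup_iff.2 h.nodup
    · intro k
      rw [hp.mem_iff, h.mem_iff]

end Outline

/-! ### Removing an extremal vertex -/

section Extremal

/-- The plaquettes of a patch, presented by their lower left corners. -/
def plaquettes (V : Finset (ℤ × ℤ)) : Finset (ℤ × ℤ) :=
  V.filter fun p => p + (1, 0) ∈ V ∧ p + (0, 1) ∈ V ∧ p + (1, 1) ∈ V

lemma card_plaquettes (V : Finset (ℤ × ℤ)) : (plaquettes V).card = numPlaquettes V := rfl

lemma mem_plaquettes {V : Finset (ℤ × ℤ)} {p : ℤ × ℤ} : p ∈ plaquettes V ↔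
    p ∈ V ∧ p + (1, 0) ∈ V ∧ p + (0, 1) ∈ V ∧ p + (1, 1) ∈ V := by
  simp [plaquettes]

/-- The Euler characteristic of a patch. -/
def eulerChar (V : Finset (ℤ × ℤ)) : ℤ := V.card - (intEdges V).card + numPlaquettes V

/-- A set of vertices is connected if it is non-empty and has no proper non-empty subset that is
closed under adjacency. -/
structure IsConn (V : Finset (ℤ × ℤ)) : Prop where
  nonempty : V.Nonempty
  eq_of_closed : ∀ A ⊆ V, A.Nonempty → (∀ p ∈ A, ∀ d : Dir, p + d.vec ∈ V → p + d.vec ∈ A) → A = V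

/-- Maximize the sum of the coordinates. Such a vertex can be attached only by its west and south
edges, which keeps the induction to a few cases. -/
lemma exists_extremal {V : Finset (ℤ × ℤ)} (h : V.Nonempty) :
    ∃ v ∈ V, v + Dir.east.vec ∉ V ∧ v + Dir.north.vec ∉ V := by
  obtain ⟨v, hv, hmax⟩ := V.exists_max_image (fun p => p.1 + p.2) h
  refine ⟨v, hv, fun h => ?_, fun h => ?_⟩
  · have := hmax _ h
    simp [Dir.vec, add_right_comm] at this
  · have := hmax _ h
    simp [Dir.vec] at this

/-- The neighbour in a direction. -/
abbrev nbr (v : ℤ × ℤ) (d : Dir) : ℤ × ℤ := v + d.vec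

lemma nbr_ne (v : ℤ × ℤ) (d : Dir) : nbr v d ≠ v := by
  cases d <;> simp [nbr, Dir.vec, Prod.ext_iff]

lemma nbr_opp (v : ℤ × ℤ) (d : Dir) : nbr (nbr v d) d.opp = v := by
  simp [nbr, Dir.vec_opp]

lemma nbr_eq_iff {p v : ℤ × ℤ} {d : Dir} : p + d.vec = v ↔ p = nbr v d.opp := by
  rw [nbr, Dir.vec_opp, eq_add_neg_iff_add_eq]

variable {V : Finset (ℤ × ℤ)} {v : ℤ × ℤ}

lemma mem_intEdges_insert (hE : nbr v .east ∉ V) (hN : nbr v .north ∉ V) {h : HalfEdge} :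
    h ∈ intEdges (insert v V) ↔ (nbr v .west ∈ V ∧ h = (nbr v .west, .east)) ∨
      (nbr v .south ∈ V ∧ h = (nbr v .south, .north)) ∨ h ∈ intEdges V := by
  obtain ⟨p, d⟩ := h
  simp only [mem_intEdges, HalfEdge.far, Finset.mem_insert]
  constructor
  · rintro ⟨h1, h2, h3⟩
    rcases h1 with rfl | h1
    · rcases h2 with h2 | h2 <;> subst h2
      · exact absurd (h3.resolve_left (nbr_ne _ _)) hE
      · exact absurd (h3.resolve_left (nbr_ne _ _)) hN
    · rcases h3 with h3 | h3
      · rw [nbr_eq_iff] at h3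
        subst h3
        rcases h2 with h2 | h2 <;> subst h2
        · exact Or.inl ⟨h1, rfl⟩
        · exact Or.inr (Or.inl ⟨h1, rfl⟩)
      · exact Or.inr (Or.inr ⟨h1, h2, h3⟩)
  · rintro (⟨h1, h2⟩ | ⟨h1, h2⟩ | ⟨h1, h2, h3⟩)
    · obtain ⟨rfl, rfl⟩ := Prod.mk.inj h2
      exact ⟨Or.inr h1, Or.inl rfl, Or.inl (nbr_opp v .west)⟩
    · obtain ⟨rfl, rfl⟩ := Prod.mk.inj h2
      exact ⟨Or.inr h1, Or.inr rfl, Or.inl (nbr_opp v .south)⟩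
    · exact ⟨Or.inr h1, h2, Or.inr h3⟩

/-- The new vertex can only be the upper right corner of a plaquette: in any other position the
plaquette also contains its east or north neighbour. -/
lemma mem_plaquettes_insert (hE : nbr v .east ∉ V) (hN : nbr v .north ∉ V)
    {p : ℤ × ℤ} : p ∈ plaquettes (insert v V) ↔
      (p = v + (-1, -1) ∧ v + (-1, -1) ∈ V ∧ nbr v .west ∈ V ∧ nbr v .south ∈ V) ∨
        p ∈ plaquettes V := by
  have e1 : ∀ q : ℤ × ℤ, q + (1, 0) = v ↔ q = nbr v .west := fun q => nbr_eq_iff (d := .east)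
  have e2 : ∀ q : ℤ × ℤ, q + (0, 1) = v ↔ q = nbr v .south := fun q => nbr_eq_iff (d := .north)
  have e3 : ∀ q : ℤ × ℤ, q + (1, 1) = v ↔ q = v + (-1, -1) := fun q => by
    rw [show ((-1, -1) : ℤ × ℤ) = -(1, 1) by rfl, eq_add_neg_iff_add_eq]
  have f1 : nbr v .west + (0, 1) + (1, 0) = nbr v .north := by
    simp [nbr, Dir.vec, Prod.ext_iff]
  have f2 : nbr v .south + (1, 0) + (0, 1) = nbr v .east := by
    simp [nbr, Dir.vec, Prod.ext_iff]
  have f3 : v + (-1, -1) + (1, 0) = nbr v .south := by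
    simp [nbr, Dir.vec, Prod.ext_iff]
  have f4 : v + (-1, -1) + (0, 1) = nbr v .west := by
    simp [nbr, Dir.vec, Prod.ext_iff]
  have f5 : ∀ q : ℤ × ℤ, q + (1, 0) + (0, 1) = q + (1, 1) := fun q => by
    simp [add_assoc]
  have f6 : ∀ q : ℤ × ℤ, q + (0, 1) + (1, 0) = q + (1, 1) := fun q => by
    simp [add_assoc]
  have n1 : nbr v .east ≠ v := nbr_ne _ _
  have n2 : nbr v .north ≠ v := nbr_ne _ _
  have n3 : nbr v .west ≠ v := nbr_ne _ _
  have n4 : nbr v .south ≠ v := nbr_ne _ _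
  have n5 : v + (-1, -1) ≠ v := by simp [Prod.ext_iff]
  simp only [mem_plaquettes, Finset.mem_insert]
  constructor
  · rintro ⟨h1, h2, h3, h4⟩
    rcases h1 with rfl | h1
    · exact absurd (h2.resolve_left n1) hE
    rcases h2 with h2 | h2
    · rw [e1] at h2
      subst h2
      rw [← f6, f1] at h4
      exact absurd (h4.resolve_left n2) hN
    rcases h3 with h3 | h3
    · rw [e2] at h3
      subst h3
      rw [← f5, f2] at h4
      exact absurd (h4.resolve_left n1) hE
    rcases h4 with h4 | h4
    · rw [e3] at h4
      subst h4
      rw [f3] at h2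
      rw [f4] at h3
      exact Or.inl ⟨rfl, h1, h3, h2⟩
    · exact Or.inr ⟨h1, h2, h3, h4⟩
  · rintro (⟨rfl, h1, h2, h3⟩ | ⟨h1, h2, h3, h4⟩)
    · rw [f3, f4, (e3 _).2 rfl]
      exact ⟨Or.inr h1, Or.inr h3, Or.inr h2, Or.inl rfl⟩
    · exact ⟨Or.inr h1, Or.inr h2, Or.inr h3, Or.inr h4⟩

section Disjoint

variable {V' : Finset (ℤ × ℤ)}

lemma intEdges_union (h : ∀ p ∈ V, ∀ d : Dir, p + d.vec ∉ V') :
    intEdges (V ∪ V') = intEdges V ∪ intEdges V' := by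
  ext ⟨p, d⟩
  simp only [mem_intEdges, HalfEdge.far, Finset.mem_union]
  constructor
  · rintro ⟨h1 | h1, h2, h3 | h3⟩
    · exact Or.inl ⟨h1, h2, h3⟩
    · exact absurd h3 (h p h1 d)
    · refine absurd h1 ?_
      have := h _ h3 d.opp
      rwa [Dir.vec_opp, add_neg_cancel_right] at this
    · exact Or.inr ⟨h1, h2, h3⟩
  · tauto

/-- The corners of a plaquette are joined by its sides, so they cannot be distributed over two sets
without adjacent vertices. -/
lemma plaquettes_union (h : ∀ p ∈ V, ∀ d : Dir, p + d.vec ∉ V') :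
    plaquettes (V ∪ V') = plaquettes V ∪ plaquettes V' := by
  have h' : ∀ p ∈ V', ∀ d : Dir, p + d.vec ∉ V := fun p hp d hd => by
    have := h _ hd d.opp
    rw [Dir.vec_opp, add_neg_cancel_right] at this
    exact this hp
  have f6 : ∀ q : ℤ × ℤ, q + (1, 0) + (0, 1) = q + (1, 1) := fun q => by
    simp [add_assoc]
  ext p
  simp only [mem_plaquettes, Finset.mem_union]
  constructor
  · rintro ⟨h1, h2, h3, h4⟩
    rw [← f6] at h4 ⊢
    rcases h1 with h1 | h1
    · have h2' := h2.resolve_right (h p h1 .east)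
      have h3' := h3.resolve_right (h p h1 .north)
      have h4' := h4.resolve_right (h _ h2' .north)
      exact Or.inl ⟨h1, h2', h3', h4'⟩
    · have h2' := h2.resolve_left (h' p h1 .east)
      have h3' := h3.resolve_left (h' p h1 .north)
      have h4' := h4.resolve_left (h' _ h2' .north)
      exact Or.inr ⟨h1, h2', h3', h4'⟩
  · tauto

lemma disjoint_plaquettes (h : Disjoint V V') : Disjoint (plaquettes V) (plaquettes V') := by
  rw [Finset.disjoint_left] at h ⊢
  exact fun p h1 h2 => h (mem_plaquettes.1 h1).1 (mem_plaquettes.1 h2).1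

lemma disjoint_intEdges (h : Disjoint V V') : Disjoint (intEdges V) (intEdges V') := by
  rw [Finset.disjoint_left] at h ⊢
  exact fun p h1 h2 => h (mem_intEdges.1 h1).1 (mem_intEdges.1 h2).1

lemma numPlaquettes_union (hd : Disjoint V V') (h : ∀ p ∈ V, ∀ d : Dir, p + d.vec ∉ V') :
    numPlaquettes (V ∪ V') = numPlaquettes V + numPlaquettes V' := by
  rw [← card_plaquettes, plaquettes_union h, Finset.card_union_of_disjoint (disjoint_plaquettes hd)]
  rfl

lemma eulerChar_union (hd : Disjoint V V') (h : ∀ p ∈ V, ∀ d : Dir, p + d.vec ∉ V') :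
    eulerChar (V ∪ V') = eulerChar V + eulerChar V' := by
  rw [eulerChar, numPlaquettes_union hd h, intEdges_union h,
    Finset.card_union_of_disjoint (disjoint_intEdges hd), Finset.card_union_of_disjoint hd,
    eulerChar, eulerChar]
  push_cast
  ring

end Disjoint

/-- The edges that join an extremal vertex to a patch. -/
def linkEdges (V : Finset (ℤ × ℤ)) (v : ℤ × ℤ) : Finset HalfEdge :=
  (if nbr v .west ∈ V then {(nbr v .west, .east)} else ∅) ∪
    (if nbr v .south ∈ V then {(nbr v .south, .north)} else ∅)

lemma mem_linkEdges {h : HalfEdge} : h ∈ linkEdges V v ↔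
    (nbr v .west ∈ V ∧ h = (nbr v .west, .east)) ∨
      (nbr v .south ∈ V ∧ h = (nbr v .south, .north)) := by
  rw [linkEdges, Finset.mem_union]
  split_ifs <;> simp_all

lemma intEdges_insert (hE : nbr v .east ∉ V) (hN : nbr v .north ∉ V) :
    intEdges (insert v V) = linkEdges V v ∪ intEdges V := by
  ext h
  rw [mem_intEdges_insert hE hN, Finset.mem_union, mem_linkEdges, or_assoc]

lemma disjoint_linkEdges (hv : v ∉ V) : Disjoint (linkEdges V v) (intEdges V) := by
  rw [Finset.disjoint_left]
  intro h h1 h2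
  have h3 := (mem_intEdges.1 h2).2.2
  rcases mem_linkEdges.1 h1 with ⟨-, rfl⟩ | ⟨-, rfl⟩
  · exact hv (nbr_opp v .west ▸ h3)
  · exact hv (nbr_opp v .south ▸ h3)

/-- Whether the plaquette below and left of an extremal vertex is in the patch. -/
lemma numPlaquettes_insert (hE : nbr v .east ∉ V) (hN : nbr v .north ∉ V) (hv : v ∉ V) :
    numPlaquettes (insert v V) = numPlaquettes V +
      if v + (-1, -1) ∈ V ∧ nbr v .west ∈ V ∧ nbr v .south ∈ V then 1 else 0 := by
  rw [← card_plaquettes, ← card_plaquettes]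
  split_ifs with h
  · have : plaquettes (insert v V) = insert (v + (-1, -1)) (plaquettes V) := by
      ext p
      rw [mem_plaquettes_insert hE hN, Finset.mem_insert]
      tauto
    rw [this, Finset.card_insert_of_notMem]
    intro h'
    have := (mem_plaquettes.1 h').2.2.2
    have h0 : v + (-1, -1) + (1, 1) = v := by simp [Prod.ext_iff]
    exact hv (h0 ▸ this)
  · congr 1
    ext p
    rw [mem_plaquettes_insert hE hN]
    tauto

lemma eulerChar_insert (hE : nbr v .east ∉ V) (hN : nbr v .north ∉ V) (hv : v ∉ V) :
    eulerChar (insert v V) = eulerChar V + 1 - (linkEdges V v).card +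
      if v + (-1, -1) ∈ V ∧ nbr v .west ∈ V ∧ nbr v .south ∈ V then 1 else 0 := by
  rw [eulerChar, intEdges_insert hE hN, Finset.card_union_of_disjoint (disjoint_linkEdges hv),
    numPlaquettes_insert hE hN hv, Finset.card_insert_of_notMem hv, eulerChar]
  push_cast
  ring

end Extremal

/-! ### Outlines of connected patches -/

section Attach

variable {ι : Type w} [Fintype ι] {T : List (ι × Bool) → ℕ → ℕ}

variable (T) in
/-- The external edges of a patch form one cycle, and its state sum is the value of the cyclic word
of their labels. -/
def HasOutline (V : Finset (ℤ × ℤ)) : Prop :=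
  ∃ l R, IsOutline V l R ∧
    ∀ x, stateSum T V x = T ((l :: R).map (letter x)) (numPlaquettes V)

lemma HasOutline.exists_rotate (hT : IsWordSum T) {V : Finset (ℤ × ℤ)} (h : HasOutline T V)
    {l : HalfEdge} (hl : l.1 ∈ V) (hl' : l.far ∉ V) : ∃ R, IsOutline V l R ∧
      ∀ x, stateSum T V x = T ((l :: R).map (letter x)) (numPlaquettes V) := by
  obtain ⟨l₀, R₀, h1, h2⟩ := h
  obtain ⟨R, A, B, h3, h4, h5⟩ := h1.rotate hl hl'
  refine ⟨R, h3, fun x => ?_⟩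
  rw [h2, h4, h5, List.map_append, List.map_append, hT.swap]

lemma edge_east (v : ℤ × ℤ) : HalfEdge.edge (v, .east) = (v, .east) := rfl
lemma edge_north (v : ℤ × ℤ) : HalfEdge.edge (v, .north) = (v, .north) := rfl
lemma edge_west (v : ℤ × ℤ) : HalfEdge.edge (v, .west) = (nbr v .west, .east) := rfl
lemma edge_south (v : ℤ × ℤ) : HalfEdge.edge (v, .south) = (nbr v .south, .north) := rfl

lemma map_letter_update {R : List HalfEdge} {e : HalfEdge} (h : ∀ k ∈ R, k.edge ≠ e)
    (x : HalfEdge → ι) (j : ι) : R.map (letter (Function.update x e j)) = R.map (letter x) :=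
  List.map_congr_left fun k hk => letter_congr (Function.update_of_ne (h k hk) _ _)

lemma letter_update_self (x : HalfEdge → ι) {h : HalfEdge} (ho : h.2.IsOutgoing) (j : ι) :
    letter (Function.update x h j) h = (j, true) := by
  simp [letter, HalfEdge.edge, ho]

lemma letter_update_ne (x : HalfEdge → ι) {h e : HalfEdge} (j : ι) (he : h.edge ≠ e) :
    letter (Function.update x e j) h = letter x h :=
  letter_congr (Function.update_of_ne he _ _)

lemma letter_west_update (x : HalfEdge → ι) (v : ℤ × ℤ) (j : ι) :
    letter (Function.update x (nbr v .west, .east) j) (v, .west) = (j, false) := by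
  simp [letter, edge_west, Dir.IsOutgoing]

lemma letter_south_update (x : HalfEdge → ι) (v : ℤ × ℤ) (j : ι) :
    letter (Function.update x (nbr v .south, .north) j) (v, .south) = (j, false) := by
  simp [letter, edge_south, Dir.IsOutgoing]

lemma vertexWeight_update_west (x : HalfEdge → ι) (v : ℤ × ℤ) (j : ι) :
    vertexWeight T v (Function.update x (nbr v .west, .east) j) =
      T [letter x (v, .east), letter x (v, .north), (j, false), letter x (v, .south)] 0 := by
  rw [vertexWeight, letter_west_update, letter_update_ne (h := (v, .east)),
    letter_update_ne (h := (v, .north)), letter_update_ne (h := (v, .south))]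
  · simp [edge_south]
  · simp [edge_north]
  · simp [edge_east, (nbr_ne v .west).symm]

lemma vertexWeight_update_south (x : HalfEdge → ι) (v : ℤ × ℤ) (j : ι) :
    vertexWeight T v (Function.update x (nbr v .south, .north) j) =
      T [letter x (v, .east), letter x (v, .north), letter x (v, .west), (j, false)] 0 := by
  rw [vertexWeight, letter_south_update, letter_update_ne (h := (v, .east)),
    letter_update_ne (h := (v, .north)), letter_update_ne (h := (v, .west))]
  · simp [edge_west]
  · simp [edge_north, (nbr_ne v .south).symm]
  · simp [edge_east]

lemma vertexWeight_update_update (x : HalfEdge → ι) (v : ℤ × ℤ) (k j : ι) :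
    vertexWeight T v (Function.update (Function.update x (nbr v .west, .east) k)
        (nbr v .south, .north) j) =
      T [letter x (v, .east), letter x (v, .north), (k, false), (j, false)] 0 := by
  rw [vertexWeight_update_south, letter_west_update, letter_update_ne (h := (v, .east)),
    letter_update_ne (h := (v, .north))]
  · simp [edge_north]
  · simp [edge_east, (nbr_ne v .west).symm]

variable {V : Finset (ℤ × ℤ)} {v : ℤ × ℤ}

/-- An external edge of `V` becomes internal only if it ends at `v`; it then starts at a neighbour
of `v`, and the absent east and north neighbours leave two candidates. -/
lemma leg_insert_iff (hE : nbr v .east ∉ V) (hN : nbr v .north ∉ V) (hv : v ∉ V) (h : HalfEdge) :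
    h.1 ∈ insert v V ∧ h.far ∉ insert v V ↔ h = (v, .east) ∨ h = (v, .north) ∨
      (h = (v, .west) ∧ nbr v .west ∉ V) ∨ (h = (v, .south) ∧ nbr v .south ∉ V) ∨
      ((h.1 ∈ V ∧ h.far ∉ V) ∧ h ≠ (nbr v .west, .east) ∧ h ≠ (nbr v .south, .north)) := by
  have key : ∀ d : Dir, nbr v d ∉ V → nbr v d ∉ insert v V := fun d hd => by
    rw [Finset.mem_insert, not_or]
    exact ⟨nbr_ne v d, hd⟩
  constructor
  · rintro ⟨h1, h2⟩
    rw [Finset.mem_insert, not_or] at h2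
    obtain ⟨p, d⟩ := h
    rcases Finset.mem_insert.1 h1 with h1 | h1
    · dsimp only at h1
      subst h1
      cases d
      · simp
      · simp
      · exact Or.inr (Or.inr (Or.inl ⟨rfl, h2.2⟩))
      · exact Or.inr (Or.inr (Or.inr (Or.inl ⟨rfl, h2.2⟩)))
    · refine Or.inr (Or.inr (Or.inr (Or.inr ⟨⟨h1, h2.2⟩, ?_, ?_⟩)))
      · rintro h3
        obtain ⟨rfl, rfl⟩ := Prod.mk.inj h3
        exact h2.1 (nbr_opp v .west)
      · rintro h3
        obtain ⟨rfl, rfl⟩ := Prod.mk.inj h3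
        exact h2.1 (nbr_opp v .south)
  · rintro (rfl | rfl | ⟨rfl, h1⟩ | ⟨rfl, h1⟩ | ⟨⟨h1, h2⟩, h3, h4⟩)
    · exact ⟨Finset.mem_insert_self _ _, key _ hE⟩
    · exact ⟨Finset.mem_insert_self _ _, key _ hN⟩
    · exact ⟨Finset.mem_insert_self _ _, key _ h1⟩
    · exact ⟨Finset.mem_insert_self _ _, key _ h1⟩
    · refine ⟨Finset.mem_insert_of_mem h1, ?_⟩
      rw [Finset.mem_insert, not_or]
      refine ⟨fun h5 => ?_, h2⟩
      obtain ⟨p, d⟩ := h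
      have h6 : p = nbr v d.opp := nbr_eq_iff.1 h5
      cases d
      · exact h3 (by rw [h6]; rfl)
      · exact h4 (by rw [h6]; rfl)
      · exact hE (by rw [h6] at h1; exact h1)
      · exact hN (by rw [h6] at h1; exact h1)

/-- The external edges of a patch other than the two that point to an extremal vertex lie on other
edges than the links to it. -/
lemma edge_ne_link {h : HalfEdge} (hv : v ∉ V) (h1 : h.1 ∈ V) :
    (h ≠ (nbr v .west, .east) → h.edge ≠ (nbr v .west, .east)) ∧
      (h ≠ (nbr v .south, .north) → h.edge ≠ (nbr v .south, .north)) := by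
  constructor
  · intro h2 h3
    rw [← edge_west, HalfEdge.edge_eq_iff] at h3
    rcases h3 with rfl | rfl
    · exact hv h1
    · exact h2 rfl
  · intro h2 h3
    rw [← edge_south, HalfEdge.edge_eq_iff] at h3
    rcases h3 with rfl | rfl
    · exact hv h1
    · exact h2 rfl

lemma hasOutline_singleton (v : ℤ × ℤ) : HasOutline T {v} := by
  have hf : ∀ d : Dir, HalfEdge.far (v, d) ∉ ({v} : Finset (ℤ × ℤ)) := fun d => by
    rw [Finset.mem_singleton]
    exact nbr_ne v d
  have hp : numPlaquettes {v} = 0 := by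
    rw [← card_plaquettes, Finset.card_eq_zero, Finset.eq_empty_iff_forall_notMem]
    intro p hp
    obtain ⟨h1, h2, -⟩ := mem_plaquettes.1 hp
    rw [Finset.mem_singleton] at h1 h2
    subst h1
    exact nbr_ne p .east h2
  refine ⟨(v, .east), [(v, .north), (v, .west), (v, .south)], ⟨?_, ?_, ?_⟩, fun x => ?_⟩
  · exact .leg (hf _) (.leg (hf _) (.leg (hf _) (.nil _)))
  · simp
  · rintro ⟨p, d⟩
    constructor
    · intro h
      have hp : p = v := by
        simp only [List.mem_cons, Prod.mk.injEq, List.not_mem_nil, or_false] at h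
        tauto
      subst hp
      exact ⟨Finset.mem_singleton_self _, hf _⟩
    · rintro ⟨h1, -⟩
      rw [Finset.mem_singleton] at h1
      dsimp only at h1
      subst h1
      cases d <;> simp
  · rw [stateSum_singleton, hp]
    rfl

/-- Attaching a vertex by one edge to its left. -/
lemma HasOutline.attach_west (hT : IsWordSum T) (hE : nbr v .east ∉ V) (hN : nbr v .north ∉ V)
    (hv : v ∉ V) (hW : nbr v .west ∈ V) (hS : nbr v .south ∉ V) (h : HasOutline T V) :
    HasOutline T (insert v V) := by
  have hfar : HalfEdge.far (nbr v .west, .east) = v := nbr_opp v .west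
  obtain ⟨R, ho, hsum⟩ := h.exists_rotate hT (l := (nbr v .west, .east)) hW (by rwa [hfar])
  have hnd := List.nodup_cons.1 ho.nodup
  have hR : ∀ k ∈ R, k.1 ∈ V := fun k hk => ((ho.mem_iff k).1 (by simp [hk])).1
  have hne : ∀ k ∈ R, k ≠ (nbr v .west, .east) := fun k hk he => hnd.1 (he ▸ hk)
  have hmem : ∀ h : HalfEdge, h ∈ (v, .north) :: (R ++ [(v, .south), (v, .east)]) ↔
      h.1 ∈ insert v V ∧ h.far ∉ insert v V := by
    intro h
    rw [leg_insert_iff hE hN hv, ← ho.mem_iff]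
    simp only [List.mem_cons, List.mem_append, List.not_mem_nil, or_false]
    have h1 := hne h
    have h2 : h ∈ R → h ≠ (nbr v .south, .north) := by
      rintro hh rfl
      exact hS (hR _ hh)
    tauto
  refine ⟨(v, .north), R ++ [(v, .south), (v, .east)], ⟨?_, ?_, hmem⟩, fun x => ?_⟩
  -- From the north leg of `v` the walk crosses the west edge, runs along the old outline until it
  -- meets that edge again, returns to `v`, and emits the south and east legs.
  · refine .edge (Finset.mem_insert_of_mem hW) ?_
    refine (ho.walk.mono (Finset.subset_insert v V)
      fun l hl => ((hmem l).1 (by simp [hl])).2).append ?_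
    refine .edge (hfar.symm ▸ Finset.mem_insert_self v V) ?_
    rw [hfar]
    exact .leg ((hmem (v, .south)).1 (by simp)).2 (.leg ((hmem (v, .east)).1 (by simp)).2 (.nil _))
  · have h1 : ∀ d, (v, d) ∉ R := fun d hd => hv (hR _ hd)
    simp only [List.nodup_cons, List.nodup_append, List.mem_cons, List.mem_append]
    grind
  · have hl : linkEdges V v = {(nbr v .west, .east)} := by
      simp [linkEdges, hW, hS]
    rw [stateSum_insert hv (intEdges_insert hE hN) (disjoint_linkEdges hv), hl,
      marginal_singleton, numPlaquettes_insert hE hN hv]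
    simp only [hS, and_false, if_false, add_zero]
    have key : ∀ j, vertexWeight T v (Function.update x (nbr v .west, .east) j) *
        stateSum T V (Function.update x (nbr v .west, .east) j) =
        T ([letter x (v, .south), letter x (v, .east), letter x (v, .north)] ++ [(j, false)]) 0 *
          T ((j, !false) :: R.map (letter x)) (numPlaquettes V) := by
      intro j
      rw [hsum, List.map_cons, map_letter_update fun k hk => (edge_ne_link hv (hR k hk)).1 (hne k hk),
        vertexWeight_update_west, letter_update_self _ (Or.inl rfl)]
      congr 1
      -- The vertex word is rotated to put the glued letter last, as the gluing rule requires.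
      exact hT.swap [_, _, _] [_] 0
    simp_rw [key]
    rw [hT.glue, hT.swap, Nat.zero_add]
    have := hT.swap (R.map (letter x) ++ [letter x (v, .south), letter x (v, .east)])
      [letter x (v, .north)] (numPlaquettes V)
    simpa using this

/-- Attaching a vertex by one edge below it. -/
lemma HasOutline.attach_south (hT : IsWordSum T) (hE : nbr v .east ∉ V) (hN : nbr v .north ∉ V)
    (hv : v ∉ V) (hW : nbr v .west ∉ V) (hS : nbr v .south ∈ V) (h : HasOutline T V) :
    HasOutline T (insert v V) := by
  have hfar : HalfEdge.far (nbr v .south, .north) = v := nbr_opp v .south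
  obtain ⟨R, ho, hsum⟩ := h.exists_rotate hT (l := (nbr v .south, .north)) hS (by rwa [hfar])
  have hnd := List.nodup_cons.1 ho.nodup
  have hR : ∀ k ∈ R, k.1 ∈ V := fun k hk => ((ho.mem_iff k).1 (by simp [hk])).1
  have hne : ∀ k ∈ R, k ≠ (nbr v .south, .north) := fun k hk he => hnd.1 (he ▸ hk)
  have hmem : ∀ h : HalfEdge, h ∈ (v, .west) :: (R ++ [(v, .east), (v, .north)]) ↔
      h.1 ∈ insert v V ∧ h.far ∉ insert v V := by
    intro h
    rw [leg_insert_iff hE hN hv, ← ho.mem_iff]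
    simp only [List.mem_cons, List.mem_append, List.not_mem_nil, or_false]
    have h1 := hne h
    have h2 : h ∈ R → h ≠ (nbr v .west, .east) := by
      rintro hh rfl
      exact hW (hR _ hh)
    tauto
  refine ⟨(v, .west), R ++ [(v, .east), (v, .north)], ⟨?_, ?_, hmem⟩, fun x => ?_⟩
  · refine .edge (Finset.mem_insert_of_mem hS) ?_
    refine (ho.walk.mono (Finset.subset_insert v V)
      fun l hl => ((hmem l).1 (by simp [hl])).2).append ?_
    refine .edge (hfar.symm ▸ Finset.mem_insert_self v V) ?_
    rw [hfar]
    exact .leg ((hmem (v, .east)).1 (by simp)).2 (.leg ((hmem (v, .north)).1 (by simp)).2 (.nil _))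
  · have h1 : ∀ d, (v, d) ∉ R := fun d hd => hv (hR _ hd)
    simp only [List.nodup_cons, List.nodup_append, List.mem_cons, List.mem_append]
    grind
  · have hl : linkEdges V v = {(nbr v .south, .north)} := by
      simp [linkEdges, hW, hS]
    rw [stateSum_insert hv (intEdges_insert hE hN) (disjoint_linkEdges hv), hl,
      marginal_singleton, numPlaquettes_insert hE hN hv]
    simp only [hW, and_false, false_and, if_false, add_zero]
    have key : ∀ j, vertexWeight T v (Function.update x (nbr v .south, .north) j) *
        stateSum T V (Function.update x (nbr v .south, .north) j) =
        T ([letter x (v, .east), letter x (v, .north), letter x (v, .west)] ++ [(j, false)]) 0 *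
          T ((j, !false) :: R.map (letter x)) (numPlaquettes V) := by
      intro j
      rw [hsum, List.map_cons, map_letter_update fun k hk => (edge_ne_link hv (hR k hk)).2 (hne k hk),
        vertexWeight_update_south, letter_update_self _ (Or.inr rfl)]
      rfl
    simp_rw [key]
    rw [hT.glue, Nat.zero_add]
    have := hT.swap (letter x (v, .west) :: R.map (letter x))
      [letter x (v, .east), letter x (v, .north)] (numPlaquettes V)
    simpa using this.symm

/-- Attaching a vertex that completes a plaquette. -/
lemma HasOutline.attach_plaquette (hT : IsWordSum T) (hE : nbr v .east ∉ V)
    (hN : nbr v .north ∉ V) (hv : v ∉ V) (hW : nbr v .west ∈ V) (hS : nbr v .south ∈ V)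
    (hSW : v + (-1, -1) ∈ V) (h : HasOutline T V) : HasOutline T (insert v V) := by
  have hfarS : HalfEdge.far (nbr v .south, .north) = v := nbr_opp v .south
  have hfarW : HalfEdge.far (nbr v .west, .east) = v := nbr_opp v .west
  obtain ⟨R, ho, hsum⟩ := h.exists_rotate hT (l := (nbr v .south, .north)) hS (by rwa [hfarS])
  have f1 : HalfEdge.far (nbr v .south, .west) = v + (-1, -1) := by
    simp [HalfEdge.far, nbr, Dir.vec, add_assoc]
  have f2 : HalfEdge.far (v + (-1, -1), .north) = nbr v .west := by
    simp [HalfEdge.far, nbr, Dir.vec, add_assoc]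
  -- Turning from the leg at the south neighbour, the walk crosses to the lower left corner and up
  -- to the west neighbour without emitting anything. Hence the two legs pointing at `v` are
  -- consecutive in the outline.
  obtain ⟨R, rfl, hwalk⟩ : ∃ R', R = (nbr v .west, .east) :: R' ∧
      OutlineWalk V (nbr v .west, .north) R' (nbr v .south, .north) := by
    rcases ho.walk.inv with ⟨h1, -⟩ | ⟨h1, -⟩ | ⟨-, h1⟩
    · have := congrArg Prod.snd h1
      simp [Dir.next] at this
    · exact absurd (f1.symm ▸ hSW) h1
    change OutlineWalk V (HalfEdge.far (nbr v .south, .west), .north) R _ at h1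
    rw [f1] at h1
    rcases h1.inv with ⟨h2, -⟩ | ⟨h2, -⟩ | ⟨-, h2⟩
    · have := congrArg Prod.fst h2
      simp [nbr, Dir.vec] at this
    · exact absurd (f2.symm ▸ hW) h2
    change OutlineWalk V (HalfEdge.far (v + (-1, -1), .north), .east) R _ at h2
    rw [f2] at h2
    rcases h2.inv with ⟨h3, -⟩ | ⟨-, h3⟩ | ⟨h3, -⟩
    · have := congrArg Prod.snd h3
      simp at this
    · exact h3
    · exact absurd h3 (hfarW.symm ▸ hv)
  have hnd1 := List.nodup_cons.1 ho.nodup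
  have hnd := List.nodup_cons.1 hnd1.2
  have hR : ∀ k ∈ R, k.1 ∈ V := fun k hk => ((ho.mem_iff k).1 (by simp [hk])).1
  have hneW : ∀ k ∈ R, k ≠ (nbr v .west, .east) := fun k hk he => hnd.1 (he ▸ hk)
  have hneS : ∀ k ∈ R, k ≠ (nbr v .south, .north) := fun k hk he => hnd1.1 (he ▸ by simp [hk])
  have hmem : ∀ h : HalfEdge, h ∈ (v, .north) :: (R ++ [(v, .east)]) ↔
      h.1 ∈ insert v V ∧ h.far ∉ insert v V := by
    intro h
    rw [leg_insert_iff hE hN hv, ← ho.mem_iff]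
    simp only [List.mem_cons, List.mem_append, List.not_mem_nil, or_false]
    have h1 := hneW h
    have h2 := hneS h
    tauto
  refine ⟨(v, .north), R ++ [(v, .east)], ⟨?_, ?_, hmem⟩, fun x => ?_⟩
  · refine .edge (Finset.mem_insert_of_mem hW) ?_
    refine (hwalk.mono (Finset.subset_insert v V)
      fun l hl => ((hmem l).1 (by simp [hl])).2).append ?_
    refine .edge (hfarS.symm ▸ Finset.mem_insert_self v V) ?_
    rw [hfarS]
    exact .leg ((hmem (v, .east)).1 (by simp)).2 (.nil _)
  · have h1 : ∀ d, (v, d) ∉ R := fun d hd => hv (hR _ hd)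
    simp only [List.nodup_cons, List.nodup_append, List.mem_cons, List.mem_append]
    grind
  · have hl : linkEdges V v = {(nbr v .west, .east)} ∪ {(nbr v .south, .north)} := by
      simp [linkEdges, hW, hS]
    rw [stateSum_insert hv (intEdges_insert hE hN) (disjoint_linkEdges hv), hl,
      marginal_union (by simp), marginal_singleton, numPlaquettes_insert hE hN hv,
      if_pos ⟨hSW, hW, hS⟩]
    simp_rw [marginal_singleton]
    have key : ∀ k j, vertexWeight T v (Function.update (Function.update x (nbr v .west, .east) k)
          (nbr v .south, .north) j) *
        stateSum T V (Function.update (Function.update x (nbr v .west, .east) k)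
          (nbr v .south, .north) j) =
        T ([letter x (v, .east), letter x (v, .north), (k, false)] ++ [(j, false)]) 0 *
          T ((j, !false) :: (k, true) :: R.map (letter x)) (numPlaquettes V) := by
      intro k j
      rw [hsum, List.map_cons, List.map_cons,
        map_letter_update fun k hk => (edge_ne_link hv (hR k hk)).2 (hneS k hk),
        map_letter_update fun k hk => (edge_ne_link hv (hR k hk)).1 (hneW k hk),
        vertexWeight_update_update, letter_update_self _ (Or.inr rfl),
        letter_update_ne (h := (nbr v .west, .east)), letter_update_self _ (Or.inl rfl)]
      · rfl
      · simp [edge_east]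
    -- Gluing the south edge brings the two letters of the west edge next to each other, and the
    -- pair rule then produces the factor of the new plaquette.
    simp_rw [key, hT.glue]
    have key2 : ∀ k, T ([letter x (v, .east), letter x (v, .north), (k, false)] ++
        (k, true) :: R.map (letter x)) (0 + numPlaquettes V) =
        T ((k, false) :: (k, true) :: (R.map (letter x) ++
          [letter x (v, .east), letter x (v, .north)])) (numPlaquettes V) := by
      intro k
      rw [Nat.zero_add]
      have := hT.swap [letter x (v, .east), letter x (v, .north)]
        ((k, false) :: (k, true) :: R.map (letter x)) (numPlaquettes V)
      simpa using this
    simp_rw [key2, hT.pair]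
    have := hT.swap (R.map (letter x) ++ [letter x (v, .east)]) [letter x (v, .north)]
      (numPlaquettes V + 1)
    simpa using this

/-- Attaching a vertex that joins two components. -/
lemma HasOutline.attach_union (hT : IsWordSum T) {V₁ V₂ : Finset (ℤ × ℤ)}
    (hd : Disjoint V₁ V₂) (hadj : ∀ p ∈ V₁, ∀ d : Dir, p + d.vec ∉ V₂)
    (hE : nbr v .east ∉ V₁ ∪ V₂) (hN : nbr v .north ∉ V₁ ∪ V₂)
    (hv : v ∉ V₁ ∪ V₂) (hW : nbr v .west ∈ V₁) (hS : nbr v .south ∈ V₂)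
    (hSW : v + (-1, -1) ∉ V₁ ∪ V₂) (h₁ : HasOutline T V₁) (h₂ : HasOutline T V₂) :
    HasOutline T (insert v (V₁ ∪ V₂)) := by
  have hfarS : HalfEdge.far (nbr v .south, .north) = v := nbr_opp v .south
  have hfarW : HalfEdge.far (nbr v .west, .east) = v := nbr_opp v .west
  have hv1 : v ∉ V₁ := fun h => hv (Finset.mem_union_left _ h)
  have hv2 : v ∉ V₂ := fun h => hv (Finset.mem_union_right _ h)
  have hdisj := Finset.disjoint_left.1 hd
  obtain ⟨R₁, ho₁, hsum₁⟩ := h₁.exists_rotate hT (l := (nbr v .west, .east)) hW (by rwa [hfarW])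
  obtain ⟨R₂, ho₂, hsum₂⟩ := h₂.exists_rotate hT (l := (nbr v .south, .north)) hS (by rwa [hfarS])
  have hnd₁ := List.nodup_cons.1 ho₁.nodup
  have hnd₂ := List.nodup_cons.1 ho₂.nodup
  have hR₁ : ∀ k ∈ R₁, k.1 ∈ V₁ := fun k hk => ((ho₁.mem_iff k).1 (by simp [hk])).1
  have hR₂ : ∀ k ∈ R₂, k.1 ∈ V₂ := fun k hk => ((ho₂.mem_iff k).1 (by simp [hk])).1
  have hne₁ : ∀ k ∈ R₁, k ≠ (nbr v .west, .east) := fun k hk he => hnd₁.1 (he ▸ hk)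
  have hne₂ : ∀ k ∈ R₂, k ≠ (nbr v .south, .north) := fun k hk he => hnd₂.1 (he ▸ hk)
  have hne₁' : ∀ k ∈ R₁, k ≠ (nbr v .south, .north) := by
    rintro k hk rfl
    exact hdisj (hR₁ _ hk) hS
  have hne₂' : ∀ k ∈ R₂, k ≠ (nbr v .west, .east) := by
    rintro k hk rfl
    exact hdisj hW (hR₂ _ hk)
  have hadj' : ∀ p ∈ V₂, ∀ d : Dir, p + d.vec ∉ V₁ := fun p hp d hd => by
    have := hadj _ hd d.opp
    rw [Dir.vec_opp, add_neg_cancel_right] at this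
    exact this hp
  have hmem : ∀ h : HalfEdge, h ∈ (v, .north) :: (R₁ ++ (R₂ ++ [(v, .east)])) ↔
      h.1 ∈ insert v (V₁ ∪ V₂) ∧ h.far ∉ insert v (V₁ ∪ V₂) := by
    intro h
    have h0 : (h.1 ∈ V₁ ∪ V₂ ∧ h.far ∉ V₁ ∪ V₂) ↔
        (h ∈ (nbr v .west, .east) :: R₁ ∨ h ∈ (nbr v .south, .north) :: R₂) := by
      rw [ho₁.mem_iff, ho₂.mem_iff, Finset.mem_union, Finset.mem_union]
      have := hadj h.1
      have := hadj' h.1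
      unfold HalfEdge.far
      constructor
      · rintro ⟨h1 | h1, h2⟩
        · exact Or.inl ⟨h1, fun h3 => h2 (Or.inl h3)⟩
        · exact Or.inr ⟨h1, fun h3 => h2 (Or.inr h3)⟩
      · rintro (⟨h1, h2⟩ | ⟨h1, h2⟩)
        · exact ⟨Or.inl h1, fun h3 => h3.elim h2 (hadj h.1 h1 h.2)⟩
        · exact ⟨Or.inr h1, fun h3 => h3.elim (hadj' h.1 h1 h.2) h2⟩
    rw [leg_insert_iff hE hN hv, h0]
    simp only [List.mem_cons, List.mem_append, List.not_mem_nil, or_false, Finset.mem_union]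
    constructor
    · rintro (h1 | h1 | h1 | h1)
      · exact Or.inr (Or.inl h1)
      · exact Or.inr (Or.inr (Or.inr (Or.inr
          ⟨Or.inl (Or.inr h1), hne₁ h h1, hne₁' h h1⟩)))
      · exact Or.inr (Or.inr (Or.inr (Or.inr
          ⟨Or.inr (Or.inr h1), hne₂' h h1, hne₂ h h1⟩)))
      · exact Or.inl h1
    · rintro (h1 | h1 | ⟨-, h1⟩ | ⟨-, h1⟩ | ⟨(h1 | h1) | (h1 | h1), h2, h3⟩)
      · exact Or.inr (Or.inr (Or.inr h1))
      · exact Or.inl h1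
      · exact absurd (Or.inl hW) h1
      · exact absurd (Or.inr hS) h1
      · exact absurd h1 h2
      · exact Or.inr (Or.inl h1)
      · exact absurd h1 h3
      · exact Or.inr (Or.inr (Or.inl h1))
  refine ⟨(v, .north), R₁ ++ (R₂ ++ [(v, .east)]), ⟨?_, ?_, hmem⟩, fun x => ?_⟩
  -- The walk makes two excursions from `v`, around `V₁` through the west edge and around `V₂`
  -- through the south edge, so the two cycles merge into one.
  · refine .edge (Finset.mem_insert_of_mem (Finset.mem_union_left _ hW)) ?_
    refine (ho₁.walk.mono (Finset.subset_union_left.trans (Finset.subset_insert v _))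
      fun l hl => ((hmem l).1 (by simp [hl])).2).append ?_
    refine .edge (hfarW.symm ▸ Finset.mem_insert_self v _) ?_
    rw [hfarW]
    refine .edge (Finset.mem_insert_of_mem (Finset.mem_union_right _ hS)) ?_
    refine (ho₂.walk.mono (Finset.subset_union_right.trans (Finset.subset_insert v _))
      fun l hl => ((hmem l).1 (by simp [hl])).2).append ?_
    refine .edge (hfarS.symm ▸ Finset.mem_insert_self v _) ?_
    rw [hfarS]
    exact .leg ((hmem (v, .east)).1 (by simp)).2 (.nil _)
  · have h1 : ∀ d, (v, d) ∉ R₁ := fun d hd => hv1 (hR₁ _ hd)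
    have h2 : ∀ d, (v, d) ∉ R₂ := fun d hd => hv2 (hR₂ _ hd)
    have h3 : ∀ k ∈ R₁, k ∉ R₂ := fun k hk hk' => hdisj (hR₁ k hk) (hR₂ k hk')
    rw [List.nodup_cons, List.nodup_append, List.nodup_append]
    refine ⟨by simp [h1, h2], hnd₁.2, ⟨hnd₂.2, by simp, ?_⟩, ?_⟩
    · rintro a ha b hb rfl
      rw [List.mem_singleton] at hb
      exact h2 _ (hb ▸ ha)
    · rintro a ha b hb rfl
      rcases List.mem_append.1 hb with hb | hb
      · exact h3 _ ha hb
      · rw [List.mem_singleton] at hb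
        exact h1 _ (hb ▸ ha)
  · have hl : linkEdges (V₁ ∪ V₂) v = {(nbr v .west, .east)} ∪ {(nbr v .south, .north)} := by
      simp [linkEdges, hW, hS]
    rw [stateSum_insert hv (intEdges_insert hE hN) (disjoint_linkEdges hv), hl,
      marginal_union (by simp), marginal_singleton, numPlaquettes_insert hE hN hv,
      if_neg (fun h => hSW h.1), numPlaquettes_union hd hadj, add_zero]
    simp_rw [marginal_singleton, stateSum_union hd (intEdges_union hadj)]
    have key : ∀ k j, vertexWeight T v (Function.update (Function.update x (nbr v .west, .east) k)
          (nbr v .south, .north) j) *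
        (stateSum T V₁ (Function.update (Function.update x (nbr v .west, .east) k)
            (nbr v .south, .north) j) *
          stateSum T V₂ (Function.update (Function.update x (nbr v .west, .east) k)
            (nbr v .south, .north) j)) =
        (T ([letter x (v, .east), letter x (v, .north), (k, false)] ++ [(j, false)]) 0 *
          T ((j, !false) :: R₂.map (letter x)) (numPlaquettes V₂)) *
          T ((k, !false) :: R₁.map (letter x)) (numPlaquettes V₁) := by
      intro k j
      rw [hsum₁, hsum₂, List.map_cons, List.map_cons,
        map_letter_update fun k hk => (edge_ne_link hv1 (hR₁ k hk)).2 (hne₁' k hk),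
        map_letter_update fun k hk => (edge_ne_link hv1 (hR₁ k hk)).1 (hne₁ k hk),
        map_letter_update fun k hk => (edge_ne_link hv2 (hR₂ k hk)).2 (hne₂ k hk),
        map_letter_update fun k hk => (edge_ne_link hv2 (hR₂ k hk)).1 (hne₂' k hk),
        vertexWeight_update_update, letter_update_self _ (Or.inr rfl),
        letter_update_ne (h := (nbr v .west, .east)), letter_update_self _ (Or.inl rfl)]
      · simp only [List.cons_append, List.nil_append, Bool.not_false]
        ring
      · simp [edge_east]
    -- The sum over the south label glues `V₂` to the vertex; the weight of `V₁` involves only the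
    -- west label and is pulled out until the second gluing.
    simp_rw [key, ← Finset.sum_mul, hT.glue]
    have key2 : ∀ k, T ([letter x (v, .east), letter x (v, .north), (k, false)] ++
        R₂.map (letter x)) (0 + numPlaquettes V₂) =
        T ((R₂.map (letter x) ++ [letter x (v, .east), letter x (v, .north)]) ++ [(k, false)])
          (numPlaquettes V₂) := by
      intro k
      rw [Nat.zero_add, hT.swap]
      simp
    simp_rw [key2, hT.glue]
    rw [Nat.add_comm]
    have := hT.swap (R₂.map (letter x) ++ [letter x (v, .east)])
      (letter x (v, .north) :: R₁.map (letter x)) (numPlaquettes V₁ + numPlaquettes V₂)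
    simpa using this

end Attach

/-! ### The Euler characteristic of connected patches -/

section Connected

variable {ι : Type w} [Fintype ι] {T : List (ι × Bool) → ℕ → ℕ} {V : Finset (ℤ × ℤ)} {v : ℤ × ℤ}

/-- `A` is closed under adjacency in `V`. -/
def IsClosedIn (V A : Finset (ℤ × ℤ)) : Prop :=
  ∀ p ∈ A, ∀ d : Dir, p + d.vec ∈ V → p + d.vec ∈ A

lemma IsClosedIn.insert_of_not_nbr {A : Finset (ℤ × ℤ)} (hE : nbr v .east ∉ V)
    (hN : nbr v .north ∉ V) (hA : A ⊆ V) (h : IsClosedIn V A) (hW : nbr v .west ∉ A)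
    (hS : nbr v .south ∉ A) : IsClosedIn (insert v V) A := by
  intro p hp d hd
  rcases Finset.mem_insert.1 hd with h1 | h1
  · rw [nbr_eq_iff] at h1
    subst h1
    cases d
    · exact absurd hp hW
    · exact absurd hp hS
    · exact absurd (hA hp) hE
    · exact absurd (hA hp) hN
  · exact h p hp d h1

lemma IsClosedIn.insert_of_nbr {A : Finset (ℤ × ℤ)} (hE : nbr v .east ∉ V)
    (hN : nbr v .north ∉ V) (h : IsClosedIn V A) (hW : nbr v .west ∈ V → nbr v .west ∈ A)
    (hS : nbr v .south ∈ V → nbr v .south ∈ A) : IsClosedIn (insert v V) (insert v A) := by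
  intro p hp d hd
  rcases Finset.mem_insert.1 hd with h1 | h1
  · exact h1 ▸ Finset.mem_insert_self _ _
  · apply Finset.mem_insert_of_mem
    rcases Finset.mem_insert.1 hp with rfl | hp
    · cases d
      · exact absurd h1 hE
      · exact absurd h1 hN
      · exact hW h1
      · exact hS h1
    · exact h p hp d h1

/-- A set that is closed in the patch without an extremal vertex of a connected patch contains a
neighbour of that vertex. -/
lemma IsConn.nbr_mem (h : IsConn (insert v V)) (hE : nbr v .east ∉ V) (hN : nbr v .north ∉ V)
    (hv : v ∉ V) {A : Finset (ℤ × ℤ)} (hA : A ⊆ V) (hne : A.Nonempty) (hc : IsClosedIn V A) :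
    nbr v .west ∈ A ∨ nbr v .south ∈ A := by
  by_contra! hcon
  have := h.eq_of_closed A (hA.trans (Finset.subset_insert v V)) hne
    (hc.insert_of_not_nbr hE hN hA hcon.1 hcon.2)
  exact hv (hA (this ▸ Finset.mem_insert_self v V))

lemma IsConn.eq_of_nbr (h : IsConn (insert v V)) (hE : nbr v .east ∉ V) (hN : nbr v .north ∉ V)
    (hv : v ∉ V) {A : Finset (ℤ × ℤ)} (hA : A ⊆ V) (hc : IsClosedIn V A)
    (hW : nbr v .west ∈ V → nbr v .west ∈ A) (hS : nbr v .south ∈ V → nbr v .south ∈ A) :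
    A = V := by
  have := h.eq_of_closed (insert v A) (Finset.insert_subset_insert v hA)
    (Finset.insert_nonempty v A) (hc.insert_of_nbr hE hN hW hS)
  rw [← Finset.erase_insert hv, ← this, Finset.erase_insert fun hvA => hv (hA hvA)]

/-- A non-empty closed part `A'` of `A` must contain a neighbour of `v`, hence the only one that `A`
has. Then `A' ∪ B` is closed and contains both neighbours, so it is all of `V`, and `A' = A`. -/
lemma IsConn.component (h : IsConn (insert v V)) (hE : nbr v .east ∉ V) (hN : nbr v .north ∉ V)
    (hv : v ∉ V) {A B : Finset (ℤ × ℤ)} (hAB : A ∪ B = V) (hd : Disjoint A B)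
    (hA : IsClosedIn V A) (hB : IsClosedIn V B) (hne : A.Nonempty)
    (hW : nbr v .west ∈ A ∧ nbr v .south ∈ B ∨ nbr v .west ∈ B ∧ nbr v .south ∈ A) :
    IsConn A := by
  refine ⟨hne, fun A' hA' hne' hc' => ?_⟩
  have hAV : A ⊆ V := hAB ▸ Finset.subset_union_left
  have hBV : B ⊆ V := hAB ▸ Finset.subset_union_right
  have hc : IsClosedIn V A' := fun p hp d hd => hc' p hp d (hA p (hA' hp) d hd)
  have hd' := Finset.disjoint_left.1 hd
  have hm := h.nbr_mem hE hN hv (hA'.trans hAV) hne' hc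
  have hu : IsClosedIn V (A' ∪ B) := by
    intro p hp d hpd
    rcases Finset.mem_union.1 hp with hp | hp
    · exact Finset.mem_union_left _ (hc p hp d hpd)
    · exact Finset.mem_union_right _ (hB p hp d hpd)
  have heq : A' ∪ B = V := by
    refine h.eq_of_nbr hE hN hv (Finset.union_subset (hA'.trans hAV) hBV) hu ?_ ?_
    · intro _
      rcases hW with ⟨h1, h2⟩ | ⟨h1, h2⟩
      · exact Finset.mem_union_left _ (hm.resolve_right fun h3 => hd' (hA' h3) h2)
      · exact Finset.mem_union_right _ h1
    · intro _
      rcases hW with ⟨h1, h2⟩ | ⟨h1, h2⟩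
      · exact Finset.mem_union_right _ h2
      · exact Finset.mem_union_left _ (hm.resolve_left fun h3 => hd' (hA' h3) h1)
  refine hA'.antisymm fun p hp => ?_
  have hpV := hAV hp
  rw [← heq, Finset.mem_union] at hpV
  exact hpV.resolve_right (hd' hp)

lemma IsClosedIn.sdiff {A : Finset (ℤ × ℤ)} (h : IsClosedIn V A) :
    IsClosedIn V (V \ A) := by
  intro p hp d hd
  rw [Finset.mem_sdiff] at hp ⊢
  refine ⟨hd, fun hdA => hp.2 ?_⟩
  have := h _ hdA d.opp
  rw [Dir.vec_opp, add_neg_cancel_right] at this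
  exact this hp.1

lemma IsClosedIn.not_adj {A B : Finset (ℤ × ℤ)} (hAB : A ∪ B = V) (hd : Disjoint A B)
    (h : IsClosedIn V A) : ∀ p ∈ A, ∀ d : Dir, p + d.vec ∉ B := fun p hp d hpd =>
  Finset.disjoint_left.1 hd (h p hp d (hAB ▸ Finset.mem_union_right _ hpd)) hpd

/-- Connected patches have Euler characteristic at most one, and if it is one, then their external
edges form one cycle, and the state sum is the value of the word of its labels. -/
theorem IsConn.hasOutline (hT : IsWordSum T) (V : Finset (ℤ × ℤ)) (h : IsConn V) :
    eulerChar V ≤ 1 ∧ (eulerChar V = 1 → HasOutline T V) := by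
  induction V using Finset.strongInduction with
  | H V ih =>
  obtain ⟨v, hvV, hE, hN⟩ := exists_extremal h.nonempty
  obtain ⟨V, rfl, hv⟩ : ∃ V', V = insert v V' ∧ v ∉ V' :=
    ⟨V.erase v, (Finset.insert_erase hvV).symm, Finset.notMem_erase v V⟩
  replace hE : nbr v .east ∉ V := fun h => hE (Finset.mem_insert_of_mem h)
  replace hN : nbr v .north ∉ V := fun h => hN (Finset.mem_insert_of_mem h)
  have hss : V ⊂ insert v V := Finset.ssubset_insert hv
  have hχ := eulerChar_insert hE hN hv
  by_cases hW : nbr v .west ∈ V <;> by_cases hS : nbr v .south ∈ V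
  · have hlc : (linkEdges V v).card = 2 := by
      simp only [linkEdges, hW, hS, if_true]
      rw [Finset.card_union_of_disjoint (by simp)]
      simp
    by_cases hSW : v + (-1, -1) ∈ V
    -- The west and south neighbours remain connected through the lower left corner.
    · have hV : IsConn V := by
        refine ⟨⟨_, hW⟩, fun A hA hne hc => ?_⟩
        have hm := h.nbr_mem hE hN hv hA hne hc
        have f1 : nbr v .south + Dir.west.vec = v + (-1, -1) := by
          simp [nbr, Dir.vec, add_assoc]
        have f2 : v + (-1, -1) + Dir.north.vec = nbr v .west := by
          simp [nbr, Dir.vec, add_assoc]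
        have f3 : nbr v .west + Dir.south.vec = v + (-1, -1) := by
          simp [nbr, Dir.vec, add_assoc]
        have f4 : v + (-1, -1) + Dir.east.vec = nbr v .south := by
          simp [nbr, Dir.vec, add_assoc]
        have g1 : nbr v .south ∈ A → nbr v .west ∈ A := fun hs =>
          f2 ▸ hc _ (f1 ▸ hc _ hs .west (f1 ▸ hSW)) .north (f2 ▸ hW)
        have g2 : nbr v .west ∈ A → nbr v .south ∈ A := fun hw =>
          f4 ▸ hc _ (f3 ▸ hc _ hw .south (f3 ▸ hSW)) .east (f4 ▸ hS)
        exact h.eq_of_nbr hE hN hv hA hc (fun _ => hm.elim id g1) (fun _ => hm.elim g2 id)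
      obtain ⟨h1, h2⟩ := ih V hss hV
      rw [if_pos ⟨hSW, hW, hS⟩, hlc] at hχ
      push_cast at hχ
      exact ⟨by omega, fun h3 => (h2 (by omega)).attach_plaquette hT hE hN hv hW hS hSW⟩
    · rw [if_neg (fun h => hSW h.1), hlc] at hχ
      push_cast at hχ
      -- If the rest is connected, the second edge closes a loop with no plaquette, the Euler
      -- characteristic falls to at most 0, and the claim about outlines is vacuous. Otherwise `v`
      -- joins two components, and total characteristic 1 forces 1 on each.
      by_cases hV : IsConn V
      · obtain ⟨h1, h2⟩ := ih V hss hV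
        exact ⟨by omega, fun h3 => by omega⟩
      · obtain ⟨A, hA, hne, hc, hneq⟩ : ∃ A ⊆ V, A.Nonempty ∧ IsClosedIn V A ∧ A ≠ V := by
          by_contra! hcon
          exact hV ⟨⟨_, hW⟩, hcon⟩
        obtain ⟨V₁, V₂, hu, hd, hc1, hc2, hW1, hS2⟩ : ∃ V₁ V₂, V₁ ∪ V₂ = V ∧ Disjoint V₁ V₂ ∧
            IsClosedIn V V₁ ∧ IsClosedIn V V₂ ∧ nbr v .west ∈ V₁ ∧ nbr v .south ∈ V₂ := by
          by_cases hWA : nbr v .west ∈ A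
          · have hSA : nbr v .south ∉ A := fun hSA =>
              hneq (h.eq_of_nbr hE hN hv hA hc (fun _ => hWA) fun _ => hSA)
            exact ⟨A, V \ A, Finset.union_sdiff_of_subset hA, Finset.disjoint_sdiff, hc,
              hc.sdiff, hWA, Finset.mem_sdiff.2 ⟨hS, hSA⟩⟩
          · have hSA := (h.nbr_mem hE hN hv hA hne hc).resolve_left hWA
            exact ⟨V \ A, A, Finset.sdiff_union_of_subset hA, Finset.sdiff_disjoint, hc.sdiff,
              hc, Finset.mem_sdiff.2 ⟨hW, hWA⟩, hSA⟩
        have hadj := hc1.not_adj hu hd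
        have hV1 : IsConn V₁ := h.component hE hN hv hu hd hc1 hc2 ⟨_, hW1⟩ (Or.inl ⟨hW1, hS2⟩)
        have hV2 : IsConn V₂ := h.component hE hN hv (by rw [Finset.union_comm, hu]) hd.symm hc2
          hc1 ⟨_, hS2⟩ (Or.inr ⟨hW1, hS2⟩)
        subst hu
        obtain ⟨h1, h1'⟩ := ih V₁ (Finset.subset_union_left.trans_ssubset hss) hV1
        obtain ⟨h2, h2'⟩ := ih V₂ (Finset.subset_union_right.trans_ssubset hss) hV2
        rw [eulerChar_union hd hadj] at hχ
        exact ⟨by omega, fun h3 => (h1' (by omega)).attach_union hT hd hadj hE hN hv hW1 hS2 hSW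
          (h2' (by omega))⟩
  · have hV : IsConn V := ⟨⟨_, hW⟩, fun A hA hne hc => h.eq_of_nbr hE hN hv hA hc
      (fun _ => (h.nbr_mem hE hN hv hA hne hc).resolve_right fun hs => hS (hA hs))
      fun hs => absurd hs hS⟩
    obtain ⟨h1, h2⟩ := ih V hss hV
    simp [linkEdges, hW, hS] at hχ
    exact ⟨by omega, fun h3 => (h2 (by omega)).attach_west hT hE hN hv hW hS⟩
  · have hV : IsConn V := ⟨⟨_, hS⟩, fun A hA hne hc => h.eq_of_nbr hE hN hv hA hc
      (fun hw => absurd hw hW)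
      fun _ => (h.nbr_mem hE hN hv hA hne hc).resolve_left fun hw => hW (hA hw)⟩
    obtain ⟨h1, h2⟩ := ih V hss hV
    simp [linkEdges, hW, hS] at hχ
    exact ⟨by omega, fun h3 => (h2 (by omega)).attach_south hT hE hN hv hW hS⟩
  -- A vertex without neighbours is a whole connected patch; this is the base of the induction.
  · have hV : V = ∅ := by
      by_contra hne
      rcases h.nbr_mem hE hN hv Finset.Subset.rfl (Finset.nonempty_iff_ne_empty.2 hne)
        (fun p _ d hd => hd) with h1 | h1
      · exact hW h1
      · exact hS h1
    subst hV
    have h0 : eulerChar ∅ = 0 := by decide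
    simp [linkEdges, h0] at hχ
    exact ⟨hχ.le, fun _ => hasOutline_singleton v⟩

end Connected

/-! ### Contractible patches -/

section Contractible

variable {V : Finset (ℤ × ℤ)}

lemma IsContractiblePatch.isConn (h : IsContractiblePatch V) : IsConn V := by
  obtain ⟨⟨p, hp⟩⟩ := h.connected.nonempty
  refine ⟨⟨p, hp⟩, fun A hA ⟨a, ha⟩ hc => hA.antisymm fun q hq => ?_⟩
  have key : ∀ (x y : V), (patchGraph V).Walk x y → x.1 ∈ A → y.1 ∈ A := by
    intro x y w hx
    induction w with
    | nil => exact hx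
    | @cons x y z hxy _ ih =>
      obtain ⟨d, hd⟩ := hxy
      exact ih (hd ▸ hc _ hx d (hd ▸ y.2))
  obtain ⟨w⟩ := h.connected.preconnected ⟨a, hA ha⟩ ⟨q, hq⟩
  exact key _ _ w ha

/-- The value on a half-edge of a cochain that is given on rightward and upward edges. -/
def cochain (g : HalfEdge → ℝ) (h : HalfEdge) : ℝ :=
  if h.2.IsOutgoing then g h else -g h.flip

lemma cochain_flip (g : HalfEdge → ℝ) (h : HalfEdge) : cochain g h.flip = -cochain g h := by
  have ho : h.flip.2.IsOutgoing ↔ ¬ h.2.IsOutgoing := Dir.isOutgoing_opp h.2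
  unfold cochain
  rw [HalfEdge.flip_flip]
  split_ifs <;> simp_all

/-- The value of a cochain on a step of a walk. -/
def stepValue (g : HalfEdge → ℝ) (p q : ℤ × ℤ) : ℝ :=
  ∑ d : Dir, if q = p + d.vec then cochain g (p, d) else 0

lemma Dir.vec_injective : Function.Injective Dir.vec := by
  intro a b
  revert a b
  decide

lemma stepValue_add (g : HalfEdge → ℝ) (p : ℤ × ℤ) (d : Dir) :
    stepValue g p (p + d.vec) = cochain g (p, d) := by
  rw [stepValue, Finset.sum_eq_single d]
  · simp
  · intro d' _ hd'
    rw [if_neg]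
    intro h
    exact hd' (Dir.vec_injective (add_left_cancel h)).symm
  · simp

/-- The sum of the values of a cochain along a walk. -/
def holonomy (g : HalfEdge → ℝ) : ∀ {p q : V}, (patchGraph V).Walk p q → ℝ
  | _, _, .nil => 0
  | _, _, .cons (u := p) (v := q) _ w => stepValue g p.1 q.1 + holonomy g w

lemma holonomy_append (g : HalfEdge → ℝ) {p q r : V} (a : (patchGraph V).Walk p q)
    (b : (patchGraph V).Walk q r) : holonomy g (a.append b) = holonomy g a + holonomy g b := by
  induction a with
  | nil => simp [holonomy]
  | cons h w ih => simp [holonomy, ih, add_assoc]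

/-- The square move of `WalkHomotopic` also admits degenerate squares. Two two-step paths with
common ends are equal, or both backtrack, or run around opposite sides of a unit square. -/
lemma Dir.parallelogram : ∀ a b a' b' : Dir, a.vec + b.vec = a'.vec + b'.vec →
    (a = a' ∧ b = b') ∨ (b = a.opp ∧ b' = a'.opp) ∨
      (a' = b ∧ b' = a ∧ (a.IsOutgoing ∧ b.IsOutgoing ∨ a.IsOutgoing ∧ b.opp.IsOutgoing ∨
        a.opp.IsOutgoing ∧ b.IsOutgoing ∨ a.opp.IsOutgoing ∧ b.opp.IsOutgoing) ∧
        a ≠ b ∧ a ≠ b.opp) := by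
  decide

end Contractible

/-! ### Flat cochains and the lower bound on the Euler characteristic. -/

section Contractible

variable {V : Finset (ℤ × ℤ)}

/-- The cochain has no circulation around the plaquettes of `V`. -/
def IsFlat (V : Finset (ℤ × ℤ)) (g : HalfEdge → ℝ) : Prop :=
  ∀ p ∈ plaquettes V, g (p, .east) + g (p + (1, 0), .north) = g (p, .north) + g (p + (0, 1), .east)

lemma cochain_far (g : HalfEdge → ℝ) (p : ℤ × ℤ) (d : Dir) :
    cochain g (p + d.vec, d.opp) = -cochain g (p, d) :=
  cochain_flip g (p, d)

lemma IsFlat.square {g : HalfEdge → ℝ} (hg : IsFlat V g) {p : ℤ × ℤ} {a b : Dir} (hab : a ≠ b)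
    (hab' : a ≠ b.opp) (h1 : p ∈ V) (h2 : p + a.vec ∈ V) (h3 : p + b.vec ∈ V)
    (h4 : p + a.vec + b.vec ∈ V) :
    cochain g (p, a) + cochain g (p + a.vec, b) = cochain g (p, b) + cochain g (p + b.vec, a) := by
  have hsq : ∀ x y : ℤ, (x, y) ∈ V → (x + 1, y) ∈ V → (x, y + 1) ∈ V → (x + 1, y + 1) ∈ V →
      g ((x, y), .east) + g ((x + 1, y), .north) = g ((x, y), .north) + g ((x, y + 1), .east) := by
    intro x y h1 h2 h3 h4
    have := hg (x, y) (mem_plaquettes.2 ⟨h1, by simpa using h2, by simpa using h3, by simpa using h4⟩)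
    simpa using this
  have hE : ∀ x y, cochain g ((x, y), .east) = g ((x, y), .east) := fun x y => by
    simp [cochain, Dir.IsOutgoing]
  have hN : ∀ x y, cochain g ((x, y), .north) = g ((x, y), .north) := fun x y => by
    simp [cochain, Dir.IsOutgoing]
  have hW : ∀ x y, cochain g ((x, y), .west) = -g ((x - 1, y), .east) := fun x y => by
    simp [cochain, Dir.IsOutgoing, HalfEdge.flip, HalfEdge.far, Dir.vec, Dir.opp, sub_eq_add_neg]
  have hS : ∀ x y, cochain g ((x, y), .south) = -g ((x, y - 1), .north) := fun x y => by
    simp [cochain, Dir.IsOutgoing, HalfEdge.flip, HalfEdge.far, Dir.vec, Dir.opp, sub_eq_add_neg]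
  obtain ⟨x, y⟩ := p
  -- Flatness is stated at lower left corners, whereas `p` may be any corner. The four instances
  -- have `p` at the lower left, upper left, lower right and upper right.
  have s1 := hsq x y
  have s2 := hsq x (y - 1)
  have s3 := hsq (x - 1) y
  have s4 := hsq (x - 1) (y - 1)
  simp only [sub_add_cancel] at s2 s3 s4
  cases a <;> cases b <;> simp [Dir.opp] at hab hab' <;>
    simp only [Dir.vec, Prod.mk_add_mk, add_zero, ← sub_eq_add_neg, hE, hN, hW, hS] at h1 h2 h3 h4 ⊢
  · exact s1 h1 h2 h3 h4
  · have := s2 h3 h4 h1 h2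
    linarith
  · exact (s1 h1 h3 h2 h4).symm
  · have := s3 h3 h1 h4 h2
    linarith
  · have := s3 h2 h1 h4 h3
    linarith
  · have := s4 h4 h3 h2 h1
    linarith
  · have := s2 h2 h4 h1 h3
    linarith
  · have := s4 h4 h2 h3 h1
    linarith

/-- Each generating move preserves the sum: a backtrack contributes opposite values, and a
nondegenerate square is covered by flatness. -/
lemma holonomy_homotopic {g : HalfEdge → ℝ} (hg : IsFlat V g) {p q : V}
    {a b : (patchGraph V).Walk p q} (h : WalkHomotopic (patchGraph V) a b) :
    holonomy g a = holonomy g b := by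
  induction h with
  | refl a => rfl
  | symm _ ih => exact ih.symm
  | trans _ _ ih ih' => exact ih.trans ih'
  | cons h _ ih => simp [holonomy, ih]
  | @backtrack p q s h a =>
    obtain ⟨d, hd⟩ := h
    have h1 : p.1 = q.1 + d.opp.vec := by rw [hd, Dir.vec_opp, add_neg_cancel_right]
    have h2 : stepValue g q.1 p.1 = -stepValue g p.1 q.1 := by
      rw [h1, stepValue_add, ← h1, hd, stepValue_add, cochain_far]
    simp [holonomy, h2]
  | @square p q q' s t h₁ h₂ h₁' h₂' a =>
    obtain ⟨a₁, ha₁⟩ := h₁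
    obtain ⟨a₂, ha₂⟩ := h₂
    obtain ⟨b₁, hb₁⟩ := h₁'
    obtain ⟨b₂, hb₂⟩ := h₂'
    have hv : a₁.vec + a₂.vec = b₁.vec + b₂.vec := by
      have : p.1 + (a₁.vec + a₂.vec) = p.1 + (b₁.vec + b₂.vec) := by
        rw [← add_assoc, ← ha₁, ← ha₂, ← add_assoc, ← hb₁, ← hb₂]
      exact add_left_cancel this
    have h1 : stepValue g p.1 q.1 + stepValue g q.1 s.1 =
        cochain g (p.1, a₁) + cochain g (p.1 + a₁.vec, a₂) := by
      rw [ha₂, stepValue_add, ha₁, stepValue_add]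
    have h2 : stepValue g p.1 q'.1 + stepValue g q'.1 s.1 =
        cochain g (p.1, b₁) + cochain g (p.1 + b₁.vec, b₂) := by
      rw [hb₂, stepValue_add, hb₁, stepValue_add]
    have key : stepValue g p.1 q.1 + stepValue g q.1 s.1 =
        stepValue g p.1 q'.1 + stepValue g q'.1 s.1 := by
      rw [h1, h2]
      rcases Dir.parallelogram a₁ a₂ b₁ b₂ hv with ⟨rfl, rfl⟩ | ⟨rfl, rfl⟩ | ⟨rfl, rfl, -, h3, h4⟩
      · rfl
      · rw [cochain_far, cochain_far, add_neg_cancel, add_neg_cancel]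
      · exact hg.square h3 h4 p.2 (ha₁ ▸ q.2) (hb₁ ▸ q'.2) (by rw [← ha₁, ← ha₂]; exact s.2)
    simp only [holonomy]
    rw [← add_assoc, ← add_assoc, key]

/-- Vanishing of the first cohomology: integrate the cochain from a base point. Simple connectedness
makes the integral independent of the path. -/
lemma IsContractiblePatch.exists_potential (h : IsContractiblePatch V) {g : HalfEdge → ℝ}
    (hg : IsFlat V g) : ∃ f : V → ℝ, ∀ p q : V, ∀ d : Dir, d.IsOutgoing → q.1 = p.1 + d.vec →
      g (p.1, d) = f q - f p := by
  obtain ⟨o⟩ := h.connected.nonempty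
  have w := fun p => (h.connected.preconnected o p).some
  refine ⟨fun p => holonomy g (w p), fun p q d hd hpq => ?_⟩
  have h1 : (patchGraph V).Adj p q := ⟨d, hpq⟩
  have h2 := holonomy_homotopic hg (h.simplyConnected _ _ ((w p).append (.cons h1 .nil)) (w q))
  rw [holonomy_append] at h2
  simp only [holonomy, add_zero] at h2
  rw [hpq, stepValue_add] at h2
  have h3 : cochain g (p.1, d) = g (p.1, d) := if_pos hd
  dsimp only
  rw [← h2, h3]
  ring

/-- Exactness of vertex cochains, edge cochains, plaquette cochains at the middle term bounds the
number of edges by the rank of `δ₀` plus the number of plaquettes. Constants lie in the kernel of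
`δ₀`, so its rank is at most the number of vertices minus one. -/
lemma IsContractiblePatch.one_le_eulerChar (h : IsContractiblePatch V) : 1 ≤ eulerChar V := by
  -- The default value 0 is harmless: all sides of a plaquette of `V` are internal edges.
  let ext (g : intEdges V → ℝ) (k : HalfEdge) : ℝ := if hk : k ∈ intEdges V then g ⟨k, hk⟩ else 0
  let δ₀ : (V → ℝ) →ₗ[ℝ] (intEdges V → ℝ) :=
    { toFun := fun f e => f ⟨e.1.far, (mem_intEdges.1 e.2).2.2⟩ - f ⟨e.1.1, (mem_intEdges.1 e.2).1⟩
      map_add' := by intro f g; funext e; simp; ring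
      map_smul' := by intro r f; funext e; simp; ring }
  let δ₁ : (intEdges V → ℝ) →ₗ[ℝ] (plaquettes V → ℝ) :=
    { toFun := fun g p => ext g (p.1, .east) + ext g (p.1 + (1, 0), .north) -
        (ext g (p.1, .north) + ext g (p.1 + (0, 1), .east))
      map_add' := by
        intro f g
        have : ∀ k, ext (f + g) k = ext f k + ext g k := fun k => by
          simp only [ext]; split_ifs <;> simp
        funext p
        simp only [this, Pi.add_apply]
        ring
      map_smul' := by
        intro r f
        have : ∀ k, ext (r • f) k = r * ext f k := fun k => by
          simp only [ext]; split_ifs <;> simp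
        funext p
        simp only [this, Pi.smul_apply, smul_eq_mul, RingHom.id_apply]
        ring }
  have hker : LinearMap.ker δ₁ ≤ LinearMap.range δ₀ := by
    intro g hg
    have hflat : IsFlat V (ext g) := fun p hp => sub_eq_zero.1 (congrFun hg ⟨p, hp⟩)
    obtain ⟨f, hf⟩ := h.exists_potential hflat
    refine ⟨f, ?_⟩
    funext ⟨e, he⟩
    have he' := mem_intEdges.1 he
    have := hf ⟨e.1, he'.1⟩ ⟨e.far, he'.2.2⟩ e.2 he'.2.1 rfl
    simp only [ext, Prod.mk.eta, he, dif_pos] at this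
    exact this.symm
  obtain ⟨o⟩ := h.connected.nonempty
  have hone : 1 ≤ Module.finrank ℝ (LinearMap.ker δ₀) := by
    have hm : (fun _ => 1 : V → ℝ) ∈ LinearMap.ker δ₀ := by
      rw [LinearMap.mem_ker]
      funext e
      exact sub_self _
    refine Module.finrank_pos_iff_exists_ne_zero.2 ⟨⟨_, hm⟩, fun h0 => ?_⟩
    exact one_ne_zero (congrFun (congrArg Subtype.val h0) o)
  have r0 := LinearMap.finrank_range_add_finrank_ker δ₀
  have r1 := LinearMap.finrank_range_add_finrank_ker δ₁
  have l0 := Submodule.finrank_mono hker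
  have l1 := Submodule.finrank_le (LinearMap.range δ₁)
  simp only [Module.finrank_fintype_fun_eq_card, Fintype.card_coe] at r0 r1 l1
  rw [eulerChar, ← card_plaquettes]
  omega

lemma IsContractiblePatch.hasOutline (h : IsContractiblePatch V) {ι : Type w} [Fintype ι]
    {T : List (ι × Bool) → ℕ → ℕ} (hT : IsWordSum T) : HasOutline T V :=
  (h.isConn.hasOutline hT).2 (le_antisymm (h.isConn.hasOutline hT).1 h.one_le_eulerChar)

end Contractible

/-! ### The list of external edges -/

section LegList

variable {V : Finset (ℤ × ℤ)}

/-- A half-edge at a vertex of the patch as a half-edge of the lattice. -/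
def toHalfEdge (h : V × Dir) : HalfEdge := (h.1.1, h.2)

lemma toHalfEdge_injective : Function.Injective (toHalfEdge (V := V)) := by
  rintro ⟨⟨p, hp⟩, d⟩ ⟨⟨q, hq⟩, e⟩ h
  obtain ⟨rfl, rfl⟩ := Prod.mk.inj h
  rfl

/-- A half-edge, if it is external. -/
def legOption (h : V × Dir) : Option (Leg V) :=
  if hk : h.1.1 + h.2.vec ∉ V then some ⟨h, hk⟩ else none

lemma turn_of_mem {h : V × Dir} (hm : HalfEdge.far (h.1.1, h.2.next) ∈ V) :
    turn V h = (⟨HalfEdge.far (h.1.1, h.2.next), hm⟩, h.2.next.opp) :=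
  dif_pos hm

lemma turn_of_notMem {h : V × Dir} (hm : HalfEdge.far (h.1.1, h.2.next) ∉ V) :
    turn V h = (h.1, h.2.next) :=
  dif_neg hm

/-- Every step of a walk is one application of `turn`, with a shift: the walk stands on the
half-edge about to be inspected, while `turn` stands on the one reached last. Crossing an internal
edge leaves `turn` on its other half, which is not external and is dropped from the list. -/
lemma OutlineWalk.exists_iterate {c c' : HalfEdge} {L : List HalfEdge} (hw : OutlineWalk V c L c')
    (h : V × Dir) (hc : (h.1.1, h.2.next) = c) : ∃ K : ℕ,
      (((turn V)^[K] h).1.1, ((turn V)^[K] h).2.next) = c' ∧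
      ((List.range K).filterMap fun k => legOption ((turn V)^[k + 1] h)).map
        (fun l => toHalfEdge l.1) = L := by
  induction hw generalizing h with
  | nil => exact ⟨0, hc, rfl⟩
  | leg hf _ ih =>
    subst hc
    have ht := turn_of_notMem hf
    obtain ⟨K, h1, h2⟩ := ih (turn V h) (by rw [ht])
    refine ⟨K + 1, h1, ?_⟩
    have hl : legOption (turn V h) = some ⟨turn V h, by rw [ht]; exact hf⟩ := dif_pos _
    rw [List.range_succ_eq_map, List.filterMap_cons, List.filterMap_map]
    simp only [Function.iterate_succ, Function.iterate_zero, Function.comp_def, id] at h2 ⊢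
    rw [hl, List.map_cons, h2]
    congr 1
    simp [toHalfEdge, ht]
  | edge hf _ ih =>
    subst hc
    have ht := turn_of_mem hf
    obtain ⟨K, h1, h2⟩ := ih (turn V h) (by rw [ht])
    refine ⟨K + 1, h1, ?_⟩
    have hl : legOption (turn V h) = none := by
      refine dif_neg (not_not.2 ?_)
      rw [ht]
      change HalfEdge.far (HalfEdge.flip _) ∈ V
      rw [HalfEdge.far_flip]
      exact h.1.2
    rw [List.range_succ_eq_map, List.filterMap_cons, List.filterMap_map]
    simp only [Function.iterate_succ, Function.iterate_zero, Function.comp_def, id] at h2 ⊢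
    rw [hl, h2]

/-- The outline of a patch is the list of its external edges. -/
lemma IsOutline.legList_eq {b : Leg V} {R : List HalfEdge} (h : IsOutline V (toHalfEdge b.1) R) :
    (legList b).map (fun l => toHalfEdge l.1) = toHalfEdge b.1 :: R := by
  obtain ⟨K, h1, h2⟩ := h.walk.exists_iterate b.1 rfl
  -- After `K` turns the walk is about to inspect `b` again; one more turn lands on it.
  have hb : (turn V)^[K + 1] b.1 = b.1 := by
    rw [Function.iterate_succ_apply', turn_of_notMem (by rw [h1]; exact b.2)]
    exact toHalfEdge_injective h1
  have hper : Function.IsPeriodicPt (turn V) (K + 1) b.1 := hb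
  have hpos : 0 < Function.minimalPeriod (turn V) b.1 := hper.minimalPeriod_pos (Nat.succ_pos K)
  have hle : Function.minimalPeriod (turn V) b.1 ≤ K + 1 := hper.minimalPeriod_le (Nat.succ_pos K)
  have hlb : legOption b.1 = some b := dif_pos b.2
  -- An earlier return to `b` would put it among the emitted half-edges `R`, contradicting that the
  -- outline has no repetition.
  have heq : Function.minimalPeriod (turn V) b.1 = K + 1 := by
    by_contra hne
    refine (List.nodup_cons.1 h.nodup).1 ?_
    rw [← h2]
    refine List.mem_map.2 ⟨b, List.mem_filterMap.2
      ⟨Function.minimalPeriod (turn V) b.1 - 1, List.mem_range.2 (by omega), ?_⟩, rfl⟩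
    rw [Nat.sub_add_cancel hpos, Function.iterate_minimalPeriod, hlb]
  have hdef : legList b = (List.range (Function.minimalPeriod (turn V) b.1)).filterMap
      fun k => legOption ((turn V)^[k] b.1) := rfl
  rw [hdef, heq, List.range_succ_eq_map, List.filterMap_cons, List.filterMap_map]
  simp only [Function.iterate_zero, id, hlb, List.map_cons]
  rw [← h2]
  rfl

end LegList

/-! ### Ground states of diagonal operators -/

section LinearAlgebra

variable {M : Type*} [AddCommGroup M] [Module ℂ M] {K : Type*} [Fintype K]

lemma repr_diagonal (b : Module.Basis K ℂ M) {T : Module.End ℂ M} {f : K → ℂ}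
    (hT : ∀ k, T (b k) = f k • b k) (ψ : M) (k : K) : b.repr (T ψ) k = f k * b.repr ψ k := by
  have h : T ψ = ∑ j, (f j * b.repr ψ j) • b j := by
    conv_lhs => rw [← b.sum_repr ψ]
    simp only [map_sum, map_smul, hT, smul_smul, mul_comm]
  rw [h, b.repr_sum_self]

/-- The ground states of a diagonal operator are spanned by basis vectors of least energy. -/
lemma mem_groundStates_iff (b : Module.Basis K ℂ M) {T : Module.End ℂ M} {f : K → ℝ}
    (hT : ∀ k, T (b k) = (f k : ℂ) • b k) {k₀ : K} (hmin : ∀ k, f k₀ ≤ f k) (ψ : M) :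
    ψ ∈ groundStates T ↔ ∀ k, b.repr ψ k ≠ 0 → f k = f k₀ := by
  have hmem : ∀ (r : ℝ) (φ : M), φ ∈ T.eigenspace (r : ℂ) ↔ ∀ k, b.repr φ k ≠ 0 → f k = r := by
    intro r φ
    rw [Module.End.mem_eigenspace_iff, ← b.repr.injective.eq_iff, Finsupp.ext_iff]
    refine forall_congr' fun k => ?_
    rw [repr_diagonal b hT, map_smul, Finsupp.smul_apply, smul_eq_mul, mul_eq_mul_right_iff,
      Complex.ofReal_inj]
    tauto
  -- Every eigenvalue occurs on the diagonal, since an eigenvector has a nonzero coordinate; thus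
  -- the infimum in `groundStates` is attained at `f k₀`.
  have hleast : IsLeast {r : ℝ | T.HasEigenvalue (r : ℂ)} (f k₀) := by
    constructor
    · refine Module.End.hasEigenvalue_of_hasEigenvector (x := b k₀) ⟨?_, b.ne_zero k₀⟩
      rw [Module.End.mem_eigenspace_iff]
      exact hT k₀
    · intro r hr
      obtain ⟨φ, hφ, hne⟩ := hr.exists_hasEigenvector
      obtain ⟨k, hk⟩ : ∃ k, b.repr φ k ≠ 0 := by
        by_contra! hcon
        exact hne (b.repr.injective (by ext k; simp [hcon k]))
      rw [← (hmem r φ).1 hφ k hk]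
      exact hmin k
  rw [groundStates, hleast.csInf_eq, hmem]

lemma sesquilinear_eq_sum_repr [DecidableEq K] (B : M →ₗ⋆[ℂ] M →ₗ[ℂ] ℂ) (b : Module.Basis K ℂ M)
    (hb : ∀ i j, B (b i) (b j) = if i = j then 1 else 0) (x y : M) :
    B x y = ∑ k, conj (b.repr x k) * b.repr y k := by
  conv_lhs => rw [← b.sum_repr x, ← b.sum_repr y]
  simp only [map_sum, LinearMap.sum_apply, map_smulₛₗ, LinearMap.smul_apply, hb]
  simp [mul_comm]

/-- A unitary onto a direct sum from a bijection of orthonormal bases. -/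
lemma exists_unitary [DecidableEq K] {G : Submodule ℂ M} {B : M → M → ℂ} (b : Module.Basis K ℂ M)
    (hB : ∀ x y, B x y = ∑ k, conj (b.repr x k) * b.repr y k) {P : K → Prop} [DecidablePred P]
    (hG : ∀ ψ, ψ ∈ G ↔ ∀ k, b.repr ψ k ≠ 0 → P k)
    {X : Type*} [Fintype X] [DecidableEq X] (bd : K → X) {N : X → Type*}
    [∀ x, AddCommGroup (N x)] [∀ x, Module ℂ (N x)] [∀ x, FiniteDimensional ℂ (N x)]
    {A : ∀ x, N x → N x → ℂ} (hA : ∀ x, IsInnerForm (A x))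
    (hcard : ∀ x, Fintype.card {k : K // P k ∧ bd k = x} = Module.finrank ℂ (N x)) :
    ∃ U : G ≃ₗ[ℂ] (∀ x, N x),
      (∀ φ ψ : G, B φ ψ = ∑ x, A x (U φ x) (U ψ x)) ∧
      ∀ (ψ : G) (x : X), (∀ k, b.repr (ψ : M) k ≠ 0 → bd k = x) ↔ ∀ y, y ≠ x → U ψ y = 0 := by
  choose c hc using fun x => (hA x).exists_orthonormal
  let EG : G ≃ₗ[ℂ] ({k // P k} → ℂ) :=
    { toFun := fun ψ k => b.repr (ψ : M) k.1
      map_add' := by intro φ ψ; funext k; simp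
      map_smul' := by intro r ψ; funext k; simp
      invFun := fun f => ⟨b.equivFun.symm fun k => if hk : P k then f ⟨k, hk⟩ else 0, (hG _).2
        fun k hk => by
          by_contra h
          refine hk ?_
          rw [← b.equivFun_apply, LinearEquiv.apply_symm_apply, dif_neg h]⟩
      left_inv := by
        intro ψ
        apply Subtype.ext
        apply b.equivFun.injective
        funext k
        rw [LinearEquiv.apply_symm_apply]
        split_ifs with hk
        · rfl
        · by_contra h
          exact hk ((hG ψ).1 ψ.2 k (Ne.symm h))
      right_inv := by
        intro f
        funext k
        dsimp only
        rw [← b.equivFun_apply, LinearEquiv.apply_symm_apply, dif_pos k.2] }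
  -- The admissible indices are sorted by boundary condition, and each class is numbered by an
  -- orthonormal basis of the matching summand; only the equality of cardinalities makes this
  -- possible.
  let σ : {k // P k} ≃ Σ x, Fin (Module.finrank ℂ (N x)) :=
    (Equiv.sigmaFiberEquiv fun k : {k // P k} => bd k.1).symm.trans
      (Equiv.sigmaCongrRight fun x => Fintype.equivFinOfCardEq ((Fintype.card_congr
        (Equiv.subtypeSubtypeEquivSubtypeInter P fun k => bd k = x)).trans (hcard x)))
  have hσ : ∀ k, (σ k).1 = bd k.1 := fun k => rfl
  let U : G ≃ₗ[ℂ] (∀ x, N x) := (EG.trans (LinearEquiv.funCongrLeft ℂ ℂ σ.symm)).trans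
    (Pi.basis c).equivFun.symm
  have hU : ∀ (ψ : G) x m, (c x).repr (U ψ x) m = b.repr (ψ : M) (σ.symm ⟨x, m⟩).1 := by
    intro ψ x m
    rw [← Pi.basis_repr c (U ψ) ⟨x, m⟩, ← Module.Basis.equivFun_apply]
    exact congrFun (LinearEquiv.apply_symm_apply (Pi.basis c).equivFun _) _
  refine ⟨U, fun φ ψ => ?_, fun ψ x => ⟨fun h y hy => ?_, fun h k hk => ?_⟩⟩
  · have h0 : ∑ k, conj (b.repr (φ : M) k) * b.repr (ψ : M) k =
        ∑ k : {k // P k}, conj (b.repr (φ : M) k.1) * b.repr (ψ : M) k.1 := by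
      rw [← Finset.sum_subtype (Finset.univ.filter P) (by simp)
        fun k => conj (b.repr (φ : M) k) * b.repr (ψ : M) k, Finset.sum_filter]
      refine Finset.sum_congr rfl fun k _ => ?_
      split_ifs with hk
      · rfl
      · by_contra h
        exact hk ((hG ψ).1 ψ.2 k fun h' => h (by rw [h', mul_zero]))
    rw [hB, h0, ← σ.symm.sum_comp, Fintype.sum_sigma]
    refine Finset.sum_congr rfl fun x _ => ?_
    rw [(hA x).eq_sum_repr (c x) (hc x)]
    exact Finset.sum_congr rfl fun m _ => by rw [hU, hU]
  · apply (c y).repr.injective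
    ext m
    rw [hU, map_zero, Finsupp.zero_apply]
    by_contra h0
    have h1 := h _ h0
    rw [← hσ, Equiv.apply_symm_apply] at h1
    exact hy h1
  · by_contra hne
    have hk' := (hG ψ).1 ψ.2 k hk
    have h1 := hU ψ (bd k) (σ ⟨k, hk'⟩).2
    have h2 : (⟨bd k, (σ ⟨k, hk'⟩).2⟩ : Σ x, Fin (Module.finrank ℂ (N x))) = σ ⟨k, hk'⟩ := rfl
    rw [h2, Equiv.symm_apply_apply, h _ hne, map_zero] at h1
    exact hk h1.symm

end LinearAlgebra

/-! ### Orthonormal bases of the string net model -/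

section ModelBasis

variable {C : Type u} [Category.{v} C] [Abelian C] [Linear ℂ C]
  [MonoidalCategory C] [MonoidalPreadditive C] [MonoidalLinear ℂ C]
  [UnitaryFusionCategory C] (D : SphericalStructure C)
  {ι : Type w} [Fintype ι] [DecidableEq ι] (S : ι → C)

/-- The dimension of the space of a vertex with given labels. -/
def vertexDim (a : Dir → ι) : ℕ :=
  homRank (S (a .west) ⊗ S (a .south)) (S (a .north) ⊗ S (a .east))

/-- The index set of a basis of `H_v`: the labels, and a basis vector for these labels. -/
abbrev LocalIndex := Σ a : Dir → ι, Fin (vertexDim S a)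

/-- A basis of `H_v` that is compatible with the labels. -/
structure LocalBasis where
  basis : Module.Basis (LocalIndex S) ℂ (Local S)
  orthonormal : ∀ i j, localForm D S (basis i) (basis j) = if i = j then 1 else 0
  labelled : ∀ i (a : Dir → ι), a ≠ i.1 → basis i a = 0

variable {S}

/-- Positive quantum dimensions make the rescaled trace form an inner product on each label sector.
Orthonormal bases of the sectors combine because different labels are orthogonal. -/
lemma IsIrr.exists_localBasis (hS : IsIrr S) : Nonempty (LocalBasis D S) := by
  have hr : ∀ a : Dir → ι, 0 < (√(∏ d, dim D (S (a d))))⁻¹ := fun a =>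
    inv_pos.2 (Real.sqrt_pos.2 (Finset.prod_pos fun d _ => hS.dim_pos D (a d)))
  have h : ∀ a : Dir → ι, ∃ e : Module.Basis (Fin (vertexDim S a)) ℂ
      (S (a .west) ⊗ S (a .south) ⟶ S (a .north) ⊗ S (a .east)), ∀ i j,
      ∑ _k : Unit, (((√(∏ d, dim D (S (a d))))⁻¹ : ℝ) : ℂ) * trInner D (e i) (e j) =
        if i = j then 1 else 0 := fun a => (IsInnerForm.sum_comp (κ := Unit)
    (fun _ => isInnerForm_trInner D (S (a .west) ⊗ S (a .south)) (S (a .north) ⊗ S (a .east)))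
    (fun _ => LinearMap.id) (fun _ => (√(∏ d, dim D (S (a d))))⁻¹) (fun _ => hr a)
    (fun x hx => hx ())).exists_orthonormal
  choose e he using h
  have hval : ∀ (i : LocalIndex S) a, Pi.basis e i a =
      Pi.single (M := fun a : Dir → ι => S (a .west) ⊗ S (a .south) ⟶ S (a .north) ⊗ S (a .east))
        i.1 (e i.1 i.2) a := fun i a => by rw [Pi.basis_apply]
  have hlab : ∀ (i : LocalIndex S) (a : Dir → ι), a ≠ i.1 → Pi.basis e i a = 0 := by
    intro i a ha
    rw [hval, Pi.single_eq_of_ne ha]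
  refine ⟨⟨Pi.basis e, ?_, hlab⟩⟩
  rintro ⟨a, m⟩ ⟨a', m'⟩
  change ∑ c : Dir → ι, _ = _
  rw [Finset.sum_eq_single a]
  · by_cases haa : a = a'
    · subst haa
      have := he a m m'
      simp only [Finset.univ_unique, Finset.sum_singleton] at this
      rw [hval, hval, Pi.single_eq_same, Pi.single_eq_same]
      refine this.trans ?_
      simp
    · rw [hlab ⟨a', m'⟩ a haa, if_neg (fun h => haa (congrArg Sigma.fst h)),
        (isInnerForm_trInner D _ _).zero_right, mul_zero]
  · intro c _ hc
    rw [hlab ⟨a, m⟩ c hc, (isInnerForm_trInner D _ _).zero_left, mul_zero]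
  · simp

variable {D} {V : Finset (ℤ × ℤ)} (L : LocalBasis D S)

/-- The index set of a basis of the total space. -/
abbrev TotalIndex (S : ι → C) (V : Finset (ℤ × ℤ)) := ∀ _ : V, LocalIndex S

/-- The basis of product states. -/
def LocalBasis.total : Module.Basis (TotalIndex S V) ℂ (Total S V) :=
  Basis.piTensorProduct fun _ => L.basis

lemma LocalBasis.total_apply (k : TotalIndex S V) :
    L.total k = PiTensorProduct.tprod ℂ fun p => L.basis (k p) :=
  Basis.piTensorProduct_apply _ _

variable (D S V) in
/-- The inner product of the total space as a sesquilinear map. -/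
def totalSesq : Total S V →ₗ⋆[ℂ] Total S V →ₗ[ℂ] ℂ :=
  LinearMap.mk₂'ₛₗ (starRingEnd ℂ) (RingHom.id ℂ) (totalInner D S V)
    (by intro f f' g; simp [totalInner, tensorForm])
    (by intro r f g; simp [totalInner, tensorForm])
    (by intro f g g'; simp [totalInner, tensorForm])
    (by intro r f g; simp [totalInner, tensorForm])

lemma LocalBasis.totalInner_eq_sum (φ ψ : Total S V) :
    totalInner D S V φ ψ = ∑ k, conj (L.total.repr φ k) * L.total.repr ψ k := by
  refine sesquilinear_eq_sum_repr (totalSesq D S V) L.total (fun i j => ?_) φ ψ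
  change totalInner D S V _ _ = _
  rw [L.total_apply, L.total_apply, totalInner, tensorForm_tprod]
  simp_rw [L.orthonormal]
  by_cases h : i = j
  · subst h
    simp
  · rw [if_neg h]
    obtain ⟨p, hp⟩ := Function.ne_iff.1 h
    exact Finset.prod_eq_zero (Finset.mem_univ p) (if_neg hp)

lemma LocalBasis.labelProj_basis (d : Dir) (i : ι) (m : LocalIndex S) :
    labelProj S d i (L.basis m) = (if m.1 d = i then (1 : ℂ) else 0) • L.basis m := by
  funext a
  change (if a d = i then L.basis m a else 0) = (if m.1 d = i then (1 : ℂ) else 0) • L.basis m a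
  by_cases h : a = m.1
  · subst h
    split_ifs <;> simp
  · rw [L.labelled m a h]
    simp

lemma LocalBasis.atVertex_labelProj (p : V) (d : Dir) (i : ι) (k : TotalIndex S V) :
    atVertex S p (labelProj S d i) (L.total k) =
      (if (k p).1 d = i then (1 : ℂ) else 0) • L.total k := by
  rw [L.total_apply, atVertex, PiTensorProduct.map_tprod]
  have h : (fun q => (if q = p then labelProj S d i else LinearMap.id) (L.basis (k q))) =
      Function.update (fun q => L.basis (k q)) p
        ((if (k p).1 d = i then (1 : ℂ) else 0) • L.basis (k p)) := by
    funext q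
    by_cases hq : q = p
    · subst hq
      rw [if_pos rfl, Function.update_self, L.labelProj_basis]
    · rw [if_neg hq, Function.update_of_ne hq]
      rfl
  rw [h, MultilinearMap.map_update_smul, Function.update_eq_self]

lemma LocalBasis.edgeTerm_total (l : Edge V) (k : TotalIndex S V) :
    edgeTerm S l (L.total k) =
      (if (k l.1.1).1 l.1.2 = (k l.head).1 l.1.2.opp then (1 : ℂ) else 0) • L.total k := by
  rw [edgeTerm, LinearMap.sum_apply]
  simp_rw [Module.End.mul_apply, L.atVertex_labelProj, map_smul, L.atVertex_labelProj, smul_smul]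
  rw [← Finset.sum_smul]
  congr 1
  simp [eq_comm]

/-- The labels of a product state match along all internal edges. -/
def IsMatched (a : V → Dir → ι) : Prop :=
  ∀ l : Edge V, a l.1.1 l.1.2 = a l.head l.1.2.opp

/-- Labelling everything by the unit object gives a nonzero vertex space. This provides a product
state with all edges matched, so the edge terms are not frustrated. -/
lemma IsIrr.exists_vertexDim_pos (hS : IsIrr S) : ∃ i : ι, 0 < vertexDim S fun _ => i := by
  obtain ⟨i, ⟨e⟩⟩ := hS.exists_iso (𝟙_ C) inferInstance
  refine ⟨i, ?_⟩
  have f : S i ⊗ S i ≅ 𝟙_ C := (e.symm ⊗ᵢ e.symm) ≪≫ λ_ _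
  have h : vertexDim S (fun _ => i) = homRank (𝟙_ C) (𝟙_ C) := homRank_congr f f
  rw [h, homRank, finrank_endomorphism_simple_eq_one ℂ (𝟙_ C)]
  exact one_pos

/-- A product state has energy minus the number of its matched edges. The state labelled by the unit
attains minus the number of all edges, so minimal energy means that every edge is matched. -/
lemma LocalBasis.mem_edgeGroundStates (hS : IsIrr S) (ψ : Total S V) :
    ψ ∈ edgeGroundStates S V ↔
      ∀ k, L.total.repr ψ k ≠ 0 → IsMatched fun p => (k p).1 := by
  obtain ⟨i, hi⟩ := hS.exists_vertexDim_pos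
  let k₀ : TotalIndex S V := fun _ => ⟨fun _ => i, ⟨0, hi⟩⟩
  let f : TotalIndex S V → ℝ := fun k =>
    -∑ l : Edge V, if (k l.1.1).1 l.1.2 = (k l.head).1 l.1.2.opp then (1 : ℝ) else 0
  have hk₀ : f k₀ = -∑ l : Edge V, (1 : ℝ) := by
    simp [f, k₀]
  have hle : ∀ k : TotalIndex S V, ∀ l ∈ (Finset.univ : Finset (Edge V)),
      (if (k l.1.1).1 l.1.2 = (k l.head).1 l.1.2.opp then (1 : ℝ) else 0) ≤ 1 := by
    intro k l _
    split_ifs <;> norm_num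
  have hmin : ∀ k, f k₀ ≤ f k := fun k => by
    rw [hk₀]
    exact neg_le_neg (Finset.sum_le_sum (hle k))
  have hT : ∀ k, (-∑ l : Edge V, edgeTerm S l) (L.total k) = (f k : ℂ) • L.total k := by
    intro k
    rw [LinearMap.neg_apply, LinearMap.sum_apply]
    simp_rw [L.edgeTerm_total]
    rw [← Finset.sum_smul, ← neg_smul]
    congr 1
    simp only [f]
    push_cast
    exact congrArg Neg.neg (Finset.sum_congr rfl fun l _ => by split_ifs <;> simp)
  rw [edgeGroundStates, mem_groundStates_iff L.total hT hmin]
  refine forall_congr' fun k => imp_congr_right fun _ => ?_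
  rw [hk₀, neg_inj, Finset.sum_eq_sum_iff_of_le (hle k)]
  refine ⟨fun h l => ?_, fun h l _ => if_pos (h l)⟩
  have := h l (Finset.mem_univ l)
  by_contra hne
  rw [if_neg hne] at this
  exact zero_ne_one this

lemma LocalBasis.hasBoundary_iff (x : Leg V → ι) (ψ : Total S V) :
    HasBoundary S x ψ ↔
      ∀ k, L.total.repr ψ k ≠ 0 → (fun l : Leg V => (k l.1.1).1 l.1.2) = x := by
  have h : ∀ l : Leg V, atVertex S l.1.1 (labelProj S l.1.2 (x l)) ψ = ψ ↔
      ∀ k, L.total.repr ψ k ≠ 0 → (k l.1.1).1 l.1.2 = x l := by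
    intro l
    rw [← L.total.repr.injective.eq_iff, Finsupp.ext_iff]
    refine forall_congr' fun k => ?_
    rw [repr_diagonal L.total (fun k => L.atVertex_labelProj l.1.1 l.1.2 (x l) k)]
    by_cases hk : (k l.1.1).1 l.1.2 = x l
    · simp [hk]
    · simp [hk, eq_comm]
  simp_rw [HasBoundary, h, funext_iff]
  exact ⟨fun h k hk l => h l k hk, fun h l k hk => h k hk l⟩

/-! ### Counting product states -/

/-- The lattice edges labelled by the boundary condition, and arbitrarily elsewhere. -/
def extendLabels (i : ι) (x : Leg V → ι) (e : HalfEdge) : ι :=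
  open Classical in
  if h : ∃ l : Leg V, (toHalfEdge l.1).edge = e then x h.choose else i

/-- The choice is forced: the other half of an external edge starts outside the patch, so two legs
on the same edge coincide. -/
lemma extendLabels_edge (i : ι) (x : Leg V → ι) (l : Leg V) :
    extendLabels i x (toHalfEdge l.1).edge = x l := by
  have h : ∃ l' : Leg V, (toHalfEdge l'.1).edge = (toHalfEdge l.1).edge := ⟨l, rfl⟩
  rw [extendLabels, dif_pos h]
  congr 1
  rcases (HalfEdge.edge_eq_iff _ _).1 h.choose_spec with h1 | h1
  · exact Subtype.ext (toHalfEdge_injective h1)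
  · refine absurd h.choose.1.1.2 ?_
    have := congrArg Prod.fst h1
    change h.choose.1.1.1 = l.1.1.1 + l.1.2.vec at this
    rw [this]
    exact l.2

/-- The labels at the vertices of a labelling of the lattice edges. -/
def vertexLabels (y : HalfEdge → ι) (p : V) (d : Dir) : ι := y (HalfEdge.edge (p.1, d))

lemma leg_edge_notMem (l : Leg V) : (toHalfEdge l.1).edge ∉ intEdges V := fun h =>
  l.2 (edge_mem_intEdges.1 h).2

lemma isMatched_vertexLabels (y : HalfEdge → ι) : IsMatched (vertexLabels (V := V) y) := fun l =>
  congrArg y ((HalfEdge.edge_eq_iff _ _).2 (Or.inr (HalfEdge.flip_flip (l.1.1.1, l.1.2)).symm))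

/-- Matched labels with a boundary condition are labels of the internal edges. -/
lemma matched_iff_exists (i : ι) (x : Leg V → ι) (a : V → Dir → ι) :
    (IsMatched a ∧ (fun l : Leg V => a l.1.1 l.1.2) = x) ↔ ∃ c : intEdges V → ι,
      a = vertexLabels (Function.updateFinset (extendLabels i x) (intEdges V) c) := by
  constructor
  · rintro ⟨hm, rfl⟩
    -- Each internal edge takes the label of its outgoing half; at incoming halves the matching
    -- condition at that edge gives the same value.
    refine ⟨fun e => a ⟨e.1.1, (mem_intEdges.1 e.2).1⟩ e.1.2, ?_⟩
    funext p d
    by_cases h : p.1 + d.vec ∈ V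
    · have he : HalfEdge.edge (p.1, d) ∈ intEdges V := edge_mem_intEdges.2 ⟨p.2, h⟩
      rw [vertexLabels, Function.updateFinset, dif_pos he]
      by_cases ho : d.IsOutgoing
      · have : HalfEdge.edge (p.1, d) = (p.1, d) := if_pos ho
        simp only [this]
      · have h1 : HalfEdge.edge (p.1, d) = (p.1 + d.vec, d.opp) := if_neg ho
        have ho' : d.opp.IsOutgoing := (Dir.isOutgoing_opp d).2 ho
        have h2 : p.1 + d.vec + d.opp.vec = p.1 := by rw [Dir.vec_opp, add_neg_cancel_right]
        have h3 := hm ⟨(⟨p.1 + d.vec, h⟩, d.opp), ho', by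
          dsimp only
          rw [h2]
          exact p.2⟩
        simp only [h1]
        refine Eq.trans ?_ h3.symm
        have h4 : Edge.head (V := V) ⟨(⟨p.1 + d.vec, h⟩, d.opp), ho', by
          dsimp only
          rw [h2]
          exact p.2⟩ = p := Subtype.ext h2
        rw [h4, Dir.opp_opp]
    · have hl : HalfEdge.edge (p.1, d) ∉ intEdges V := leg_edge_notMem (V := V) ⟨(p, d), h⟩
      have hx := extendLabels_edge i (fun l : Leg V => a l.1.1 l.1.2) ⟨(p, d), h⟩
      rw [vertexLabels, Function.updateFinset, dif_neg hl]
      exact hx.symm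
  · rintro ⟨c, rfl⟩
    refine ⟨isMatched_vertexLabels _, ?_⟩
    funext l
    have hl := leg_edge_notMem l
    have hx := extendLabels_edge i x l
    change Function.updateFinset _ _ _ (toHalfEdge l.1).edge = _
    rw [Function.updateFinset, dif_neg hl, hx]

lemma vertexLabels_updateFinset_injective (x : HalfEdge → ι) :
    Function.Injective fun c : intEdges V → ι =>
      vertexLabels (V := V) (Function.updateFinset x (intEdges V) c) := by
  intro c c' h
  funext e
  have he := mem_intEdges.1 e.2
  have h1 := congrFun (congrFun h ⟨e.1.1, he.1⟩) e.1.2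
  have h2 : HalfEdge.edge (e.1.1, e.1.2) = e.1 := if_pos he.2.1
  simpa only [vertexLabels, h2, Function.updateFinset, dif_pos e.2] using h1

omit [DecidableEq ι] in
lemma card_fiber (N : (Dir → ι) → ℕ) (a : V → Dir → ι) :
    Nat.card {k : ∀ _ : V, Σ a : Dir → ι, Fin (N a) // (fun p => (k p).1) = a} =
      ∏ p, N (a p) := by
  have e : {k : ∀ _ : V, Σ a : Dir → ι, Fin (N a) // (fun p => (k p).1) = a} ≃
      ∀ p : V, {s : Σ a : Dir → ι, Fin (N a) // s.1 = a p} :=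
    (Equiv.subtypeEquivRight fun k => funext_iff).trans
      (Equiv.subtypePiEquivPi (p := fun p (s : Σ a : Dir → ι, Fin (N a)) => s.1 = a p))
  rw [Nat.card_congr (e.trans (Equiv.piCongrRight fun p => Equiv.sigmaSubtype (a p))), Nat.card_pi]
  simp

end ModelBasis

/-! ### Equality of the two dimensions. -/

section Count

variable {C : Type u} [Category.{v} C] [Abelian C] [Linear ℂ C]
  [MonoidalCategory C] [MonoidalPreadditive C] [MonoidalLinear ℂ C]
  [UnitaryFusionCategory C] (D : SphericalStructure C)
  {ι : Type w} [Fintype ι] [DecidableEq ι] {S : ι → C}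

variable (S) in
lemma vertexWeight_skeinDim (A : C) {V : Finset (ℤ × ℤ)} (y : HalfEdge → ι) (p : V) :
    vertexWeight (skeinDim D S A) p.1 y = vertexDim S (vertexLabels y p) :=
  skeinDim_vertex D A _ _ _ _

variable (S) in
/-- The product states with matching labels and a given boundary condition are counted by the
state sum. -/
lemma card_matched_eq_stateSum (A : C) {V : Finset (ℤ × ℤ)} (i : ι) (x : Leg V → ι) :
    Nat.card {k : TotalIndex S V // IsMatched (fun p => (k p).1) ∧
        (fun l : Leg V => (k l.1.1).1 l.1.2) = x} =
      stateSum (skeinDim D S A) V (extendLabels i x) := by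
  let lab : (intEdges V → ι) → V → Dir → ι := fun c =>
    vertexLabels (Function.updateFinset (extendLabels i x) (intEdges V) c)
  have hlab : Function.Injective lab := vertexLabels_updateFinset_injective _
  have hP : ∀ k : TotalIndex S V, (IsMatched (fun p => (k p).1) ∧
      (fun l : Leg V => (k l.1.1).1 l.1.2) = x) ↔ ∃ c, (fun p => (k p).1) = lab c :=
    fun k => matched_iff_exists i x fun p => (k p).1
  let e : (Σ c : intEdges V → ι, {k : TotalIndex S V // (fun p => (k p).1) = lab c}) ≃
      {k : TotalIndex S V // IsMatched (fun p => (k p).1) ∧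
        (fun l : Leg V => (k l.1.1).1 l.1.2) = x} :=
    Equiv.ofBijective (fun s => ⟨s.2.1, (hP _).2 ⟨s.1, s.2.2⟩⟩) <| by
      constructor
      · rintro ⟨c, k, hk⟩ ⟨c', k', hk'⟩ h
        obtain rfl : k = k' := congrArg Subtype.val h
        obtain rfl : c = c' := hlab (hk.symm.trans hk')
        rfl
      · rintro ⟨k, hk⟩
        obtain ⟨c, hc⟩ := (hP k).1 hk
        exact ⟨⟨c, k, hc⟩, rfl⟩
  rw [← Nat.card_congr e, Nat.card_sigma, stateSum, marginal]
  refine Finset.sum_congr rfl fun c _ => ?_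
  exact (card_fiber (vertexDim S) (lab c)).trans ((Finset.prod_congr rfl fun p _ =>
    (vertexWeight_skeinDim D S A _ p).symm).trans (Finset.prod_coe_sort V fun v =>
      vertexWeight (skeinDim D S A) v
        (Function.updateFinset (extendLabels i x) (intEdges V) c)))

lemma IsIrr.isWordSum_skeinDim (hS : IsIrr S) (I : C ⥤ Center C) (adj : Center.forget C ⊣ I) :
    IsWordSum (skeinDim D S (I.obj (𝟙_ C)).1) := by
  obtain ⟨s, h1, h2, h3⟩ := exists_component_splitting D hS I adj
  exact ⟨fun L M n => skeinDim_swap D S _ L M n,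
    fun L M s n m => sum_skeinDim_glue D hS _ L M s n m,
    fun L n => sum_skeinDim_pair D _ s h1 h2 h3 L n⟩

variable (S) in
lemma tensorFam_eq_wordObj {α : Type*} (f : α → ι × Bool) (L : List α) :
    tensorFam L.length (fun k => letterObj D S (f (L.get k))) = wordObj D S (L.map f) := by
  induction L with
  | nil => rfl
  | cons a L ih => exact congrArg (letterObj D S (f a) ⊗ ·) ih

variable (S) in
lemma boundaryObj_eq_wordObj {V : Finset (ℤ × ℤ)} (b : Leg V) (x : Leg V → ι) :
    boundaryObj D S b x =
      wordObj D S ((legList b).map fun l => (x l, decide l.1.2.IsOutgoing)) := by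
  rw [← tensorFam_eq_wordObj, boundaryObj]
  congr 1
  funext k
  simp [legObj, letterObj]

/-- The outline may be cut at `b` because of cyclic invariance, and `legList b` is this outline, so
the boundary object is the word of the state sum formula. -/
lemma homRank_boundaryObj (hS : IsIrr S) (I : C ⥤ Center C) (adj : Center.forget C ⊣ I)
    {V : Finset (ℤ × ℤ)} (hV : IsContractiblePatch V) (b : Leg V) (i : ι) (x : Leg V → ι) :
    homRank (boundaryObj D S b x) (tensorPow (I.obj (𝟙_ C)).1 (numPlaquettes V)) =
      stateSum (skeinDim D S (I.obj (𝟙_ C)).1) V (extendLabels i x) := by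
  have hT := hS.isWordSum_skeinDim D I adj
  obtain ⟨R, h1, h2⟩ := (hV.hasOutline hT).exists_rotate hT (l := toHalfEdge b.1) b.1.1.2 b.2
  rw [h2, ← h1.legList_eq, List.map_map, boundaryObj_eq_wordObj, skeinDim]
  congr 3
  funext l
  exact Prod.ext (extendLabels_edge i x l).symm rfl

end Count

/-! ### The skein inner product and the resulting unitary. -/

section Unitary

variable {C : Type u} [Category.{v} C] [Abelian C] [Linear ℂ C]
  [MonoidalCategory C] [MonoidalPreadditive C] [MonoidalLinear ℂ C]
  [UnitaryFusionCategory C] (D : SphericalStructure C)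
  {ι : Type w} [Fintype ι] [DecidableEq ι] {S : ι → C}

/-- A sum of trace forms with positive weights. It is definite because the components jointly split
the power of `FI(1)`: a map with vanishing components factors through a zero resolution of the
identity. -/
lemma isInnerForm_skeinInner (hS : IsIrr S) (I : C ⥤ Center C) (adj : Center.forget C ⊣ I)
    {V : Finset (ℤ × ℤ)} (b : Leg V) (x : Leg V → ι) (n : ℕ) :
    IsInnerForm (skeinInner D S b x (I.obj (𝟙_ C)) (adj.counit.app (𝟙_ C)) n) := by
  obtain ⟨s, -, -, hs⟩ := exists_component_splitting D hS I adj
  let c (j : Fin n → ι) :=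
    tensorFamMap n fun k => component D (I.obj (𝟙_ C)) (adj.counit.app (𝟙_ C)) (S (j k))
  refine IsInnerForm.sum_comp (fun j : Fin n → ι => isInnerForm_trInner D (boundaryObj D S b x) _)
    (fun j => Linear.rightComp ℂ (boundaryObj D S b x) (c j))
    (fun j => (√(∏ l, dim D (S (x l))) * ∏ k, dim D (S (j k)))⁻¹) (fun j => ?_) fun f hf => ?_
  · exact inv_pos.2 (mul_pos (Real.sqrt_pos.2 (Finset.prod_pos fun l _ => hS.dim_pos D _))
      (Finset.prod_pos fun k _ => hS.dim_pos D _))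
  · have h := sum_tensorFamMap _ s hs n
    rw [← Category.comp_id f]
    refine (congrArg (f ≫ ·) h.symm).trans ?_
    rw [Preadditive.comp_sum]
    refine Finset.sum_eq_zero fun j _ => ?_
    rw [← Category.assoc]
    have h0 : f ≫ c j = 0 := hf j
    exact (congrArg (· ≫ _) h0).trans zero_comp

end Unitary

end StringNet

end

theorem mainTheorem7 {C : Type u} [Category.{v} C] [Abelian C] [Linear ℂ C]
    [MonoidalCategory C] [MonoidalPreadditive C] [MonoidalLinear ℂ C]
    [StringNet.UnitaryFusionCategory C] (D : StringNet.SphericalStructure C)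
    {ι : Type w} [Fintype ι] [DecidableEq ι] (S : ι → C) (hS : StringNet.IsIrr S)
    (I : C ⥤ Center C) (adj : Center.forget C ⊣ I)
    (V : Finset (ℤ × ℤ)) (hV : StringNet.IsContractiblePatch V) (b : StringNet.Leg V) :
    ∃ U : StringNet.edgeGroundStates S V ≃ₗ[ℂ]
        ((x : StringNet.Leg V → ι) → (StringNet.boundaryObj D S b x ⟶
          StringNet.tensorPow ((Center.forget C).obj (I.obj (𝟙_ C)))
            (StringNet.numPlaquettes V))),
      (∀ φ ψ : StringNet.edgeGroundStates S V,
        StringNet.totalInner D S V φ ψ =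
          ∑ x, StringNet.skeinInner D S b x (I.obj (𝟙_ C)) (adj.counit.app (𝟙_ C))
            (StringNet.numPlaquettes V) (U φ x) (U ψ x)) ∧
      (∀ (ψ : StringNet.edgeGroundStates S V) (x : StringNet.Leg V → ι),
        StringNet.HasBoundary S x (ψ : StringNet.Total S V) ↔ ∀ y, y ≠ x → U ψ y = 0) := by
  classical
  obtain ⟨L⟩ := hS.exists_localBasis D
  obtain ⟨i, -⟩ := hS.exists_vertexDim_pos
  obtain ⟨U, h1, h2⟩ := StringNet.exists_unitary L.total L.totalInner_eq_sum
    (L.mem_edgeGroundStates hS) (fun k l => (k l.1.1).1 l.1.2)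
    (fun x => StringNet.isInnerForm_skeinInner D hS I adj b x (StringNet.numPlaquettes V))
    -- The cardinality condition at `x`: matched product states and the dimension of the skein space
    -- are both equal to the state sum.
    fun x => by
      rw [← Nat.card_eq_fintype_card]
      exact (StringNet.card_matched_eq_stateSum D S (I.obj (𝟙_ C)).1 i x).trans
        (StringNet.homRank_boundaryObj D hS I adj hV b i x).symm
  exact ⟨U, h1, fun ψ x => (L.hasBoundary_iff x _).trans (h2 ψ x)⟩
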